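/- Let $D$ be a negative fundamental discriminant, $K=\mathbb{Q}(\sqrt{D})\subset\mathbb{C}$, $h$ the class number of $K$, $w$ the number of units of its ring of integers, and $\chi_D$ the Dirichlet character modulo $|D|$ given by the Kronecker symbol $\chi_D(n)=\left(\frac{D}{n}\right)$, with $L$-function $L(\chi_D,s)$ (analytically continued to $\mathbb{C}$). To an ideal class of $K$, represented by a fractional ideal $\mathfrak{a}=\mathbb{Z}a+\mathbb{Z}b$ with an oriented $\mathbb{Z}$-basis $a,b$ (that is, $\operatorname{Im}(b\bar a)>0$), one attaches the point $[\rho_{\mathfrak a}]$ of $\mathrm{SL}_2(\mathbb{Z})\backslash\mathbb{H}$ with $\rho_{\mathfrak a}=b/a\in\mathbb{H}$; it depends only on the ideal class. The Heegner divisor is $$H(D)=\frac{2}{w}\sum_{[\mathfrak a]}[\rho_{\mathfrak a}],$$ where the sum is over all ideal classes of $K$. The divisor on $\mathrm{SL}_2(\mathbb{Z})\backslash\mathbb{H}$ of a nonzero modular form $f$ for $\mathrm{SL}_2(\mathbb{Z})$ assigns to $[\tau]$ the multiplicity $\operatorname{ord}_\tau(f)/e_\tau$, where $e_\tau$ is the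 order of the stabilizer of $\tau$ in $\mathrm{SL}_2(\mathbb{Z})/\{\pm1\}$. Theorem. (i) The degree of $H(D)$, that is, the sum of its multiplicities, is equal to $L(\chi_D,0)$. (ii) There is a unique modular form $\Psi_D$ for $\mathrm{SL}_2(\mathbb{Z})$ (of some weight) whose divisor is $H(D)$ and whose value at the cusp $\infty$ is $1$. Its weight is $k=24h/w$. The function $\log\left(|\Psi_D(\tau)|^2(4\pi y)^k\right)$, where $\tau=x+iy$, is integrable over $\mathrm{SL}_2(\mathbb{Z})\backslash\mathbb{H}$ with respect to $\frac{dx\,dy}{y^2}$, and $$\frac{1}{L(\chi_D,0)}\int_{\mathrm{SL}_2(\mathbb{Z})\backslash\mathbb{H}}\log\left(|\Psi_D(\tau)|^2(4\pi y)^k\right)\frac{dx\,dy}{4\pi y^2}=2\,\frac{\zeta'(-1)}{\zeta(-1)}+1-\frac{L'(\chi_D,0)}{L(\chi_D,0)}-\frac12\log|D|.$$ -/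

import Mathlib

open UpperHalfPlane NumberField
open scoped MatrixGroups nonZeroDivisors ComplexConjugate NumberTheorySymbols

namespace HeegnerDivisor

/-- `D` is a negative fundamental discriminant. -/
def IsNegFundamentalDiscriminant (D : ℤ) : Prop :=
  D < 0 ∧ ((D % 4 = 1 ∧ Squarefree D) ∨
    ∃ m : ℤ, D = 4 * m ∧ (m % 4 = 2 ∨ m % 4 = 3) ∧ Squarefree m)

/-- The Kronecker symbol `(D / n)` for `n ≥ 0`: if `n = 2 ^ e * m` with `m` odd, it is
`(D / 2) ^ e` times the Jacobi symbol `(D / m)`, where `(D / 2)` is `0`, `1`, `-1` according as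
`D` is even, `D ≡ ±1 (mod 8)`, `D ≡ ±3 (mod 8)`; this is the value `χ₈ D`. -/
def kronecker (D : ℤ) (n : ℕ) : ℤ :=
  if n = 0 then (if D.natAbs = 1 then 1 else 0)
  else ZMod.χ₈ (D : ZMod 8) ^ n.factorization 2 * J(D | ordCompl[2] n)

theorem kronecker_of_odd {D : ℤ} {n : ℕ} (hn : n % 2 = 1) : kronecker D n = J(D | n) := by
  have h0 : n ≠ 0 := by rintro rfl; simp at hn
  have h2 : n.factorization 2 = 0 := Nat.factorization_eq_zero_of_not_dvd (by omega)
  simp [kronecker, h0, h2]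

theorem kronecker_of_one_mod_four {D : ℤ} (h : D < 0) (h4 : D % 4 = 1) (n : ℕ) :
    kronecker D n = J((n : ℤ) | D.natAbs) := by
  obtain ⟨N, rfl⟩ : ∃ N : ℕ, D = -(N : ℤ) := ⟨D.natAbs, by omega⟩
  have hN : N % 4 = 3 := by omega
  have hNo : Odd N := Nat.odd_iff.2 (by omega)
  simp only [Int.natAbs_neg, Int.natAbs_natCast]
  by_cases h0 : n = 0
  · subst h0
    have : N ≠ 1 := by omega
    simp [kronecker, this, jacobiSym.zero_left (b := N) (by omega)]
  have hodd : Odd (ordCompl[2] n) := by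
    rw [← Nat.not_even_iff_odd, even_iff_two_dvd]
    exact Nat.not_dvd_ordCompl Nat.prime_two h0
  have e8 : ZMod.χ₈ ((-(N : ℤ) : ℤ) : ZMod 8) = J(2 | N) := by
    rw [jacobiSym.at_two hNo]
    push_cast
    generalize (N : ZMod 8) = x
    revert x; decide
  have e1 : J(-(N : ℤ) | ordCompl[2] n) = J(((ordCompl[2] n : ℕ) : ℤ) | N) := by
    generalize ordCompl[2] n = b at hodd
    rw [jacobiSym.neg _ hodd, ← jacobiSym.quadratic_reciprocity_if (a := N) (b := b) (by omega)
      (Nat.odd_iff.1 hodd)]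
    have := Nat.odd_iff.1 hodd
    rcases (by omega : b % 4 = 1 ∨ b % 4 = 3) with hb | hb
    · simp [hN, hb, ZMod.χ₄_nat_one_mod_four hb]
    · simp [hN, hb, ZMod.χ₄_nat_three_mod_four hb]
  rw [kronecker, if_neg h0, e8, e1, ← jacobiSym.pow_left, ← jacobiSym.mul_left]
  congr 1
  exact_mod_cast Nat.ordProj_mul_ordCompl_eq_self n 2

theorem kronecker_of_four_dvd {D : ℤ} (h : D < 0) (h4 : D % 4 = 0) (n : ℕ) :
    kronecker D n = if n % 2 = 1 then J(D | n) else 0 := by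
  split_ifs with hn
  · exact kronecker_of_odd hn
  · by_cases h0 : n = 0
    · have : D.natAbs ≠ 1 := by omega
      simp [kronecker, h0, this]
    · have h2 : n.factorization 2 ≠ 0 :=
        (Nat.Prime.factorization_pos_of_dvd Nat.prime_two h0 (by omega)).ne'
      have e8 : ZMod.χ₈ (D : ZMod 8) = 0 := by
        rw [ZMod.χ₈_int_eq_if_mod_eight, if_pos (by omega)]
      simp [kronecker, h0, e8, h2]

theorem kronecker_mod {D : ℤ} (h : D < 0) (h4 : D % 4 = 0 ∨ D % 4 = 1) (n : ℕ) :
    kronecker D (n % D.natAbs) = kronecker D n := by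
  rcases h4 with h4 | h4
  · rw [kronecker_of_four_dvd h h4, kronecker_of_four_dvd h h4]
    have h2 : 2 ∣ D.natAbs := by omega
    rw [Nat.mod_mod_of_dvd _ h2]
    split_ifs with hn
    · have hn' : n % D.natAbs % 2 = 1 := by rwa [Nat.mod_mod_of_dvd _ h2]
      rw [← jacobiSym.div_four_left h4 hn, ← jacobiSym.div_four_left h4 hn',
        jacobiSym.mod_right _ (Nat.odd_iff.2 hn)]
      congr 2
      omega
    · rfl
  · rw [kronecker_of_one_mod_four h h4, kronecker_of_one_mod_four h h4, jacobiSym.mod_left (n : ℤ)]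
    simp

theorem kronecker_mul {D : ℤ} (h : D.natAbs ≠ 1) (m n : ℕ) :
    kronecker D (m * n) = kronecker D m * kronecker D n := by
  by_cases hm : m = 0
  · simp [kronecker, hm, h]
  by_cases hn : n = 0
  · simp [kronecker, hn, h]
  have a1 : NeZero (ordCompl[2] m) := ⟨(Nat.ordCompl_pos 2 hm).ne'⟩
  have a2 : NeZero (ordCompl[2] n) := ⟨(Nat.ordCompl_pos 2 hn).ne'⟩
  rw [kronecker, kronecker, kronecker, if_neg hm, if_neg hn, if_neg (mul_ne_zero hm hn),
    Nat.ordCompl_mul, jacobiSym.mul_right, Nat.factorization_mul hm hn, Finsupp.add_apply, pow_add]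
  ring

theorem kronecker_eq_zero {D : ℤ} (h : D < 0) (h4 : D % 4 = 0 ∨ D % 4 = 1) {n : ℕ}
    (hn : ¬ n.Coprime D.natAbs) : kronecker D n = 0 := by
  rcases h4 with h4 | h4
  · rw [kronecker_of_four_dvd h h4]
    split_ifs with h1
    · refine jacobiSym.eq_zero_iff.2 ⟨by rintro rfl; simp at h1, ?_⟩
      rwa [Nat.coprime_comm] at hn
    · rfl
  · rw [kronecker_of_one_mod_four h h4]
    exact jacobiSym.eq_zero_iff.2 ⟨by omega, hn⟩

theorem IsNegFundamentalDiscriminant.mod_four {D : ℤ} (h : IsNegFundamentalDiscriminant D) :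
    D % 4 = 0 ∨ D % 4 = 1 := by
  rcases h.2 with h | ⟨m, h, -⟩ <;> omega

/-- The Dirichlet character `χ_D` modulo `|D|` given by the Kronecker symbol,
`χ_D(n) = (D / n)`. -/
noncomputable def kroneckerChar (D : ℤ) (hD : IsNegFundamentalDiscriminant D) :
    DirichletCharacter ℂ D.natAbs where
  toFun a := (kronecker D a.val : ℂ)
  map_one' := by
    have h := hD.1
    have h4 := hD.mod_four
    have : Fact (1 < D.natAbs) := ⟨by omega⟩
    simp [ZMod.val_one, kronecker_of_odd]
  map_mul' a b := by
    have h := hD.1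
    have h4 := hD.mod_four
    rw [ZMod.val_mul, kronecker_mod h h4, kronecker_mul (by omega)]
    push_cast
    rfl
  map_nonunit' a ha := by
    have h := hD.1
    have h4 := hD.mod_four
    have : NeZero D.natAbs := ⟨by omega⟩
    rw [← ZMod.natCast_zmod_val a, ZMod.isUnit_iff_coprime] at ha
    simp only [kronecker_eq_zero h h4 ha, Int.cast_zero]

theorem kroneckerChar_natCast (D : ℤ) (hD : IsNegFundamentalDiscriminant D) (n : ℕ) :
    kroneckerChar D hD (n : ZMod D.natAbs) = (kronecker D n : ℂ) := by
  change (kronecker D (n : ZMod D.natAbs).val : ℂ) = _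
  rw [ZMod.val_natCast, kronecker_mod hD.1 hD.mod_four]

/-- The `L`-function `L(χ_D, s)`, that is, the analytic continuation to all `s ∈ ℂ` of the Dirichlet
series `∑ χ_D(n) n ^ (-s)`. -/
noncomputable def kroneckerL (D : ℤ) (hD : IsNegFundamentalDiscriminant D) (s : ℂ) : ℂ :=
  haveI : NeZero D.natAbs := ⟨Int.natAbs_ne_zero.2 hD.1.ne⟩
  DirichletCharacter.LFunction (kroneckerChar D hD) s

/-- The square root `i √|D|` of a negative integer `D` in the upper half-plane. -/
noncomputable def sqrtDisc (D : ℤ) : ℂ := Complex.I * (√(-(D : ℝ)) : ℝ)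

theorem sqrtDisc_sq {D : ℤ} (h : D < 0) : sqrtDisc D ^ 2 = D := by
  have h' : (0 : ℝ) ≤ -(D : ℝ) := by
    have : (D : ℝ) < 0 := by exact_mod_cast h
    linarith
  rw [sqrtDisc, mul_pow, Complex.I_sq, ← Complex.ofReal_pow, Real.sq_sqrt h']
  push_cast
  ring

theorem sqrtDisc_im_pos {D : ℤ} (h : D < 0) : 0 < (sqrtDisc D).im := by
  have : (D : ℝ) < 0 := by exact_mod_cast h
  simp only [sqrtDisc, Complex.I_mul_im, Complex.ofReal_re]
  exact Real.sqrt_pos.2 (by linarith)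

theorem isIntegral_sqrtDisc (D : ℤ) : IsIntegral ℤ (sqrtDisc D) := by
  rcases lt_or_ge D 0 with h | h
  · refine IsIntegral.of_pow (n := 2) two_pos ?_
    rw [sqrtDisc_sq h]
    exact isIntegral_algebraMap (R := ℤ) (x := D)
  · have : (D : ℝ) ≥ 0 := by exact_mod_cast h
    have h0 : √(-(D : ℝ)) = 0 := Real.sqrt_eq_zero_of_nonpos (by linarith)
    simpa [sqrtDisc, h0] using isIntegral_zero

/-- The imaginary quadratic field `K = ℚ(√D)`, as a subfield of `ℂ`. -/
noncomputable def quadField (D : ℤ) : IntermediateField ℚ ℂ :=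
  IntermediateField.adjoin ℚ {sqrtDisc D}

instance instNumberFieldQuadField (D : ℤ) : NumberField (quadField D) where
  to_charZero := inferInstance
  to_finiteDimensional :=
    IntermediateField.adjoin.finiteDimensional (isIntegral_sqrtDisc D).tower_top

theorem finrank_quadField {D : ℤ} (h : D < 0) : Module.finrank ℚ (quadField D) = 2 := by
  have hint : IsIntegral ℚ (sqrtDisc D) := (isIntegral_sqrtDisc D).tower_top
  have : Module.finrank ℚ (quadField D) = (minpoly ℚ (sqrtDisc D)).natDegree :=
    IntermediateField.adjoin.finrank hint
  rw [this]
  apply le_antisymm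
  · have hm : (Polynomial.X ^ 2 - Polynomial.C (D : ℚ)).Monic :=
      Polynomial.monic_X_pow_sub_C _ two_ne_zero
    have := Polynomial.natDegree_le_natDegree (minpoly.min ℚ (sqrtDisc D) hm
      (by simp [sqrtDisc_sq h]))
    rwa [Polynomial.natDegree_X_pow_sub_C] at this
  · rw [minpoly.two_le_natDegree_iff hint]
    rintro ⟨q, hq⟩
    have := sqrtDisc_im_pos h
    rw [← hq] at this
    simp at this

/-- The quotient `SL₂(ℤ) \ ℍ`. -/
abbrev ModularCurve : Type := MulAction.orbitRel.Quotient SL(2, ℤ) ℍ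

/-- The class `[τ]` in `SL₂(ℤ) \ ℍ` of a point `τ ∈ ℍ`. -/
noncomputable def toModularCurve (τ : ℍ) : ModularCurve := Quotient.mk _ τ

/-- `a, b` is an oriented `ℤ`-basis of the fractional ideal `𝔞` of `K`: it is a `ℤ`-basis, and
`Im (b ā) > 0`. -/
def IsOrientedBasis (D : ℤ) (𝔞 : (FractionalIdeal (𝓞 (quadField D))⁰ (quadField D))ˣ)
    (a b : quadField D) : Prop :=
  LinearIndependent ℤ ![a, b] ∧
  (∀ x : quadField D, x ∈ (𝔞 : FractionalIdeal (𝓞 (quadField D))⁰ (quadField D)) ↔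
    x ∈ Submodule.span ℤ {a, b}) ∧
  0 < ((b : ℂ) * conj (a : ℂ)).im

/-- `P` is the point `[b / a]` attached to some fractional ideal `𝔞` in the ideal class `C` and some
oriented `ℤ`-basis `a, b` of `𝔞`. -/
def IsHeegnerPoint (D : ℤ) (C : ClassGroup (𝓞 (quadField D))) (P : ModularCurve) : Prop :=
  ∃ (𝔞 : (FractionalIdeal (𝓞 (quadField D))⁰ (quadField D))ˣ) (a b : quadField D) (ρ : ℍ),
    ClassGroup.mk (quadField D) 𝔞 = C ∧ IsOrientedBasis D 𝔞 a b ∧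
      (ρ : ℂ) = (b : ℂ) / (a : ℂ) ∧ P = toModularCurve ρ

theorem im_div_eq (a b : ℂ) : (b / a).im = (b * conj a).im / Complex.normSq a := by
  rw [div_eq_mul_inv, Complex.inv_def, ← mul_assoc, mul_comm _ ((_ : ℝ) : ℂ), Complex.im_ofReal_mul]
  field_simp

/-- Every fractional ideal has an oriented `ℤ`-basis, so every ideal class has a Heegner point. -/
theorem exists_isHeegnerPoint {D : ℤ} (h : D < 0) (C : ClassGroup (𝓞 (quadField D))) :
    ∃ P, IsHeegnerPoint D C P := by
  obtain ⟨𝔞, rfl⟩ : ∃ 𝔞, ClassGroup.mk (quadField D) 𝔞 = C := by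
    obtain ⟨I, rfl⟩ := ClassGroup.mk0_surjective C
    exact ⟨FractionalIdeal.mk0 _ I, ClassGroup.mk_mk0 _ I⟩
  have hc : Fintype.card (Module.Free.ChooseBasisIndex ℤ
      (𝔞 : FractionalIdeal (𝓞 (quadField D))⁰ (quadField D))) = Fintype.card (Fin 2) := by
    rw [← Module.finrank_eq_card_basis (basisOfFractionalIdeal (quadField D) 𝔞),
      finrank_quadField h, Fintype.card_fin]
  let e := (basisOfFractionalIdeal (quadField D) 𝔞).reindex (Fintype.equivOfCardEq hc)
  have hspan : ∀ x : quadField D,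
      x ∈ (𝔞 : FractionalIdeal (𝓞 (quadField D))⁰ (quadField D)) ↔
        x ∈ Submodule.span ℤ {e 0, e 1} := by
    intro x
    have : ({e 0, e 1} : Set (quadField D)) =
        Set.range (basisOfFractionalIdeal (quadField D) 𝔞) := by
      have he : Set.range e = Set.range (basisOfFractionalIdeal (quadField D) 𝔞) :=
        Module.Basis.range_reindex _ (Fintype.equivOfCardEq hc)
      rw [← he]
      ext y
      simp only [Set.mem_range, Fin.exists_fin_two, Set.mem_insert_iff, Set.mem_singleton_iff,
        eq_comm]
    rw [this]
    exact (mem_span_basisOfFractionalIdeal (quadField D)).symm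
  have hli : LinearIndependent ℤ e := e.linearIndependent.restrict_scalars' ℤ
  have hpair : LinearIndependent ℤ ![e 0, e 1] := by
    have he : ![e 0, e 1] = e := by
      ext i
      fin_cases i <;> rfl
    rw [he]
    exact hli
  have ha : (e 0 : ℂ) ≠ 0 := by
    have := e.ne_zero 0
    exact_mod_cast this
  have hin : sqrtDisc D ∈ quadField D := IntermediateField.subset_adjoin ℚ _ rfl
  have hne : ((e 1 : ℂ) / (e 0 : ℂ)).im ≠ 0 := by
    intro h0
    let w : 𝓞 (quadField D) := ⟨⟨sqrtDisc D, hin⟩, by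
      have := isIntegral_sqrtDisc D
      exact (isIntegral_algHom_iff ((quadField D).val.restrictScalars ℤ)
        Subtype.val_injective).1 this⟩
    have hm : w • e 0 ∈ (𝔞 : FractionalIdeal (𝓞 (quadField D))⁰ (quadField D)) :=
      Submodule.smul_mem _ w ((hspan _).2 (Submodule.subset_span (by simp)))
    rw [hspan, Submodule.mem_span_pair] at hm
    obtain ⟨m, n, hmn⟩ := hm
    have hw : ((w • e 0 : quadField D) : ℂ) = sqrtDisc D * (e 0 : ℂ) := rfl
    have hmn' := congrArg (Subtype.val : quadField D → ℂ) hmn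
    rw [hw] at hmn'
    have h1 : (m : ℂ) * (e 0 : ℂ) + (n : ℂ) * (e 1 : ℂ) = sqrtDisc D * (e 0 : ℂ) := by
      rw [← hmn']; simp
    have h2 : sqrtDisc D = m + n * ((e 1 : ℂ) / (e 0 : ℂ)) := by
      field_simp
      linear_combination -h1
    have h3 := sqrtDisc_im_pos h
    rw [h2] at h3
    simp [h0] at h3
  rw [im_div_eq] at hne
  have hN : 0 < Complex.normSq (e 0 : ℂ) := Complex.normSq_pos.2 ha
  have hb : (e 1 : ℂ) ≠ 0 := by
    have := e.ne_zero 1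
    exact_mod_cast this
  have hN' : 0 < Complex.normSq (e 1 : ℂ) := Complex.normSq_pos.2 hb
  rcases lt_or_gt_of_ne (show ((e 1 : ℂ) * conj (e 0 : ℂ)).im ≠ 0 by
    intro h0; simp [h0] at hne) with hs | hs
  · have hs' : 0 < ((e 0 : ℂ) * conj (e 1 : ℂ)).im := by
      have : (e 0 : ℂ) * conj (e 1 : ℂ) = conj ((e 1 : ℂ) * conj (e 0 : ℂ)) := by
        simp [mul_comm]
      rw [this, Complex.conj_im]
      linarith
    refine ⟨_, 𝔞, e 1, e 0, ⟨(e 0 : ℂ) / (e 1 : ℂ), ?_⟩, rfl, ⟨?_, ?_, hs'⟩, rfl, rfl⟩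
    · rw [im_div_eq]; positivity
    · exact LinearIndependent.pair_symm_iff.1 hpair
    · intro x; rw [hspan, Set.pair_comm]
  · refine ⟨_, 𝔞, e 0, e 1, ⟨(e 1 : ℂ) / (e 0 : ℂ), ?_⟩, rfl, ⟨?_, hspan, hs⟩, rfl, rfl⟩
    · rw [im_div_eq]; positivity
    · exact hpair

/-- The Heegner point depends only on the ideal class. -/
theorem IsHeegnerPoint.unique {D : ℤ} {C : ClassGroup (𝓞 (quadField D))} {P Q : ModularCurve}
    (hP : IsHeegnerPoint D C P) (hQ : IsHeegnerPoint D C Q) : P = Q := by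
  obtain ⟨𝔞, a, b, ρ, rfl, ⟨-, hs, ho⟩, hρ, rfl⟩ := hP
  obtain ⟨𝔟, c, d, σ, hC, ⟨hli', hs', ho'⟩, hσ, rfl⟩ := hQ
  -- the two ideals differ by a principal one
  obtain ⟨x, hx⟩ : ∃ x : (quadField D)ˣ, 𝔟 * toPrincipalIdeal (𝓞 (quadField D)) _ x = 𝔞 := by
    have := congrArg (ClassGroup.equiv (quadField D)) hC
    rw [ClassGroup.equiv_mk, ClassGroup.equiv_mk] at this
    simp only [FractionalIdeal.canonicalEquiv_self] at this
    have := (QuotientGroup.mk'_eq_mk' _).1 this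
    obtain ⟨z, ⟨x, rfl⟩, hz⟩ := this
    exact ⟨x, by simpa [Units.ext_iff] using hz⟩
  have hmem : ∀ y : quadField D, y ∈ (𝔟 : FractionalIdeal (𝓞 (quadField D))⁰ (quadField D)) ↔
      (x : quadField D) * y ∈ (𝔞 : FractionalIdeal (𝓞 (quadField D))⁰ (quadField D)) := by
    intro y
    rw [← hx, Units.val_mul, coe_toPrincipalIdeal, mul_comm, FractionalIdeal.mem_singleton_mul]
    constructor
    · intro hy
      exact ⟨y, hy, rfl⟩
    · rintro ⟨y', hy', he⟩
      rwa [mul_left_cancel₀ x.ne_zero he]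
  have hx0 : ((x : quadField D) : ℂ) ≠ 0 := by
    have := x.ne_zero
    exact_mod_cast this
  have key1 : ∀ y ∈ ({c, d} : Set (quadField D)), ∃ p q : ℤ,
      ((x : quadField D) : ℂ) * (y : ℂ) = p * (a : ℂ) + q * (b : ℂ) := by
    intro y hy
    have := (hmem y).1 ((hs' y).2 (Submodule.subset_span hy))
    rw [hs, Submodule.mem_span_pair] at this
    obtain ⟨p, q, hpq⟩ := this
    refine ⟨p, q, ?_⟩
    have := congrArg (Subtype.val : quadField D → ℂ) hpq
    simpa using this.symm
  have key2 : ∀ y ∈ ({a, b} : Set (quadField D)), ∃ p q : ℤ,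
      (y : ℂ) = ((x : quadField D) : ℂ) * (p * (c : ℂ) + q * (d : ℂ)) := by
    intro y hy
    have h1 : (x : quadField D) * ((x : quadField D)⁻¹ * y) = y := by
      rw [mul_inv_cancel_left₀ x.ne_zero]
    have := (hmem ((x : quadField D)⁻¹ * y)).2 (by
      rw [h1]; exact (hs y).2 (Submodule.subset_span hy))
    rw [hs', Submodule.mem_span_pair] at this
    obtain ⟨p, q, hpq⟩ := this
    refine ⟨p, q, ?_⟩
    rw [← h1, ← hpq]
    simp
  obtain ⟨p, q, h1⟩ := key1 c (by simp)
  obtain ⟨r, s, h2⟩ := key1 d (by simp)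
  obtain ⟨p', q', h3⟩ := key2 a (by simp)
  obtain ⟨r', s', h4⟩ := key2 b (by simp)
  have ha : (a : ℂ) ≠ 0 := by
    intro h0; simp [h0] at ho
  have hc : (c : ℂ) ≠ 0 := by
    intro h0; simp [h0] at ho'
  have hind : ∀ m n : ℤ, (m : ℂ) * (a : ℂ) + n * (b : ℂ) = 0 → m = 0 ∧ n = 0 := by
    intro m n hmn
    have hmn' : (m : ℂ) + n * (ρ : ℂ) = 0 := by
      rw [hρ]; field_simp; linear_combination hmn
    have hi := congrArg Complex.im hmn'
    have hr := congrArg Complex.re hmn'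
    have := ρ.im_pos
    simp at hi hr
    have hn : n = 0 := by
      rcases hi with hi | hi
      · exact hi
      · exact absurd hi ρ.im_ne_zero
    subst hn
    simpa using hr
  have e3 : ((p' * p + q' * r - 1 : ℤ) : ℂ) * (a : ℂ) + ((p' * q + q' * s : ℤ) : ℂ) * (b : ℂ) = 0 := by
    push_cast
    linear_combination -h3 - p' * h1 - q' * h2
  have e4 : ((r' * p + s' * r : ℤ) : ℂ) * (a : ℂ) + ((r' * q + s' * s - 1 : ℤ) : ℂ) * (b : ℂ) = 0 := by
    push_cast
    linear_combination -h4 - r' * h1 - s' * h2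
  obtain ⟨f1, f2⟩ := hind _ _ e3
  obtain ⟨f3, f4⟩ := hind _ _ e4
  have hdet : (p' * s' - q' * r') * (p * s - q * r) = 1 := by
    linear_combination (r' * q + s' * s) * f1 + f4 - (r' * p + s' * r) * f2
  have hσ' : (σ : ℂ) * (p + q * (ρ : ℂ)) = r + s * (ρ : ℂ) := by
    rw [hσ, hρ]
    field_simp
    linear_combination (d : ℂ) * (- h1) + (c : ℂ) * h2
  have hu : (p * s - q * r) = 1 := by
    rcases Int.eq_one_or_neg_one_of_mul_eq_one' hdet with ⟨-, h⟩ | ⟨-, h⟩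
    · exact h
    · exfalso
      have hi := congrArg Complex.im hσ'
      have hr := congrArg Complex.re hσ'
      have hσp := σ.im_pos
      have hρp := ρ.im_pos
      simp at hi hr
      have hR : (p * s - q * r : ℝ) = -1 := by exact_mod_cast h
      have : σ.im * ((p + q * ρ.re) ^ 2 + (q * ρ.im) ^ 2) = (p * s - q * r : ℝ) * ρ.im := by
        linear_combination hi * (p + q * ρ.re) - hr * (q * ρ.im)
      rw [hR] at this
      have : 0 ≤ σ.im * ((p + q * ρ.re) ^ 2 + (q * ρ.im) ^ 2) := by positivity
      linarith
  have hden : (p + q * (ρ : ℂ)) ≠ 0 := by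
    intro h0
    have : ((p : ℤ) : ℂ) * (a : ℂ) + q * (b : ℂ) = 0 := by
      rw [hρ] at h0; field_simp at h0; linear_combination h0
    obtain ⟨rfl, rfl⟩ := hind _ _ this
    simp at hu
  refine (Quotient.sound ?_).symm
  change σ ∈ MulAction.orbit _ ρ
  obtain ⟨g, hg⟩ : ∃ g : SL(2, ℤ), (g : Matrix (Fin 2) (Fin 2) ℤ) = !![s, r; q, p] :=
    ⟨⟨!![s, r; q, p], by rw [Matrix.det_fin_two_of]; linarith⟩, rfl⟩
  refine ⟨g, ?_⟩
  apply UpperHalfPlane.ext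
  change ((g • ρ : ℍ) : ℂ) = _
  rw [UpperHalfPlane.coe_specialLinearGroup_apply, hg]
  have hden' : (q : ℂ) * (ρ : ℂ) + p ≠ 0 := by rwa [add_comm]
  simp
  rw [div_eq_iff hden']
  linear_combination -hσ'

/-- The point `[ρ_𝔞]` of `SL₂(ℤ) \ ℍ` attached to an ideal class `[𝔞]` of `K = ℚ(√D)`. -/
noncomputable def heegnerPoint (D : ℤ) (hD : IsNegFundamentalDiscriminant D)
    (C : ClassGroup (𝓞 (quadField D))) : ModularCurve :=
  (exists_isHeegnerPoint hD.1 C).choose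

theorem heegnerPoint_eq_iff {D : ℤ} (hD : IsNegFundamentalDiscriminant D)
    (C : ClassGroup (𝓞 (quadField D))) (P : ModularCurve) :
    heegnerPoint D hD C = P ↔ IsHeegnerPoint D C P :=
  ⟨fun h ↦ h ▸ (exists_isHeegnerPoint hD.1 C).choose_spec,
    fun h ↦ (exists_isHeegnerPoint hD.1 C).choose_spec.unique h⟩

/-- The number `w` of units of (the ring of integers of) `K = ℚ(√D)`. -/
noncomputable def numUnits (D : ℤ) : ℕ := Nat.card (𝓞 (quadField D))ˣ

/-- Divisors with rational coefficients on `SL₂(ℤ) \ ℍ`. -/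
abbrev Divisor : Type := ModularCurve →₀ ℚ

/-- The degree of a divisor: the sum of its coefficients. -/
def Divisor.degree (Z : Divisor) : ℚ := Z.sum fun _ m ↦ m

/-- The Heegner divisor `H(D)`: the sum of the points `[ρ_𝔞]` over all ideal classes `[𝔞]` of
`ℚ(√D)`, each counted with multiplicity `2 / w`. -/
noncomputable def heegnerDivisor (D : ℤ) (hD : IsNegFundamentalDiscriminant D) : Divisor :=
  ∑ C : ClassGroup (𝓞 (quadField D)), Finsupp.single (heegnerPoint D hD C) (2 / (numUnits D : ℚ))

/-- The order of the stabilizer of `τ` in `PSL₂(ℤ) = SL₂(ℤ) / {±1}`, that is, the ramification index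
of `ℍ → SL₂(ℤ) \ ℍ` at `τ`. -/
noncomputable def ramification (τ : ℍ) : ℚ :=
  (Nat.card (MulAction.stabilizer SL(2, ℤ) τ) : ℚ) / 2

/-- `f` is a holomorphic function on `ℍ`, not identically zero, whose divisor on `SL₂(ℤ) \ ℍ` is `Z`:
the multiplicity of `[τ]` in `Z` is `ord_τ(f)` divided by the order of the stabilizer of `τ` in
`PSL₂(ℤ)` (so that the divisor of a modular form of weight `k` that does not vanish at the cusp
has degree `k / 12`). Here `ofComplex` is the identity on `ℍ`, so that `f ∘ ofComplex` extends `f`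
from `ℍ` to `ℂ`. -/
def HasDivisor (f : ℍ → ℂ) (Z : Divisor) : Prop :=
  ∀ τ : ℍ, ∃ n : ℕ, analyticOrderAt (fun z : ℂ ↦ f (ofComplex z)) (τ : ℂ) = n ∧
    Z (toModularCurve τ) = n / ramification τ

/-- `Ψ` is a modular form for `SL₂(ℤ)` (of weight `k`) with divisor `H(D)` and `Ψ(∞) = 1`. -/
def IsPsi (D : ℤ) (hD : IsNegFundamentalDiscriminant D) {k : ℤ} (Ψ : ModularForm 𝒮ℒ k) : Prop :=
  HasDivisor Ψ (heegnerDivisor D hD) ∧ Filter.Tendsto Ψ atImInfty (nhds 1)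

/-- The function `log (|Ψ(τ)|² (4 π y) ^ k)` on `ℍ`, with `y = Im τ`. -/
noncomputable def logPetersson {k : ℤ} (Ψ : ModularForm 𝒮ℒ k) (τ : ℍ) : ℝ :=
  Real.log (‖Ψ τ‖ ^ 2 * (4 * Real.pi * τ.im) ^ k)

end HeegnerDivisor

/-!
The proof pairs the logarithm of the Petersson norm `log (|f|² (4πy)^k)` of a modular form with
`f(∞) = 1` against the theta series `Θ(τ, t) = ∑ exp (-π t |mτ + n|² / Im τ)` and lets `t → 0`.

Since `Θ(τ, 1/t) = t Θ(τ, t)`, the product `t (Θ(τ, t) - 1)` tends to `1`, so the limit of the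
pairing is the integral that is sought. On the other hand `Θ - 1` is an incomplete Eisenstein
series, and the integral unfolds to the strip `-1/2 ≤ x < 1/2`
(`two_mul_integral_strip_logPetersson`). There the integral over `x` is given by Jensen's formula
on a disc in the coordinate `q = exp (2πiτ)` (`horizontalMean_eq_tsum`), that is, by a sum over the
zeros of `f` modulo translations. Folding this sum back expresses the pairing through the divisor
`∑ m_P [P]` of `f`, as the sum of `4π m_P ∫_t^∞ (Θ(P, w) - 1)(1 - t/w) dw` and an elementary
contribution of `(4πy)^k`. Both grow like `log t`. Comparison of the coefficients of `log t` is the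
valence formula `k = 12 deg` (`HasDivisor.weight_eq`), and the constant term is the integral
(`HasDivisor.integral_fd_logPetersson`), expressed through the values at `0` of the entire parts
`Λ₀` of the Epstein zeta functions of the points of the divisor.

The valence formula determines the weight, and it gives uniqueness of the form with a given
divisor: a linear combination of two such forms with one more zero would have too large a divisor
(`HasDivisor.unique`). For existence it is enough to treat a single point `ρ`, with coefficient `2`
divided by the order of the stabilizer of `ρ` in `SL₂(ℤ)`. The form is `E₄`, `E₆` or a combination
of `E₄³` and `E₆²` that vanishes at `ρ`, and the valence formula leaves no room for other zeros
(`exists_hasDivisor_single`). The coefficient is the one required by `H(D)`, because the stabilizer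
of a Heegner point is the unit group of the ring of integers (`IsOrientedBasis.card_stabilizer`).

The arithmetic input is the identity
`∑_C (Θ(ρ_C, t) - 1) = w ∑_I exp (-2π t N(I) / √|D|)`, with `C` running over the ideal classes and
`I` over the nonzero ideals (`hasSum_latticeTheta`), together with the formula `∑_{d ∣ n} χ_D(d)`
for the number of ideals of norm `n` (`idealCount_eq_kroneckerSum`), which is proved by comparing
the recursions of both sides at each prime. The Mellin transform of this identity and analytic
continuation relate `∑_C Λ₀(ρ_C, s)` to `ζ(s) L(χ_D, s)` (`sum_epsteinLambda₀_eq`). At `s = 0` the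
leading coefficients give the class number formula `L(χ_D, 0) = 2h/w`, and the next ones give
`∑_C Λ₀(ρ_C, 0)` in terms of `L'(χ_D, 0)` (`kroneckerL_zero_and_sum_epsteinLambda₀`). The sum
`∑ log c / c² = -ζ'(2)`, which comes from the contribution of `(4πy)^k`, turns into
`ζ'(-1) / ζ(-1)` by the functional equation (`logDeriv_riemannZeta_neg_one`).
-/

namespace HeegnerDivisor

open Filter Topology MeasureTheory Set
open scoped ENNReal

/-! ### The theta series of a point of the upper half-plane -/

/-- The binary quadratic form `q_τ(m, n) = |mτ + n|² / Im τ` of discriminant `-4`. -/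
noncomputable def latticeForm (τ : ℍ) (v : Fin 2 → ℤ) : ℝ :=
  Complex.normSq (v 0 * (τ : ℂ) + v 1) / τ.im

/-- The theta series `Θ(τ, t) = ∑ exp (-π t q_τ(m, n))`, the sum being over all `(m, n) ∈ ℤ²`. -/
noncomputable def latticeTheta (τ : ℍ) (t : ℝ) : ℝ :=
  ∑' v : Fin 2 → ℤ, Real.exp (-Real.pi * latticeForm τ v * t)

theorem latticeForm_nonneg (τ : ℍ) (v : Fin 2 → ℤ) : 0 ≤ latticeForm τ v :=
  div_nonneg (Complex.normSq_nonneg _) τ.im_pos.le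

theorem latticeForm_zero (τ : ℍ) : latticeForm τ 0 = 0 := by simp [latticeForm]

theorem exists_le_latticeForm (τ : ℍ) :
    ∃ c > 0, ∀ v : Fin 2 → ℤ, c * ‖v‖ ^ 2 ≤ latticeForm τ v := by
  refine ⟨EisensteinSeries.r τ ^ 2 / τ.im, div_pos (pow_pos (EisensteinSeries.r_pos τ) 2) τ.im_pos,
    fun v ↦ ?_⟩
  by_cases hv : v = 0
  · simp [hv, latticeForm_zero]
  rw [latticeForm, div_mul_eq_mul_div]
  have h0 := τ.im_pos
  gcongr
  rw [Complex.normSq_eq_norm_sq, ← mul_pow]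
  have := (EisensteinSeries.r_pos τ).le
  gcongr
  exact EisensteinSeries.r_mul_max_le τ hv

theorem one_le_norm_of_ne_zero {v : Fin 2 → ℤ} (hv : v ≠ 0) : 1 ≤ ‖v‖ := by
  rw [EisensteinSeries.norm_eq_max_natAbs]
  by_contra! h
  have : max (v 0).natAbs (v 1).natAbs < 1 := by exact_mod_cast h
  apply hv
  ext i
  fin_cases i <;> simp <;> omega

theorem exists_le_latticeForm_of_ne_zero (τ : ℍ) :
    ∃ c > 0, ∀ v : Fin 2 → ℤ, v ≠ 0 → c ≤ latticeForm τ v := by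
  obtain ⟨c, hc, h⟩ := exists_le_latticeForm τ
  refine ⟨c, hc, fun v hv ↦ le_trans ?_ (h v)⟩
  have := one_le_norm_of_ne_zero hv
  nlinarith [mul_self_nonneg (‖v‖ - 1)]

theorem latticeForm_pos (τ : ℍ) {v : Fin 2 → ℤ} (hv : v ≠ 0) : 0 < latticeForm τ v := by
  obtain ⟨c, hc, h⟩ := exists_le_latticeForm_of_ne_zero τ
  exact hc.trans_le (h v hv)

theorem summable_exp_latticeForm (τ : ℍ) {t : ℝ} (ht : 0 < t) :
    Summable fun v : Fin 2 → ℤ ↦ Real.exp (-Real.pi * latticeForm τ v * t) := by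
  obtain ⟨c, hc, h⟩ := exists_le_latticeForm τ
  have hs : Summable fun v : Fin 2 → ℤ ↦ (2 / (Real.pi * c * t) ^ 2) * ‖v‖ ^ (-4 : ℝ) :=
    (EisensteinSeries.summable_one_div_norm_rpow (by norm_num)).mul_left _
  refine hs.of_norm_bounded_eventually ?_
  have : {v : Fin 2 → ℤ | v ≠ 0} ∈ Filter.cofinite := by simp
  filter_upwards [this] with v hv
  have h1 := one_le_norm_of_ne_zero hv
  have h2 : 0 < Real.pi * c * t * ‖v‖ ^ 2 := by positivity
  have h3 := Real.quadratic_le_exp_of_nonneg h2.le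
  rw [Real.norm_of_nonneg (Real.exp_pos _).le]
  calc Real.exp (-Real.pi * latticeForm τ v * t) ≤ Real.exp (-(Real.pi * c * t * ‖v‖ ^ 2)) := by
        rw [Real.exp_le_exp]
        have := mul_le_mul_of_nonneg_right (h v) (mul_pos Real.pi_pos ht).le
        linarith
    _ = (Real.exp (Real.pi * c * t * ‖v‖ ^ 2))⁻¹ := Real.exp_neg _
    _ ≤ ((Real.pi * c * t * ‖v‖ ^ 2) ^ 2 / 2)⁻¹ := by
        gcongr
        linarith
    _ = 2 / (Real.pi * c * t) ^ 2 * ‖v‖ ^ (-4 : ℝ) := by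
        rw [Real.rpow_neg (norm_nonneg _), show (4 : ℝ) = (4 : ℕ) by norm_num, Real.rpow_natCast]
        field_simp

theorem latticeTheta_eq_one_add (τ : ℍ) {t : ℝ} (ht : 0 < t) :
    latticeTheta τ t = 1 + ∑' v : Fin 2 → ℤ,
      if v = 0 then 0 else Real.exp (-Real.pi * latticeForm τ v * t) := by
  rw [latticeTheta, (summable_exp_latticeForm τ ht).tsum_eq_add_tsum_ite 0]
  simp [latticeForm_zero]

theorem summable_exp_latticeForm_ite (τ : ℍ) {t : ℝ} (ht : 0 < t) :
    Summable fun v : Fin 2 → ℤ ↦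
      if v = 0 then 0 else Real.exp (-Real.pi * latticeForm τ v * t) := by
  refine (summable_exp_latticeForm τ ht).of_norm_bounded fun v ↦ ?_
  split_ifs
  · simpa using (Real.exp_pos _).le
  · rw [Real.norm_of_nonneg (Real.exp_pos _).le]

theorem one_le_latticeTheta (τ : ℍ) {t : ℝ} (ht : 0 < t) : 1 ≤ latticeTheta τ t := by
  rw [latticeTheta_eq_one_add τ ht, le_add_iff_nonneg_right]
  refine tsum_nonneg fun v ↦ ?_
  split_ifs
  · exact le_rfl
  · exact (Real.exp_pos _).le

theorem latticeTheta_antitoneOn (τ : ℍ) : AntitoneOn (latticeTheta τ) (Ioi 0) := by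
  intro s hs t ht hst
  refine (summable_exp_latticeForm τ ht).tsum_le_tsum (fun v ↦ ?_) (summable_exp_latticeForm τ hs)
  rw [Real.exp_le_exp]
  have := mul_le_mul_of_nonneg_left hst (mul_nonneg Real.pi_pos.le (latticeForm_nonneg τ v))
  linarith

/-- `Θ(τ, t) - 1` decays exponentially as `t → ∞`. -/
theorem exists_latticeTheta_sub_one_le (τ : ℍ) :
    ∃ c > 0, ∃ C, ∀ t, 1 ≤ t → latticeTheta τ t - 1 ≤ C * Real.exp (-c * t) := by
  obtain ⟨c, hc, h⟩ := exists_le_latticeForm_of_ne_zero τ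
  refine ⟨Real.pi * c, by positivity, Real.exp (Real.pi * c) * (latticeTheta τ 1 - 1),
    fun t ht ↦ ?_⟩
  have ht0 : 0 < t := by linarith
  rw [latticeTheta_eq_one_add τ ht0, latticeTheta_eq_one_add τ one_pos, add_sub_cancel_left,
    add_sub_cancel_left, mul_right_comm, ← Real.exp_add, ← tsum_mul_left]
  refine (summable_exp_latticeForm_ite τ ht0).tsum_le_tsum (fun v ↦ ?_)
    ((summable_exp_latticeForm_ite τ one_pos).mul_left _)
  split_ifs with hv
  · simp
  · rw [← Real.exp_add, Real.exp_le_exp]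
    have := mul_le_mul_of_nonneg_left (h v hv) (mul_nonneg Real.pi_pos.le (sub_nonneg.2 ht))
    linarith

theorem latticeForm_eq (τ : ℍ) (v : Fin 2 → ℤ) :
    latticeForm τ v = (v 0 : ℝ) ^ 2 * τ.im + (v 1 + v 0 * τ.re) ^ 2 / τ.im := by
  have := τ.im_ne_zero
  rw [latticeForm, Complex.normSq_apply]
  simp
  field_simp
  ring

/-- One-dimensional Poisson summation for a shifted Gaussian. -/
theorem tsum_exp_neg_shift_sq {a : ℝ} (ha : 0 < a) (b : ℝ) :
    ∑' n : ℤ, Complex.exp (-Real.pi / a * (n + b) ^ 2) =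
      (√a : ℝ) * ∑' n : ℤ, Complex.exp (-Real.pi * a * n ^ 2 - 2 * Real.pi * Complex.I * b * n) := by
  have h := Complex.tsum_exp_neg_quadratic (a := (a : ℂ)) (by simpa using ha) (-Complex.I * b)
  have e1 : Complex.I * (-Complex.I * b) = b := by
    rw [← mul_assoc, mul_neg, Complex.I_mul_I]; simp
  have e2 : (a : ℂ) ^ (1 / 2 : ℂ) = (√a : ℝ) := by
    rw [Real.sqrt_eq_rpow, Complex.ofReal_cpow ha.le]; norm_num
  have e3 : ((√a : ℝ) : ℂ) ≠ 0 := by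
    exact_mod_cast (Real.sqrt_pos.2 ha).ne'
  rw [e1, e2] at h
  have e4 : ∀ n : ℤ, (-Real.pi * a * n ^ 2 + 2 * Real.pi * (-Complex.I * b) * n : ℂ) =
      -Real.pi * a * n ^ 2 - 2 * Real.pi * Complex.I * b * n := fun n ↦ by ring
  simp_rw [e4] at h
  rw [h]
  field_simp

theorem summable_exp_neg_sq {a : ℝ} (ha : 0 < a) :
    Summable fun n : ℤ ↦ Real.exp (-Real.pi * a * n ^ 2) := by
  have := ((summable_jacobiTheta₂_term_iff 0 (Complex.I * a)).2 (by simpa using ha)).norm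
  refine this.congr fun n ↦ ?_
  rw [norm_jacobiTheta₂_term]
  congr 1
  simp
  ring

theorem norm_exp_gaussian (a b : ℝ) (n : ℤ) :
    ‖Complex.exp (-Real.pi * a * n ^ 2 - 2 * Real.pi * Complex.I * b * n)‖ =
      Real.exp (-Real.pi * a * n ^ 2) := by
  rw [Complex.norm_exp]
  congr 1
  have : (-Real.pi * a * n ^ 2 - 2 * Real.pi * Complex.I * b * n : ℂ) =
    ((-Real.pi * a * n ^ 2 : ℝ) : ℂ) + ((- 2 * Real.pi * b * n : ℝ) : ℂ) * Complex.I := by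
    push_cast; ring
  rw [this, Complex.add_re, Complex.ofReal_re, Complex.re_ofReal_mul]
  simp

theorem latticeTheta_eq_tsum_tsum (τ : ℍ) {t : ℝ} (ht : 0 < t) :
    latticeTheta τ t = ∑' m : ℤ, ∑' n : ℤ,
      Real.exp (-Real.pi * (m ^ 2 * τ.im + (n + m * τ.re) ^ 2 / τ.im) * t) := by
  have h := summable_exp_latticeForm τ ht
  rw [latticeTheta, ← (finTwoArrowEquiv ℤ).symm.tsum_eq, Summable.tsum_prod]
  · simp [latticeForm_eq]
  · exact (finTwoArrowEquiv ℤ).symm.summable_iff.2 h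

/-- Poisson summation in the second variable of the lattice sum. -/
theorem latticeTheta_inner (τ : ℍ) {t : ℝ} (ht : 0 < t) (m : ℤ) :
    ((∑' n : ℤ, Real.exp (-Real.pi * (m ^ 2 * τ.im + (n + m * τ.re) ^ 2 / τ.im) * t) : ℝ) : ℂ) =
      (√(τ.im / t) : ℝ) * ∑' n : ℤ, Complex.exp (-Real.pi * (t * τ.im) * m ^ 2) *
        Complex.exp (-Real.pi * (τ.im / t : ℝ) * n ^ 2
          - 2 * Real.pi * Complex.I * (m * τ.re : ℝ) * n) := by
  have h := tsum_exp_neg_shift_sq (div_pos τ.im_pos ht) (m * τ.re)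
  have him : (τ.im : ℂ) ≠ 0 := by exact_mod_cast τ.im_ne_zero
  have ht' : (t : ℂ) ≠ 0 := by exact_mod_cast ht.ne'
  rw [tsum_mul_left, mul_left_comm, ← h, ← tsum_mul_left, Complex.ofReal_tsum]
  refine tsum_congr fun n ↦ ?_
  rw [← Complex.exp_add]
  push_cast
  congr 1
  field_simp
  ring

/-- The functional equation `Θ(τ, 1/t) = t Θ(τ, t)`, by Poisson summation in each variable. -/
theorem latticeTheta_one_div (τ : ℍ) {t : ℝ} (ht : 0 < t) :
    latticeTheta τ (1 / t) = t * latticeTheta τ t := by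
  have hy := τ.im_pos
  have key : (latticeTheta τ t : ℂ) = (√(τ.im / t) : ℝ) * ∑' n : ℤ, ∑' m : ℤ,
      Complex.exp (-Real.pi * (t * τ.im) * m ^ 2) *
        Complex.exp (-Real.pi * (τ.im / t : ℝ) * n ^ 2
          - 2 * Real.pi * Complex.I * (m * τ.re : ℝ) * n) := by
    rw [latticeTheta_eq_tsum_tsum τ ht, Complex.ofReal_tsum, tsum_congr (latticeTheta_inner τ ht),
      tsum_mul_left]
    congr 1
    refine (Summable.tsum_comm (f := fun m n : ℤ ↦ Complex.exp (-Real.pi * (t * τ.im) * m ^ 2) *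
        Complex.exp (-Real.pi * (τ.im / t : ℝ) * n ^ 2
          - 2 * Real.pi * Complex.I * (m * τ.re : ℝ) * n)) ?_).symm
    have hs := (summable_exp_neg_sq (mul_pos ht hy)).mul_of_nonneg
      (summable_exp_neg_sq (div_pos hy ht)) (fun _ ↦ (Real.exp_pos _).le)
      (fun _ ↦ (Real.exp_pos _).le)
    refine Summable.of_norm_bounded hs fun p ↦ ?_
    simp only [Function.uncurry, norm_mul]
    rw [norm_exp_gaussian, Complex.norm_exp]
    apply le_of_eq
    congr 2
    have : (-Real.pi * (t * τ.im) * p.1 ^ 2 : ℂ) =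
      ((-Real.pi * (t * τ.im) * p.1 ^ 2 : ℝ) : ℂ) := by push_cast; ring
    rw [this, Complex.ofReal_re]
  have inner : ∀ n : ℤ, ∑' m : ℤ, Complex.exp (-Real.pi * (t * τ.im) * m ^ 2) *
        Complex.exp (-Real.pi * (τ.im / t : ℝ) * n ^ 2
          - 2 * Real.pi * Complex.I * (m * τ.re : ℝ) * n) = ((√(t * τ.im))⁻¹ : ℝ) *
      ((∑' m : ℤ, Real.exp (-Real.pi * (n ^ 2 * τ.im + (m + n * τ.re) ^ 2 / τ.im) * (1 / t)) : ℝ)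
        : ℂ) := by
    intro n
    have h := tsum_exp_neg_shift_sq (mul_pos ht hy) (n * τ.re)
    have him : (τ.im : ℂ) ≠ 0 := by exact_mod_cast τ.im_ne_zero
    have ht' : (t : ℂ) ≠ 0 := by exact_mod_cast ht.ne'
    have e1 : ∀ m : ℤ, Complex.exp (-Real.pi * (t * τ.im) * m ^ 2) *
        Complex.exp (-Real.pi * (τ.im / t : ℝ) * n ^ 2
          - 2 * Real.pi * Complex.I * (m * τ.re : ℝ) * n) =
        Complex.exp (-Real.pi * (τ.im / t : ℝ) * n ^ 2) *
        Complex.exp (-Real.pi * (t * τ.im : ℝ) * m ^ 2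
          - 2 * Real.pi * Complex.I * (n * τ.re : ℝ) * m) := by
      intro m
      rw [← Complex.exp_add, ← Complex.exp_add]
      congr 1
      push_cast
      ring
    have e3 : ((√(t * τ.im) : ℝ) : ℂ) ≠ 0 := by
      exact_mod_cast (Real.sqrt_pos.2 (mul_pos ht hy)).ne'
    rw [tsum_congr e1, tsum_mul_left]
    have h' := h.symm
    rw [← eq_inv_mul_iff_mul_eq₀ e3] at h'
    rw [h', mul_left_comm, ← tsum_mul_left, Complex.ofReal_tsum, Complex.ofReal_inv]
    congr 1
    refine tsum_congr fun m ↦ ?_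
    rw [← Complex.exp_add]
    push_cast
    congr 1
    field_simp
    ring
  rw [tsum_congr inner, tsum_mul_left, ← Complex.ofReal_tsum,
    ← latticeTheta_eq_tsum_tsum τ (one_div_pos.2 ht)] at key
  have key' : latticeTheta τ t = √(τ.im / t) * ((√(t * τ.im))⁻¹ * latticeTheta τ (1 / t)) := by
    exact_mod_cast key
  have e : √(τ.im / t) = √(t * τ.im) / t := by
    rw [Real.sqrt_eq_iff_eq_sq (by positivity) (by positivity), div_pow, Real.sq_sqrt (by positivity)]
    field_simp
  have e3 : √(t * τ.im) ≠ 0 := (Real.sqrt_pos.2 (mul_pos ht hy)).ne'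
  rw [key', e]
  field_simp

/-- In the half-plane `Im τ ≥ 1/2`, the theta series `Θ(τ, 1)` grows at most like `√(Im τ)`. -/
theorem exists_latticeTheta_one_le :
    ∃ C, ∀ τ : ℍ, 1 / 2 ≤ τ.im → latticeTheta τ 1 ≤ C * √τ.im := by
  set S := ∑' n : ℤ, Real.exp (-Real.pi * (1 / 2 : ℝ) * n ^ 2) with hS
  have hsum := summable_exp_neg_sq (a := 1 / 2) (by norm_num)
  have hS0 : 0 ≤ S := tsum_nonneg fun _ ↦ (Real.exp_pos _).le
  have hle : ∀ y : ℝ, 1 / 2 ≤ y → ∀ n : ℤ, Real.exp (-Real.pi * y * n ^ 2) ≤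
      Real.exp (-Real.pi * (1 / 2 : ℝ) * n ^ 2) := by
    intro y hy n
    rw [Real.exp_le_exp]
    have := mul_le_mul_of_nonneg_right hy (mul_nonneg Real.pi_pos.le (sq_nonneg (n : ℝ)))
    linarith
  refine ⟨S * S, fun τ hτ ↦ ?_⟩
  have hi : ∀ m : ℤ, ∑' n : ℤ, Real.exp (-Real.pi * (m ^ 2 * τ.im + (n + m * τ.re) ^ 2 / τ.im) * 1) ≤
      Real.exp (-Real.pi * (1 / 2 : ℝ) * m ^ 2) * (S * √τ.im) := by
    intro m
    have h := latticeTheta_inner τ one_pos m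
    have h0 : 0 ≤ ∑' n : ℤ, Real.exp (-Real.pi * (m ^ 2 * τ.im + (n + m * τ.re) ^ 2 / τ.im) * 1) :=
      tsum_nonneg fun _ ↦ (Real.exp_pos _).le
    rw [← Real.norm_of_nonneg h0, ← Complex.norm_real, h, tsum_mul_left, norm_mul, norm_mul,
      Complex.norm_real, Real.norm_of_nonneg (Real.sqrt_nonneg _), div_one]
    have h1 : ‖Complex.exp (-Real.pi * ((1 : ℝ) * τ.im) * m ^ 2)‖ ≤
        Real.exp (-Real.pi * (1 / 2 : ℝ) * m ^ 2) := by
      refine le_trans (le_of_eq ?_) (hle τ.im hτ m)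
      have := norm_exp_gaussian τ.im 0 m
      simpa using this
    have h2 : ‖∑' n : ℤ, Complex.exp (-Real.pi * (τ.im : ℝ) * n ^ 2
          - 2 * Real.pi * Complex.I * (m * τ.re : ℝ) * n)‖ ≤ S := by
      have hs' := summable_exp_neg_sq τ.im_pos
      refine (norm_tsum_le_tsum_norm ?_).trans ?_
      · simpa only [norm_exp_gaussian] using hs'
      · simp only [norm_exp_gaussian]
        exact hs'.tsum_le_tsum (hle τ.im hτ) hsum
    calc _ ≤ √τ.im * (Real.exp (-Real.pi * (1 / 2 : ℝ) * m ^ 2) * S) := by gcongr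
      _ = _ := by ring
  have hs1 : Summable fun m : ℤ ↦ Real.exp (-Real.pi * (1 / 2 : ℝ) * m ^ 2) * (S * √τ.im) :=
    hsum.mul_right _
  rw [latticeTheta_eq_tsum_tsum τ one_pos]
  calc _ ≤ ∑' m : ℤ, Real.exp (-Real.pi * (1 / 2 : ℝ) * m ^ 2) * (S * √τ.im) := by
        refine Summable.tsum_le_tsum hi ?_ hs1
        exact hs1.of_nonneg_of_le (fun m ↦ tsum_nonneg fun _ ↦ (Real.exp_pos _).le) hi
    _ = S * S * √τ.im := by rw [tsum_mul_right, ← hS]; ring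

/-! ### The Epstein zeta function -/

theorem latticeTheta_sub_one_isBigO (τ : ℍ) (r : ℝ) :
    (fun t ↦ latticeTheta τ t - 1) =O[atTop] fun t : ℝ ↦ t ^ r := by
  obtain ⟨c, hc, K, h⟩ := exists_latticeTheta_sub_one_le τ
  refine Asymptotics.IsBigO.trans (.of_bound |K| ?_) (isLittleO_exp_neg_mul_rpow_atTop hc r).isBigO
  filter_upwards [eventually_ge_atTop 1] with t ht
  rw [Real.norm_of_nonneg (sub_nonneg.2 (one_le_latticeTheta τ (by linarith))),
    Real.norm_of_nonneg (Real.exp_pos _).le]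
  exact (h t ht).trans (mul_le_mul_of_nonneg_right (le_abs_self K) (Real.exp_pos _).le)

theorem latticeTheta_sub_one_isBigO_complex (τ : ℍ) (r : ℝ) :
    (fun t ↦ (latticeTheta τ t : ℂ) - 1) =O[atTop] fun t : ℝ ↦ t ^ r := by
  rw [← Asymptotics.isBigO_norm_left]
  refine (latticeTheta_sub_one_isBigO τ r).norm_left.congr_left fun t ↦ ?_
  rw [← Complex.norm_real]
  push_cast
  rfl

theorem locallyIntegrableOn_latticeTheta (τ : ℍ) :
    LocallyIntegrableOn (fun t ↦ (latticeTheta τ t : ℂ)) (Ioi 0) := by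
  rw [locallyIntegrableOn_iff isOpen_Ioi.isLocallyClosed]
  intro k hk hkc
  exact (((latticeTheta_antitoneOn τ).mono hk).integrableOn_isCompact hkc).ofReal

/-- The theta series `Θ(τ, ·)` with its functional equation, as an input for the Mellin
transform. -/
noncomputable def latticeThetaFEPair (τ : ℍ) : WeakFEPair ℂ where
  f t := latticeTheta τ t
  g t := latticeTheta τ t
  k := 1
  ε := 1
  f₀ := 1
  g₀ := 1
  hf_int := locallyIntegrableOn_latticeTheta τ
  hg_int := locallyIntegrableOn_latticeTheta τ
  hk := one_pos
  hε := one_ne_zero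
  h_feq t ht := by
    rw [latticeTheta_one_div τ ht]
    simp
  hf_top r := latticeTheta_sub_one_isBigO_complex τ r
  hg_top r := latticeTheta_sub_one_isBigO_complex τ r

/-- The entire part `Λ₀(s)` of the completed Epstein zeta function
`Λ(s) = π⁻ˢ Γ(s) ∑' q_τ(v)⁻ˢ = Λ₀(s) - 1 / s - 1 / (1 - s)`. -/
noncomputable def epsteinLambda₀ (τ : ℍ) : ℂ → ℂ := (latticeThetaFEPair τ).Λ₀

theorem differentiable_epsteinLambda₀ (τ : ℍ) : Differentiable ℂ (epsteinLambda₀ τ) :=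
  (latticeThetaFEPair τ).differentiable_Λ₀

theorem epsteinLambda₀_one (τ : ℍ) : epsteinLambda₀ τ 1 = epsteinLambda₀ τ 0 := by
  have hs : (latticeThetaFEPair τ).symm = latticeThetaFEPair τ := by
    simp [latticeThetaFEPair, WeakFEPair.symm]
  have := (latticeThetaFEPair τ).functional_equation₀ 0
  rw [hs] at this
  simpa [epsteinLambda₀, latticeThetaFEPair] using this

/-- `Θ(τ, t)` minus its leading behaviour at `∞` (for `t > 1`) or at `0` (for `t < 1`). -/
noncomputable def latticeThetaModif (τ : ℍ) (t : ℝ) : ℝ :=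
  (Ioi 1).indicator (fun t ↦ latticeTheta τ t - 1) t +
    (Ioo 0 1).indicator (fun t ↦ latticeTheta τ t - t⁻¹) t

theorem f_modif_latticeThetaFEPair (τ : ℍ) :
    (latticeThetaFEPair τ).f_modif = fun t ↦ (latticeThetaModif τ t : ℂ) := by
  ext t
  simp only [WeakFEPair.f_modif, latticeThetaFEPair, latticeThetaModif, Pi.add_apply, indicator]
  split_ifs <;> simp [Real.rpow_neg_one]

theorem integrableOn_latticeThetaModif (τ : ℍ) : IntegrableOn (latticeThetaModif τ) (Ioi 0) := by
  have h := ((latticeThetaFEPair τ).isStrongFEPair_toStrongFEPair.hasMellin 1).1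
  have h' : MellinConvergent (latticeThetaFEPair τ).f_modif 1 := h
  rw [f_modif_latticeThetaFEPair] at h'
  have : IntegrableOn (fun t ↦ (latticeThetaModif τ t : ℂ)) (Ioi 0) := by
    simpa [MellinConvergent] using h'
  exact this.re.congr (Eventually.of_forall fun t ↦ by simp)

theorem integral_latticeThetaModif (τ : ℍ) :
    ((∫ t in Ioi 0, latticeThetaModif τ t : ℝ) : ℂ) = epsteinLambda₀ τ 0 := by
  rw [← epsteinLambda₀_one, epsteinLambda₀, WeakFEPair.Λ₀, f_modif_latticeThetaFEPair, mellin,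
    ← integral_complex_ofReal]
  simp

theorem integrableOn_latticeTheta_sub_one (τ : ℍ) {t : ℝ} (ht : 0 < t) :
    IntegrableOn (fun w ↦ latticeTheta τ w - 1) (Ioi t) := by
  have h1 : IntegrableOn (fun w ↦ latticeTheta τ w - 1) (Ioi 1) := by
    refine ((integrableOn_latticeThetaModif τ).mono_set (Ioi_subset_Ioi zero_le_one)).congr_fun
      (fun w hw ↦ ?_) measurableSet_Ioi
    have : ¬ w < 1 := not_lt.2 (le_of_lt hw)
    simp only [mem_Ioi] at hw
    simp [latticeThetaModif, hw, this]
  have h2 : IntegrableOn (fun w ↦ latticeTheta τ w - 1) (Icc t 1) := by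
    refine IntegrableOn.sub ?_ (by simp [integrableOn_const_iff])
    refine ((latticeTheta_antitoneOn τ).mono fun w hw ↦ ?_).integrableOn_isCompact isCompact_Icc
    exact ht.trans_le hw.1
  refine (h2.union h1).mono_set fun w hw ↦ ?_
  rcases le_or_gt w 1 with h | h
  · exact Or.inl ⟨le_of_lt hw, h⟩
  · exact Or.inr h

theorem integrableOn_latticeTheta_sub_one_mul (τ : ℍ) {t : ℝ} (ht : 0 < t) :
    IntegrableOn (fun w ↦ (latticeTheta τ w - 1) * (1 - t / w)) (Ioi t) := by
  refine Integrable.mul_bdd (c := 1) (integrableOn_latticeTheta_sub_one τ ht) ?_ ?_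
  · exact (by fun_prop : Measurable fun w : ℝ ↦ 1 - t / w).aestronglyMeasurable
  · filter_upwards [ae_restrict_mem measurableSet_Ioi] with w hw
    have hw' : t < w := hw
    have h1 : t / w ≤ 1 := (div_le_one (ht.trans hw')).2 hw'.le
    have h2 : 0 ≤ t / w := (div_pos ht (ht.trans hw')).le
    rw [Real.norm_of_nonneg (by linarith)]
    linarith

theorem integral_inv_sub_one_mul {t : ℝ} (ht : 0 < t) :
    ∫ w in t..1, (w⁻¹ - 1) * (1 - t / w) = -Real.log t - 2 + 2 * t - t * Real.log t := by
  have hd : ∀ w ∈ uIcc t 1, HasDerivAt (fun w ↦ Real.log w - w + t * w⁻¹ + t * Real.log w)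
      ((w⁻¹ - 1) * (1 - t / w)) w := by
    intro w hw
    have hw0 : 0 < w := lt_of_lt_of_le (lt_min ht one_pos) hw.1
    convert! (((Real.hasDerivAt_log hw0.ne').sub (hasDerivAt_id w)).add
      ((hasDerivAt_inv hw0.ne').const_mul t)).add ((Real.hasDerivAt_log hw0.ne').const_mul t) using 1
    field_simp
    ring
  rw [intervalIntegral.integral_eq_sub_of_hasDerivAt hd]
  · simp
    field_simp
    ring
  · refine ContinuousOn.intervalIntegrable fun w hw ↦ ?_
    have hw0 : w ≠ 0 := (lt_of_lt_of_le (lt_min ht one_pos) hw.1).ne'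
    exact ContinuousAt.continuousWithinAt (by fun_prop (disch := assumption))

/-- The behaviour of `∫_t^∞ (Θ(τ, w) - 1) (1 - t / w) dw` as `t → 0`; the constant term is a value
of the entire part of the Epstein zeta function. -/
theorem tendsto_integral_latticeTheta_sub_one_mul (τ : ℍ) :
    Tendsto (fun t ↦ (∫ w in Ioi t, (latticeTheta τ w - 1) * (1 - t / w)) + Real.log t) (𝓝[>] 0)
      (𝓝 ((epsteinLambda₀ τ 0).re - 2)) := by
  have hre : (epsteinLambda₀ τ 0).re = ∫ t in Ioi 0, latticeThetaModif τ t := by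
    rw [← integral_latticeThetaModif, Complex.ofReal_re]
  have h1 : Tendsto (fun t : ℝ ↦ ∫ w in Ioi 0,
      (Ioi t).indicator (fun w ↦ latticeThetaModif τ w * (1 - t / w)) w) (𝓝[>] 0)
      (𝓝 (∫ t in Ioi 0, latticeThetaModif τ t)) := by
    refine tendsto_integral_filter_of_dominated_convergence (fun w ↦ ‖latticeThetaModif τ w‖)
      ?_ ?_ (integrableOn_latticeThetaModif τ).norm ?_
    · refine Eventually.of_forall fun t ↦ ?_
      refine AEStronglyMeasurable.indicator ?_ measurableSet_Ioi
      exact (integrableOn_latticeThetaModif τ).1.mul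
        (by fun_prop : Measurable fun w : ℝ ↦ 1 - t / w).aestronglyMeasurable
    · filter_upwards [self_mem_nhdsWithin] with t ht
      refine Eventually.of_forall fun w ↦ ?_
      rw [indicator]
      split_ifs with hw
      · have hw' : t < w := hw
        have ht' : 0 < t := ht
        have h1 : t / w ≤ 1 := (div_le_one (ht'.trans hw')).2 hw'.le
        have h2 : 0 ≤ t / w := (div_pos ht' (ht'.trans hw')).le
        rw [norm_mul, Real.norm_of_nonneg (by linarith : 0 ≤ 1 - t / w)]
        exact mul_le_of_le_one_right (norm_nonneg _) (by linarith)
      · simp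
    · filter_upwards [ae_restrict_mem measurableSet_Ioi] with w hw
      have hw' : 0 < w := hw
      have : Tendsto (fun t : ℝ ↦ latticeThetaModif τ w * (1 - t / w)) (𝓝[>] 0)
          (𝓝 (latticeThetaModif τ w * (1 - 0 / w))) :=
        (Continuous.tendsto (by fun_prop) 0).mono_left nhdsWithin_le_nhds
      rw [zero_div, sub_zero, mul_one] at this
      refine this.congr' ?_
      filter_upwards [Ioo_mem_nhdsGT hw'] with t ht
      rw [indicator_of_mem (show w ∈ Ioi t from ht.2)]
  -- On `(t, 1)` the theta series differs from its modification by `1 / w - 1`, and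
  -- `∫_t^1 (1 / w - 1) (1 - t / w) dw = -log t - 2 + 2 t - t log t`.
  have h2 : Tendsto (fun t : ℝ ↦ -2 + 2 * t - t * Real.log t) (𝓝[>] 0) (𝓝 (-2 + 2 * 0 - 0)) := by
    refine Tendsto.sub ?_ ?_
    · exact (Continuous.tendsto (by fun_prop) 0).mono_left nhdsWithin_le_nhds
    · have := tendsto_log_mul_rpow_nhdsGT_zero one_pos
      simpa [mul_comm] using this
  rw [hre]
  have h12 := h1.add h2
  rw [show ∀ x : ℝ, x + (-2 + 2 * 0 - 0) = x - 2 by intro x; ring] at h12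
  refine h12.congr' ?_
  filter_upwards [Ioo_mem_nhdsGT one_pos] with t ht
  have ht0 : 0 < t := ht.1
  rw [integral_indicator measurableSet_Ioi, Measure.restrict_restrict measurableSet_Ioi,
    inter_eq_left.2 (Ioi_subset_Ioi ht0.le)]
  have e : ∫ w in Ioi t, (latticeTheta τ w - 1) * (1 - t / w) =
      (∫ w in Ioi t, latticeThetaModif τ w * (1 - t / w)) +
        ∫ w in t..1, (w⁻¹ - 1) * (1 - t / w) := by
    have hi2 : IntegrableOn (fun w ↦ latticeThetaModif τ w * (1 - t / w)) (Ioi t) := by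
      refine Integrable.mul_bdd (c := 1)
        ((integrableOn_latticeThetaModif τ).mono_set (Ioi_subset_Ioi ht0.le)) ?_ ?_
      · exact (by fun_prop : Measurable fun w : ℝ ↦ 1 - t / w).aestronglyMeasurable
      · filter_upwards [ae_restrict_mem measurableSet_Ioi] with w hw
        have hw' : t < w := hw
        have h1 : t / w ≤ 1 := (div_le_one (ht0.trans hw')).2 hw'.le
        have h2 : 0 ≤ t / w := (div_pos ht0 (ht0.trans hw')).le
        rw [Real.norm_of_nonneg (by linarith)]
        linarith
    rw [← sub_eq_iff_eq_add', ← integral_sub (integrableOn_latticeTheta_sub_one_mul τ ht0) hi2,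
      intervalIntegral.integral_of_le ht.2.le, integral_Ioc_eq_integral_Ioo]
    have : ∀ᵐ w ∂(volume.restrict (Ioi t)), (latticeTheta τ w - 1) * (1 - t / w) -
        latticeThetaModif τ w * (1 - t / w) =
        (Ioo t 1).indicator (fun w ↦ (w⁻¹ - 1) * (1 - t / w)) w := by
      have h1 : ∀ᵐ w ∂(volume.restrict (Ioi t)), w ≠ 1 :=
        ae_restrict_of_ae (Measure.ae_ne volume 1)
      filter_upwards [ae_restrict_mem measurableSet_Ioi, h1] with w hw hw1
      have hw' : t < w := hw
      rcases lt_or_gt_of_ne hw1 with h | h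
      · rw [indicator_of_mem (show w ∈ Ioo t 1 from ⟨hw, h⟩), latticeThetaModif,
          indicator_of_notMem (by simpa using h.le), indicator_of_mem (show w ∈ Ioo 0 1 from
            ⟨ht0.trans hw', h⟩)]
        ring
      · rw [indicator_of_notMem (fun h' ↦ absurd h'.2 (not_lt.2 h.le)), latticeThetaModif,
          indicator_of_mem (show w ∈ Ioi 1 from h),
          indicator_of_notMem (fun h' ↦ absurd h'.2 (not_lt.2 h.le))]
        ring
    rw [integral_congr_ae this, integral_indicator measurableSet_Ioo,
      Measure.restrict_restrict measurableSet_Ioo, inter_eq_left.2 (fun w hw ↦ hw.1)]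
  rw [e, integral_inv_sub_one_mul ht0]
  ring

/-! ### Unfolding over the modular group -/

/-- The vertical strip `-1/2 ≤ Re τ < 1/2`, a fundamental domain for integer translations. -/
def strip : Set ℍ := {τ | τ.re ∈ Ico (-(1 / 2) : ℝ) (1 / 2)}

theorem measurableSet_strip : MeasurableSet strip :=
  measurableSet_Ico.preimage UpperHalfPlane.continuous_re.measurable

/-- Coprime pairs of integers, the possible bottom rows of matrices in `SL₂(ℤ)`. -/
abbrev CoprimePair : Type := {x : Fin 2 → ℤ // IsCoprime (x 0) (x 1)}

/-- The imaginary part of `γ τ` in terms of the bottom row `x` of `γ`. -/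
noncomputable def rowIm (τ : ℍ) (x : CoprimePair) : ℝ := (latticeForm τ x.1)⁻¹

theorem CoprimePair.ne_zero (x : CoprimePair) : x.1 ≠ 0 := by
  intro h
  have := x.2
  simp [h, isCoprime_zero_left] at this

theorem rowIm_pos (τ : ℍ) (x : CoprimePair) : 0 < rowIm τ x :=
  inv_pos.2 (latticeForm_pos τ x.ne_zero)

/-- The bottom row of a matrix in `SL₂(ℤ)`. -/
def bottomRow (γ : SL(2, ℤ)) : CoprimePair := ⟨γ.1 1, ModularGroup.bottom_row_coprime γ⟩

theorem im_smul_eq_rowIm (τ : ℍ) (γ : SL(2, ℤ)) : (γ • τ).im = rowIm τ (bottomRow γ) := by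
  rw [ModularGroup.im_smul_eq_div_normSq, rowIm, latticeForm, inv_div, ModularGroup.denom_apply]
  rfl

/-- Above every coprime pair there is exactly one matrix that moves `τ` into the strip. -/
theorem bijective_bottomRow_strip (τ : ℍ) :
    Function.Bijective fun γ : {γ : SL(2, ℤ) // γ • τ ∈ strip} ↦ bottomRow γ.1 := by
  constructor
  · rintro ⟨γ, hγ⟩ ⟨δ, hδ⟩ h
    have h' : γ.1 1 = δ.1 1 := congrArg Subtype.val h
    have h0 : γ.1 1 0 = δ.1 1 0 := congrFun h' 0
    have h1 : γ.1 1 1 = δ.1 1 1 := congrFun h' 1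
    have dγ := γ.2
    have dδ := δ.2
    rw [Matrix.det_fin_two] at dγ dδ
    set n : ℤ := δ.1 0 1 * γ.1 0 0 - δ.1 0 0 * γ.1 0 1 with hn
    -- Matrices with the same bottom row differ by a power of `T`, that is, by a translation.
    have e : δ = ModularGroup.T ^ n * γ := by
      ext i j
      fin_cases i <;> fin_cases j
      · simp [ModularGroup.coe_T_zpow, Matrix.mul_apply, hn]
        rw [← h0, ← h1] at dδ
        linear_combination (δ.1 0 0) * (- dγ) + (γ.1 0 0) * dδ
      · simp [ModularGroup.coe_T_zpow, Matrix.mul_apply, hn]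
        rw [← h0, ← h1] at dδ
        linear_combination (δ.1 0 1) * (- dγ) + (γ.1 0 1) * dδ
      · simp [h0]
      · simp [h1]
    have hre : (δ • τ).re = (γ • τ).re + n := by
      rw [e, mul_smul, ModularGroup.re_T_zpow_smul]
    have hn0 : n = 0 := by
      have l1 := hγ.1; have l2 := hγ.2; have l3 := hδ.1; have l4 := hδ.2
      rw [hre] at l3 l4
      have a1 : (n : ℝ) < 1 := by linarith
      have a2 : (-1 : ℝ) < n := by linarith
      have a1' : n < 1 := by exact_mod_cast a1
      have a2' : -1 < n := by exact_mod_cast a2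
      omega
    rw [Subtype.mk.injEq, e, hn0]
    simp
  · rintro ⟨x, hx⟩
    obtain ⟨γ, -, hγ⟩ := ModularGroup.bottom_row_surj hx
    set n : ℤ := -⌊(γ • τ).re + 1 / 2⌋ with hn
    refine ⟨⟨ModularGroup.T ^ n * γ, ?_⟩, ?_⟩
    · have h1 := Int.floor_le ((γ • τ).re + 1 / 2)
      have h2 := Int.lt_floor_add_one ((γ • τ).re + 1 / 2)
      rw [mul_smul]
      refine ⟨?_, ?_⟩ <;> rw [ModularGroup.re_T_zpow_smul, hn] <;> push_cast <;> linarith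
    · subst hγ
      apply Subtype.ext
      ext j
      fin_cases j <;> simp [bottomRow]

/-- Sums over the matrices that move `τ` into the strip are sums over coprime pairs. -/
theorem tsum_strip_eq (τ : ℍ) (g : ℝ → ℝ≥0∞) :
    ∑' γ : SL(2, ℤ), strip.indicator (fun z ↦ g z.im) (γ • τ) =
      ∑' x : CoprimePair, g (rowIm τ x) := by
  rw [← (Equiv.ofBijective _ (bijective_bottomRow_strip τ)).tsum_eq]
  have : ∀ γ : SL(2, ℤ), strip.indicator (fun z ↦ g z.im) (γ • τ) =
      {γ : SL(2, ℤ) | γ • τ ∈ strip}.indicator (fun γ ↦ g (rowIm τ (bottomRow γ))) γ := by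
    intro γ
    by_cases h : γ • τ ∈ strip
    · rw [indicator_of_mem h, indicator_of_mem (show γ ∈ {γ : SL(2, ℤ) | γ • τ ∈ strip} from h),
        im_smul_eq_rowIm]
    · rw [indicator_of_notMem h,
        indicator_of_notMem (show γ ∉ {γ : SL(2, ℤ) | γ • τ ∈ strip} from h)]
  rw [tsum_congr this]
  exact (tsum_subtype {γ : SL(2, ℤ) | γ • τ ∈ strip} _).symm

instance : Countable SL(2, ℤ) :=
  haveI : Countable (Matrix (Fin 2) (Fin 2) ℤ) := inferInstanceAs (Countable (Fin 2 → Fin 2 → ℤ))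
  Subtype.countable

theorem measurePreserving_sl_smul (γ : SL(2, ℤ)) :
    MeasurePreserving (fun τ : ℍ ↦ γ • τ) volume volume := by
  have := measurePreserving_smul (γ : GL (Fin 2) ℝ) (volume : Measure ℍ)
  exact this

theorem measurable_sl_smul (γ : SL(2, ℤ)) : Measurable fun τ : ℍ ↦ γ • τ :=
  (measurePreserving_sl_smul γ).measurable

theorem volume_re_eq (c : ℝ) : volume {z : ℂ | z.re = c} = 0 := by
  have : {z : ℂ | z.re = c} = Complex.measurableEquivRealProd ⁻¹' ({c} ×ˢ univ) := by
    ext z; simp [Complex.measurableEquivRealProd_apply]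
  rw [this, Complex.volume_preserving_equiv_real_prod.measure_preimage_equiv,
    Measure.volume_eq_prod, Measure.prod_prod]
  simp

theorem volume_fd_diff_fdo : volume (ModularGroup.fd \ ModularGroup.fdo) = 0 := by
  rw [volume_eq_lintegral]
  refine setLIntegral_measure_zero _ _ (measure_mono_null (t := {z : ℂ | z.re = 1 / 2} ∪
    {z : ℂ | z.re = -(1 / 2)} ∪ Metric.sphere (0 : ℂ) 1) ?_ ?_)
  · rintro _ ⟨τ, ⟨⟨h1, h2⟩, h3⟩, rfl⟩
    simp only [ModularGroup.fdo, Set.mem_ofPred_eq, not_and, not_lt] at h3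
    by_cases h : 1 < Complex.normSq τ
    · have h4 := le_antisymm h2 (h3 h)
      left
      rcases abs_choice τ.re with h5 | h5
      · left; simp; rw [h5] at h4; linarith
      · right; simp; rw [h5] at h4; linarith
    · right
      have : Complex.normSq τ = 1 := le_antisymm (not_lt.1 h) h1
      rw [Complex.normSq_eq_norm_sq, pow_eq_one_iff_of_nonneg (norm_nonneg _) two_ne_zero]
        at this
      simpa using this
  · refine measure_union_null (measure_union_null (volume_re_eq _) (volume_re_eq _)) ?_
    exact Measure.addHaar_sphere _ _ _

/-- Almost every orbit of `SL₂(ℤ)` meets the standard fundamental domain for exactly two group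
elements `±γ`. -/
theorem ae_tsum_indicator_fd :
    ∀ᵐ τ : ℍ, ∑' γ : SL(2, ℤ), (ModularGroup.fd).indicator (1 : ℍ → ℝ≥0∞) (γ • τ) = 2 := by
  have hae : ∀ᵐ τ : ℍ, ∀ γ : SL(2, ℤ), γ • τ ∉ ModularGroup.fd \ ModularGroup.fdo := by
    rw [ae_all_iff]
    intro γ
    have := (measurePreserving_sl_smul γ).quasiMeasurePreserving.ae
      (measure_eq_zero_iff_ae_notMem.1 volume_fd_diff_fdo)
    exact this
  filter_upwards [hae] with τ hτ
  obtain ⟨γ, hγ⟩ := ModularGroup.exists_smul_mem_fd τ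
  have hγo : γ • τ ∈ ModularGroup.fdo := by
    by_contra h
    exact hτ γ ⟨hγ, h⟩
  have hmem : ∀ δ : SL(2, ℤ), δ • τ ∈ ModularGroup.fd ↔ δ ∈ ({γ, -γ} : Finset SL(2, ℤ)) := by
    intro δ
    rw [Finset.mem_insert, Finset.mem_singleton]
    constructor
    · intro h
      have h' : (δ * γ⁻¹) • (γ • τ) ∈ ModularGroup.fd := by
        rwa [← mul_smul, inv_mul_cancel_right]
      rcases ModularGroup.eq_one_or_neg_one_of_mem_fdo_mem_fd hγo h' with h | h
      · left; rwa [mul_inv_eq_one] at h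
      · right; rw [mul_inv_eq_iff_eq_mul] at h; simpa using h
    · rintro (rfl | rfl)
      · exact hγ
      · rwa [ModularGroup.SL_neg_smul]
  have hne : γ ≠ -γ := by
    intro h
    have hdet := γ.2
    have h1 : ∀ i j, γ.1 i j = 0 := by
      intro i j
      have := congrArg (fun δ : SL(2, ℤ) ↦ δ.1 i j) h
      simp only [Matrix.SpecialLinearGroup.coe_neg, Matrix.neg_apply] at this
      omega
    rw [Matrix.det_fin_two] at hdet
    simp [h1] at hdet
  rw [tsum_eq_sum (s := {γ, -γ}), Finset.sum_pair hne, indicator_of_mem ((hmem γ).2 (by simp)),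
    indicator_of_mem ((hmem (-γ)).2 (by simp))]
  · simp only [Pi.one_apply]; norm_num
  · intro δ hδ
    exact indicator_of_notMem (fun h ↦ hδ ((hmem δ).1 h)) _

theorem measurableSet_fd : MeasurableSet ModularGroup.fd := ModularGroup.isClosed_fd.measurableSet

/-- Integrals over `ℍ` as integrals over the fundamental domain; the factor `2` is due to `-1`
acting trivially. -/
theorem two_mul_lintegral_eq {F : ℍ → ℝ≥0∞} (hF : Measurable F) :
    2 * ∫⁻ τ, F τ = ∫⁻ τ in ModularGroup.fd, ∑' γ : SL(2, ℤ), F (γ • τ) := by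
  have hind : Measurable ((ModularGroup.fd).indicator (1 : ℍ → ℝ≥0∞)) :=
    measurable_one.indicator measurableSet_fd
  calc 2 * ∫⁻ τ, F τ = ∫⁻ τ, ∑' γ : SL(2, ℤ),
        (ModularGroup.fd).indicator (1 : ℍ → ℝ≥0∞) (γ • τ) * F τ := by
        rw [← lintegral_const_mul _ hF]
        refine lintegral_congr_ae ?_
        filter_upwards [ae_tsum_indicator_fd] with τ hτ
        rw [ENNReal.tsum_mul_right, hτ]
    _ = ∑' γ : SL(2, ℤ), ∫⁻ τ, (ModularGroup.fd).indicator (1 : ℍ → ℝ≥0∞) (γ • τ) * F τ :=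
        lintegral_tsum fun γ ↦ ((hind.comp (measurable_sl_smul γ)).mul hF).aemeasurable
    _ = ∑' γ : SL(2, ℤ), ∫⁻ τ, (ModularGroup.fd).indicator (1 : ℍ → ℝ≥0∞) τ * F (γ⁻¹ • τ) := by
        refine tsum_congr fun γ ↦ ?_
        have := (measurePreserving_sl_smul γ).lintegral_comp
          (hind.mul (hF.comp (measurable_sl_smul γ⁻¹)))
        simpa using this
    _ = ∑' γ : SL(2, ℤ), ∫⁻ τ, (ModularGroup.fd).indicator (1 : ℍ → ℝ≥0∞) τ * F (γ • τ) :=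
        (Equiv.inv SL(2, ℤ)).tsum_eq
          fun γ ↦ ∫⁻ τ, (ModularGroup.fd).indicator (1 : ℍ → ℝ≥0∞) τ * F (γ • τ)
    _ = ∫⁻ τ, (ModularGroup.fd).indicator (fun τ ↦ ∑' γ : SL(2, ℤ), F (γ • τ)) τ := by
        refine (lintegral_tsum (f := fun (γ : SL(2, ℤ)) τ ↦
          (ModularGroup.fd).indicator (1 : ℍ → ℝ≥0∞) τ * F (γ • τ))
          fun γ ↦ (hind.mul (hF.comp (measurable_sl_smul γ))).aemeasurable).symm.trans ?_
        refine lintegral_congr fun τ ↦ ?_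
        rw [ENNReal.tsum_mul_left]
        by_cases h : τ ∈ ModularGroup.fd <;> simp [h]
    _ = _ := lintegral_indicator measurableSet_fd _

/-- Unfolding: the integral over the strip of an invariant function times a function of `Im τ`. -/
theorem two_mul_lintegral_strip {v : ℍ → ℝ≥0∞} (hv : Measurable v)
    (hinv : ∀ (γ : SL(2, ℤ)) (τ : ℍ), v (γ • τ) = v τ) {g : ℝ → ℝ≥0∞} (hg : Measurable g) :
    2 * ∫⁻ τ in strip, v τ * g τ.im =
      ∫⁻ τ in ModularGroup.fd, v τ * ∑' x : CoprimePair, g (rowIm τ x) := by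
  have hm : Measurable fun τ : ℍ ↦ v τ * strip.indicator (fun z ↦ g z.im) τ :=
    hv.mul ((hg.comp UpperHalfPlane.continuous_im.measurable).indicator measurableSet_strip)
  have h := two_mul_lintegral_eq hm
  have e : ∫⁻ τ in strip, v τ * g τ.im =
      ∫⁻ τ, v τ * strip.indicator (fun z ↦ g z.im) τ := by
    rw [← lintegral_indicator measurableSet_strip]
    refine lintegral_congr fun τ ↦ ?_
    by_cases h : τ ∈ strip <;> simp [h]
  rw [e, h]
  refine lintegral_congr fun τ ↦ ?_
  simp_rw [hinv]
  rw [ENNReal.tsum_mul_left, tsum_strip_eq]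

/-- The measure `dx dy / y²` on `[-1/2, 1/2) × (0, ∞)`. -/
noncomputable def stripMeasure : Measure (ℝ × ℝ) :=
  (volume.restrict (Ico (-(1 / 2)) (1 / 2))).prod
    ((volume.restrict (Ioi 0)).withDensity fun y ↦ ENNReal.ofReal (y ^ 2)⁻¹)

/-- The real and imaginary parts of a point of the upper half-plane. -/
def reIm (τ : ℍ) : ℝ × ℝ := (τ.re, τ.im)

theorem measurableEmbedding_reIm : MeasurableEmbedding reIm :=
  Complex.measurableEquivRealProd.measurableEmbedding.comp measurableEmbedding_coe

theorem measurePreserving_reIm :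
    MeasurePreserving reIm (volume.restrict strip) stripMeasure := by
  refine ⟨measurableEmbedding_reIm.measurable, ?_⟩
  ext s hs
  have hd : Measurable fun y : ℝ ↦ ENNReal.ofReal (y ^ 2)⁻¹ := by fun_prop
  have hd2 : Measurable fun p : ℝ × ℝ ↦ ENNReal.ofReal (p.2 ^ 2)⁻¹ := by fun_prop
  rw [Measure.map_apply measurableEmbedding_reIm.measurable hs,
    Measure.restrict_apply (measurableEmbedding_reIm.measurable hs), volume_eq_lintegral,
    stripMeasure, prod_withDensity_right hd, Measure.prod_restrict, withDensity_apply _ hs,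
    Measure.restrict_restrict hs]
  have himg : UpperHalfPlane.coe '' (reIm ⁻¹' s ∩ strip) =
      Complex.measurableEquivRealProd ⁻¹' (s ∩ Ico (-(1 / 2)) (1 / 2) ×ˢ Ioi 0) := by
    ext z
    constructor
    · rintro ⟨τ, ⟨h1, h2⟩, rfl⟩
      exact ⟨h1, h2, τ.im_pos⟩
    · rintro ⟨h1, h2, h3⟩
      exact ⟨⟨z, h3⟩, ⟨h1, h2⟩, rfl⟩
  rw [himg, ← Measure.volume_eq_prod, ← (Complex.volume_preserving_equiv_real_prod).setLIntegral_comp_preimage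
    (hs.inter (measurableSet_Ico.prod measurableSet_Ioi)) hd2]
  refine lintegral_congr fun z ↦ ?_
  rw [Complex.measurableEquivRealProd_apply, ENNReal.ofReal]
  congr 1
  ext
  rw [Real.coe_toNNReal _ (by positivity)]
  simp

/-! ### Jensen's formula for modular forms -/

section Jensen

variable {k : ℤ} (f : ModularForm 𝒮ℒ k)

/-- The order of vanishing of `f` at `τ`, as in the definition of `HasDivisor`. -/
noncomputable def vanishingOrder (f : ℍ → ℂ) (τ : ℍ) : ℕ∞ :=
  analyticOrderAt (fun z : ℂ ↦ f (ofComplex z)) (τ : ℂ)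

theorem cuspFunction_qParam (τ : ℍ) :
    cuspFunction 1 f (Function.Periodic.qParam 1 τ) = f τ :=
  SlashInvariantFormClass.eq_cuspFunction f τ one_mem_strictPeriods_SL one_ne_zero

theorem analyticOnNhd_cuspFunction : AnalyticOnNhd ℂ (cuspFunction 1 f) (Metric.ball 0 1) := by
  refine DifferentiableOn.analyticOnNhd (fun q hq ↦ ?_) Metric.isOpen_ball
  exact (ModularFormClass.differentiableAt_cuspFunction f one_pos one_mem_strictPeriods_SL
    (by simpa using hq)).differentiableWithinAt

variable {f} in
theorem cuspFunction_zero_of_tendsto {c : ℂ} (hf : Tendsto f atImInfty (𝓝 c)) :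
    cuspFunction 1 f 0 = c := by
  rw [UpperHalfPlane.cuspFunction_apply_zero one_pos
    (ModularFormClass.analyticAt_cuspFunction_zero f one_pos one_mem_strictPeriods_SL)
    (SlashInvariantFormClass.periodic_comp_ofComplex f one_mem_strictPeriods_SL)]
  exact hf.limUnder_eq

theorem differentiableAt_comp_ofComplex (τ : ℍ) :
    DifferentiableAt ℂ (fun z : ℂ ↦ f (ofComplex z)) τ :=
  UpperHalfPlane.mdifferentiableAt_iff.mp (ModularFormClass.holo f τ)

theorem analyticAt_comp_ofComplex (τ : ℍ) :
    AnalyticAt ℂ (fun z : ℂ ↦ f (ofComplex z)) τ := by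
  refine DifferentiableOn.analyticAt (s := {z : ℂ | 0 < z.im}) (fun z hz ↦ ?_)
    ((isOpen_lt continuous_const Complex.continuous_im).mem_nhds τ.im_pos)
  exact (differentiableAt_comp_ofComplex f ⟨z, hz⟩).differentiableWithinAt

theorem deriv_qParam_ne_zero (z : ℂ) : deriv (Function.Periodic.qParam 1) z ≠ 0 := by
  have : HasDerivAt (Function.Periodic.qParam 1)
      (Complex.exp (2 * Real.pi * Complex.I * z / (1 : ℝ)) * (2 * Real.pi * Complex.I)) z := by
    have h : HasDerivAt (fun z : ℂ ↦ 2 * Real.pi * Complex.I * z / (1 : ℝ))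
        (2 * Real.pi * Complex.I) z := by
      simpa using (hasDerivAt_id z).const_mul (2 * Real.pi * Complex.I)
    exact h.cexp
  rw [this.deriv]
  exact mul_ne_zero (Complex.exp_ne_zero _) Complex.two_pi_I_ne_zero

/-- Since `q = exp (2πiτ)` is a local coordinate on the upper half-plane, the order of vanishing may
be read off from the function of `q` to which Jensen's formula applies. -/
theorem analyticOrderAt_cuspFunction (τ : ℍ) :
    analyticOrderAt (cuspFunction 1 f) (Function.Periodic.qParam 1 τ) = vanishingOrder f τ := by
  rw [← analyticOrderAt_comp_of_deriv_ne_zero (g := Function.Periodic.qParam 1) (z₀ := (τ : ℂ))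
    (Function.Periodic.differentiable_qParam.analyticAt _) (deriv_qParam_ne_zero _)]
  refine analyticOrderAt_congr ?_
  filter_upwards [(isOpen_lt continuous_const Complex.continuous_im).mem_nhds τ.im_pos] with z hz
  rw [Function.comp_apply, ofComplex_apply_of_im_pos hz]
  exact cuspFunction_qParam f ⟨z, hz⟩

theorem qParam_injOn_strip : InjOn (fun τ : ℍ ↦ Function.Periodic.qParam 1 (τ : ℂ)) strip := by
  intro z hz w hw h
  obtain ⟨m, hm⟩ := Function.Periodic.qParam_left_inv_mod_period (h := 1) one_ne_zero (z : ℂ)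
  obtain ⟨n, hn⟩ := Function.Periodic.qParam_left_inv_mod_period (h := 1) one_ne_zero (w : ℂ)
  have e : (z : ℂ) + m = w + n := by
    have h' : Function.Periodic.qParam 1 (z : ℂ) = Function.Periodic.qParam 1 (w : ℂ) := h
    rw [h', hn] at hm
    simpa using hm.symm
  have hre : z.re + m = w.re + n := by simpa using congrArg Complex.re e
  have h1 : ((m - n : ℤ) : ℝ) < 1 := by push_cast; linarith [hz.1, hz.2, hw.1, hw.2]
  have h2 : (-1 : ℝ) < ((m - n : ℤ) : ℝ) := by push_cast; linarith [hz.1, hz.2, hw.1, hw.2]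
  have h1' : m - n < 1 := by exact_mod_cast h1
  have h2' : -1 < m - n := by exact_mod_cast h2
  have : m = n := by omega
  rw [this] at e
  exact UpperHalfPlane.ext (add_right_cancel e)

theorem exists_strip_qParam_eq {u : ℂ} (h0 : u ≠ 0) (h1 : ‖u‖ < 1) :
    ∃ τ ∈ strip, Function.Periodic.qParam 1 (τ : ℂ) = u := by
  let σ : ℍ := ⟨Function.Periodic.invQParam 1 u,
    Function.Periodic.im_invQParam_pos_of_norm_lt_one one_pos h1 h0⟩
  have hσ : Function.Periodic.qParam 1 (σ : ℂ) = u :=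
    Function.Periodic.qParam_right_inv one_ne_zero h0
  set n : ℤ := -⌊σ.re + 1 / 2⌋ with hn
  refine ⟨ModularGroup.T ^ n • σ, ?_, ?_⟩
  · have h1 := Int.floor_le (σ.re + 1 / 2)
    have h2 := Int.lt_floor_add_one (σ.re + 1 / 2)
    refine ⟨?_, ?_⟩ <;> rw [ModularGroup.re_T_zpow_smul, hn] <;> push_cast <;> linarith
  · rw [ModularGroup.coe_T_zpow_smul_eq, ← hσ, Function.Periodic.qParam, Function.Periodic.qParam,
      Complex.exp_eq_exp_iff_exists_int]
    exact ⟨n, by push_cast; ring⟩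

theorem ofReal_add_mul_I_im_pos {y : ℝ} (hy : 0 < y) (x : ℝ) :
    0 < ((x : ℂ) + y * Complex.I).im := by simpa

theorem norm_qParam_strip (τ : ℍ) :
    ‖Function.Periodic.qParam 1 (τ : ℂ)‖ = Real.exp (-(2 * Real.pi * τ.im)) := by
  rw [Function.Periodic.norm_qParam]
  simp

theorem circleMap_eq_qParam (y θ : ℝ) :
    circleMap 0 (Real.exp (-(2 * Real.pi * y))) (2 * Real.pi * θ) =
      Function.Periodic.qParam 1 (θ + y * Complex.I) := by
  rw [circleMap, Function.Periodic.qParam, zero_add, Complex.ofReal_exp, ← Complex.exp_add]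
  congr 1
  push_cast
  linear_combination (-2 * Real.pi * y) * Complex.I_sq

theorem exp_neg_two_pi_lt_one {y : ℝ} (hy : 0 < y) : Real.exp (-(2 * Real.pi * y)) < 1 := by
  rw [Real.exp_lt_one_iff, neg_lt_zero]
  positivity

theorem closedBall_subset_ball {y : ℝ} (hy : 0 < y) :
    Metric.closedBall (0 : ℂ) |Real.exp (-(2 * Real.pi * y))| ⊆ Metric.ball 0 1 := by
  rw [abs_of_pos (Real.exp_pos _)]
  exact Metric.closedBall_subset_ball (exp_neg_two_pi_lt_one hy)

theorem log_norm_cuspFunction_circleMap {y : ℝ} (hy : 0 < y) (x : ℝ) :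
    Real.log ‖cuspFunction 1 f (circleMap 0 (Real.exp (-(2 * Real.pi * y))) (2 * Real.pi * x))‖ =
      Real.log ‖f (ofComplex (x + y * Complex.I))‖ := by
  rw [circleMap_eq_qParam, ofComplex_apply_of_im_pos (ofReal_add_mul_I_im_pos hy x)]
  congr 2
  exact cuspFunction_qParam f ⟨_, ofReal_add_mul_I_im_pos hy x⟩

theorem intervalIntegrable_log_norm {y : ℝ} (hy : 0 < y) (a b : ℝ) :
    IntervalIntegrable (fun x : ℝ ↦ Real.log ‖f (ofComplex (x + y * Complex.I))‖) volume a b := by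
  have h : CircleIntegrable (fun z ↦ Real.log ‖cuspFunction 1 f z‖) 0
      (Real.exp (-(2 * Real.pi * y))) :=
    MeromorphicOn.circleIntegrable_log_norm fun z hz ↦
      (analyticOnNhd_cuspFunction f z (closedBall_subset_ball hy
        (Metric.sphere_subset_closedBall hz))).meromorphicAt
  have hper : Function.Periodic (fun θ ↦ Real.log ‖cuspFunction 1 f
      (circleMap 0 (Real.exp (-(2 * Real.pi * y))) θ)‖) (2 * Real.pi) :=
    fun θ ↦ by simp only [periodic_circleMap 0 _ θ]
  have h2 := hper.intervalIntegrable₀ Real.two_pi_pos.ne' h (2 * Real.pi * a) (2 * Real.pi * b)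
  have h3 := h2.comp_mul_left (c := 2 * Real.pi)
  rw [mul_div_cancel_left₀ _ Real.two_pi_pos.ne', mul_div_cancel_left₀ _ Real.two_pi_pos.ne'] at h3
  simpa only [log_norm_cuspFunction_circleMap f hy] using h3

/-- The mean of `log |f|` over a horizontal segment of length one. -/
noncomputable def horizontalMean (y : ℝ) : ℝ :=
  ∫ x in (-(1 / 2) : ℝ)..(1 / 2), Real.log ‖f (ofComplex (x + y * Complex.I))‖

theorem horizontalMean_eq_circleAverage {y : ℝ} (hy : 0 < y) :
    horizontalMean f y = Real.circleAverage (fun z ↦ Real.log ‖cuspFunction 1 f z‖) 0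
      (Real.exp (-(2 * Real.pi * y))) := by
  rw [Real.circleAverage_eq_integral_add (-Real.pi), horizontalMean]
  have h := intervalIntegral.integral_comp_mul_add (a := -(1 / 2)) (b := 1 / 2)
    (fun θ ↦ Real.log ‖cuspFunction 1 f (circleMap 0 (Real.exp (-(2 * Real.pi * y)))
      (θ + -Real.pi))‖) Real.two_pi_pos.ne' Real.pi
  rw [show 2 * Real.pi * -(1 / 2) + Real.pi = 0 by ring,
    show 2 * Real.pi * (1 / 2) + Real.pi = 2 * Real.pi by ring] at h
  rw [← h]
  refine intervalIntegral.integral_congr fun x _ ↦ ?_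
  simp only [add_neg_cancel_right]
  exact (log_norm_cuspFunction_circleMap f hy x).symm

theorem untop₀_map_natCast (n : ℕ∞) : (ENat.map (Nat.cast : ℕ → ℤ) n).untop₀ = n.toNat := by
  cases n <;> simp

variable {f}

/-- Jensen's formula on the disc `|q| < exp (-2πy)`: the mean of `log |f|` at height `y` is a sum
over the zeros of `f` above height `y`, one for each class modulo integer translations. The centre
of the disc does not contribute, because `f` has the value `1` at the cusp. -/
theorem horizontalMean_eq_tsum (hf : Tendsto f atImInfty (𝓝 1)) {y : ℝ} (hy : 0 < y) :
    0 ≤ horizontalMean f y ∧ ENNReal.ofReal (horizontalMean f y) =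
      ∑' τ : ℍ, strip.indicator (fun τ ↦
        ENNReal.ofReal ((vanishingOrder f τ).toNat * (2 * Real.pi * (τ.im - y)))) τ := by
  set R := Real.exp (-(2 * Real.pi * y)) with hR
  have hR0 : 0 < R := Real.exp_pos _
  have hR1 : R < 1 := exp_neg_two_pi_lt_one hy
  have habs : |R| = R := abs_of_pos hR0
  have han : AnalyticOnNhd ℂ (cuspFunction 1 f) (Metric.closedBall 0 |R|) :=
    (analyticOnNhd_cuspFunction f).mono (closedBall_subset_ball hy)
  have h0 := cuspFunction_zero_of_tendsto hf
  have hJ := han.circleAverage_log_norm hR0.ne' (by rw [h0]; exact one_ne_zero)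
  rw [h0, norm_one, Real.log_one, add_zero, ← horizontalMean_eq_circleAverage f hy] at hJ
  set dv := MeromorphicOn.divisor (cuspFunction 1 f) (Metric.closedBall 0 |R|) with hdv
  set term : ℂ → ℝ := fun u ↦ dv u * Real.log (R * ‖0 - u‖⁻¹) with hterm
  have hnn : ∀ u, 0 ≤ term u := by
    intro u
    by_cases hu : u ∈ Metric.closedBall (0 : ℂ) |R|
    · have h1 : 0 ≤ dv u := by
        rw [hdv, MeromorphicOn.AnalyticOnNhd.divisor_apply han hu, untop₀_map_natCast]
        positivity
      refine mul_nonneg (by exact_mod_cast h1) ?_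
      by_cases hu0 : u = 0
      · simp [hu0]
      · have : 0 < ‖u‖ := norm_pos_iff.2 hu0
        refine Real.log_nonneg ?_
        rw [zero_sub, norm_neg, ← div_eq_mul_inv, one_le_div this]
        simpa [habs] using hu
    · simp [hterm, dv.apply_eq_zero_of_notMem hu]
  have hfin : (Function.support term).Finite := by
    refine ((dv.finiteSupport (isCompact_closedBall _ _)).subset fun u hu ↦ ?_)
    intro h
    exact hu (by simp [hterm, h])
  rw [hJ]
  refine ⟨finsum_nonneg hnn, ?_⟩
  have hsum : HasSum term (∑ᶠ u, term u) := by
    rw [finsum_eq_sum _ hfin]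
    exact hasSum_sum_of_ne_finset_zero fun u hu ↦ by simpa using hu
  rw [← hsum.tsum_eq, ENNReal.ofReal_tsum_of_nonneg hnn hsum.summable]
  -- a term of the sum at `q(τ)`
  have hq : ∀ τ : ℍ, ENNReal.ofReal (term (Function.Periodic.qParam 1 (τ : ℂ))) =
      ENNReal.ofReal ((vanishingOrder f τ).toNat * (2 * Real.pi * (τ.im - y))) := by
    intro τ
    by_cases hτ : y ≤ τ.im
    · have hu : Function.Periodic.qParam 1 (τ : ℂ) ∈ Metric.closedBall (0 : ℂ) |R| := by
        rw [mem_closedBall_zero_iff, norm_qParam_strip, habs, hR, Real.exp_le_exp]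
        have := mul_le_mul_of_nonneg_left hτ Real.two_pi_pos.le
        linarith
      simp only [hterm, hdv]
      rw [MeromorphicOn.AnalyticOnNhd.divisor_apply han hu, analyticOrderAt_cuspFunction,
        untop₀_map_natCast, zero_sub, norm_neg, norm_qParam_strip, hR, ← Real.exp_neg, ← Real.exp_add, Real.log_exp]
      congr 1
      push_cast
      ring
    · have hu : Function.Periodic.qParam 1 (τ : ℂ) ∉ Metric.closedBall (0 : ℂ) |R| := by
        rw [mem_closedBall_zero_iff, norm_qParam_strip, habs, hR, Real.exp_le_exp, not_le]
        have := mul_lt_mul_of_pos_left (not_le.1 hτ) Real.two_pi_pos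
        linarith
      simp only [hterm, dv.apply_eq_zero_of_notMem hu]
      have h1 : (vanishingOrder f τ).toNat * (2 * Real.pi * (τ.im - y)) ≤ 0 :=
        mul_nonpos_of_nonneg_of_nonpos (by positivity)
          (mul_nonpos_of_nonneg_of_nonpos (by positivity) (by linarith [not_le.1 hτ]))
      rw [ENNReal.ofReal_of_nonpos h1]
      simp
  rw [← tsum_subtype strip, ← tsum_subtype_eq_of_support_subset
    (s := (fun τ : ℍ ↦ Function.Periodic.qParam 1 (τ : ℂ)) '' strip)]
  · rw [tsum_image (fun u ↦ ENNReal.ofReal (term u)) qParam_injOn_strip]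
    exact tsum_congr fun τ ↦ hq τ
  · intro u hu
    by_cases hu0 : u = 0
    · simp [hu0, hterm] at hu
    · have hu1 : u ∈ Metric.closedBall (0 : ℂ) |R| := by
        by_contra h
        simp [hterm, dv.apply_eq_zero_of_notMem h] at hu
      exact exists_strip_qParam_eq hu0 (by simpa using closedBall_subset_ball hy hu1)

end Jensen

/-! ### Sums over the zeros of a modular form -/

instance finite_stabilizer (τ : ℍ) : Finite (MulAction.stabilizer SL(2, ℤ) τ) := by
  have h : {g : 𝒮ℒ | g • τ = τ}.Finite := ProperlyDiscontinuousSMul.finite_stabilizer' 𝒮ℒ τ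
  have := h.to_subtype
  refine Finite.of_injective (β := {g : 𝒮ℒ | g • τ = τ})
    (fun γ ↦ ⟨⟨Matrix.SpecialLinearGroup.mapGL ℝ γ.1, ⟨γ.1, rfl⟩⟩, γ.2⟩) fun γ δ hγδ ↦ ?_
  have h1 := congrArg (fun x : {g : 𝒮ℒ | g • τ = τ} ↦ (x.1.1 : GL (Fin 2) ℝ)) hγδ
  exact Subtype.ext (Matrix.SpecialLinearGroup.mapGL_injective h1)

theorem ramification_pos (τ : ℍ) : 0 < ramification τ :=
  div_pos (by exact_mod_cast Nat.card_pos) two_pos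

theorem toModularCurve_eq_iff {σ τ : ℍ} :
    toModularCurve σ = toModularCurve τ ↔ ∃ γ : SL(2, ℤ), γ • τ = σ := by
  rw [toModularCurve, toModularCurve, Quotient.eq]
  exact Iff.rfl

theorem toModularCurve_smul (γ : SL(2, ℤ)) (τ : ℍ) :
    toModularCurve (γ • τ) = toModularCurve τ := toModularCurve_eq_iff.2 ⟨γ, rfl⟩

theorem toModularCurve_out (P : ModularCurve) : toModularCurve P.out = P := Quotient.out_eq P

/-- The matrices that carry `ρ` to a given point of its orbit form a coset of a stabilizer. -/
theorem card_smul_eq {ρ z : ℍ} (h : toModularCurve z = toModularCurve ρ) :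
    ENat.card {γ : SL(2, ℤ) // γ • ρ = z} = (Nat.card (MulAction.stabilizer SL(2, ℤ) z) : ℕ∞) := by
  obtain ⟨γ₀, rfl⟩ := toModularCurve_eq_iff.1 h
  rw [← ENat.card_eq_coe_natCard]
  refine ENat.card_congr ⟨fun γ ↦ ⟨γ.1 * γ₀⁻¹, ?_⟩, fun δ ↦ ⟨δ.1 * γ₀, ?_⟩, fun γ ↦ ?_, fun δ ↦ ?_⟩
  · rw [MulAction.mem_stabilizer_iff, ← mul_smul, inv_mul_cancel_right, γ.2]
  · rw [mul_smul]; exact δ.2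
  · exact Subtype.ext (inv_mul_cancel_right _ _)
  · exact Subtype.ext (mul_inv_cancel_right _ _)

open Classical in
/-- A sum over the group as a sum over the orbit, each point being counted as often as the order of
its stabilizer; this is where the multiplicities `1 / e_τ` of the divisor come from. -/
theorem tsum_smul_eq (ρ : ℍ) (G : ℍ → ℝ≥0∞) :
    ∑' γ : SL(2, ℤ), G (γ • ρ) = ∑' z : ℍ, if toModularCurve z = toModularCurve ρ then
      (Nat.card (MulAction.stabilizer SL(2, ℤ) z) : ℝ≥0∞) * G z else 0 := by
  rw [← (Equiv.sigmaFiberEquiv fun γ : SL(2, ℤ) ↦ γ • ρ).tsum_eq, ENNReal.tsum_sigma']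
  refine tsum_congr fun z ↦ ?_
  have h1 : ∀ γ : {γ : SL(2, ℤ) // γ • ρ = z},
      G (Equiv.sigmaFiberEquiv (fun γ : SL(2, ℤ) ↦ γ • ρ) ⟨z, γ⟩ • ρ) = G z := fun γ ↦ by
    rw [Equiv.sigmaFiberEquiv_apply, γ.2]
  rw [tsum_congr h1, ENNReal.tsum_const]
  split_ifs with h
  · rw [card_smul_eq h]
    simp
  · have : IsEmpty {γ : SL(2, ℤ) // γ • ρ = z} := ⟨fun γ ↦ h (by rw [← γ.2, toModularCurve_smul])⟩
    rw [(ENat.card_eq_zero_iff_empty _).2 this]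
    simp

variable {f : ℍ → ℂ} {Z : Divisor}

theorem HasDivisor.coeff_eq (hZ : HasDivisor f Z) (τ : ℍ) :
    Z (toModularCurve τ) = (vanishingOrder f τ).toNat / ramification τ := by
  obtain ⟨n, h1, h2⟩ := hZ τ
  rw [h2, vanishingOrder, h1]
  simp

theorem HasDivisor.coeff_nonneg (hZ : HasDivisor f Z) (P : ModularCurve) : 0 ≤ Z P := by
  rw [← toModularCurve_out P, hZ.coeff_eq]
  exact div_nonneg (Nat.cast_nonneg _) (ramification_pos _).le

/-- Sums over the zeros of `f`, in terms of the divisor of `f`. -/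
theorem HasDivisor.tsum_vanishingOrder (hZ : HasDivisor f Z) (G : ℍ → ℝ≥0∞) :
    ∑' τ : ℍ, (((vanishingOrder f τ).toNat : ℕ) : ℝ≥0∞) * G τ =
      ∑ P ∈ Z.support, ENNReal.ofReal (Z P / 2) * ∑' γ : SL(2, ℤ), G (γ • P.out) := by
  classical
  simp_rw [tsum_smul_eq, ← ENNReal.tsum_mul_left]
  rw [← Summable.tsum_finsetSum fun _ _ ↦ ENNReal.summable]
  refine tsum_congr fun τ ↦ ?_
  simp_rw [toModularCurve_out, mul_ite, mul_zero]
  rw [Finset.sum_ite_eq]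
  have hc := hZ.coeff_eq τ
  have hn : ((vanishingOrder f τ).toNat : ℝ) =
      (Z (toModularCurve τ) / 2 : ℝ) * Nat.card (MulAction.stabilizer SL(2, ℤ) τ) := by
    have : ((vanishingOrder f τ).toNat : ℚ) = Z (toModularCurve τ) / 2 *
        Nat.card (MulAction.stabilizer SL(2, ℤ) τ) := by
      have h0 : (Nat.card (MulAction.stabilizer SL(2, ℤ) τ) : ℚ) ≠ 0 := by
        exact_mod_cast Nat.card_pos.ne'
      rw [hc, ramification]
      field_simp
    exact_mod_cast this
  split_ifs with h
  · rw [← mul_assoc, ← ENNReal.ofReal_natCast, ← ENNReal.ofReal_natCast, ← ENNReal.ofReal_mul, ← hn]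
    have := hZ.coeff_nonneg (toModularCurve τ)
    have : (0 : ℝ) ≤ Z (toModularCurve τ) := by exact_mod_cast this
    positivity
  · rw [Finsupp.notMem_support_iff] at h
    rw [h] at hn
    simp only [Rat.cast_zero, zero_div, zero_mul, Nat.cast_eq_zero] at hn
    simp [hn]

/-- The mean of `log |f|` at height `y` in terms of the divisor of `f`. -/
theorem HasDivisor.horizontalMean_eq {k : ℤ} {f : ModularForm 𝒮ℒ k} (hZ : HasDivisor f Z)
    (hf : Tendsto f atImInfty (𝓝 1)) {y : ℝ} (hy : 0 < y) :
    ENNReal.ofReal (horizontalMean f y) = ∑ P ∈ Z.support, ENNReal.ofReal (Real.pi * Z P) *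
      ∑' x : CoprimePair, ENNReal.ofReal (rowIm P.out x - y) := by
  have h1 : ∀ τ : ℍ, strip.indicator (fun τ ↦
        ENNReal.ofReal ((vanishingOrder f τ).toNat * (2 * Real.pi * (τ.im - y)))) τ =
      (((vanishingOrder f τ).toNat : ℕ) : ℝ≥0∞) *
        strip.indicator (fun τ ↦ ENNReal.ofReal (2 * Real.pi * (τ.im - y))) τ := by
    intro τ
    by_cases h : τ ∈ strip
    · rw [indicator_of_mem h, indicator_of_mem h, ENNReal.ofReal_mul (by positivity),
        ENNReal.ofReal_natCast]
    · rw [indicator_of_notMem h, indicator_of_notMem h, mul_zero]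
  rw [(horizontalMean_eq_tsum hf hy).2, tsum_congr h1, hZ.tsum_vanishingOrder]
  refine Finset.sum_congr rfl fun P _ ↦ ?_
  have h2 := tsum_strip_eq P.out fun t ↦ ENNReal.ofReal (2 * Real.pi * (t - y))
  rw [h2]
  simp_rw [ENNReal.ofReal_mul Real.two_pi_pos.le]
  have : (0 : ℝ) ≤ Z P := by exact_mod_cast hZ.coeff_nonneg P
  rw [ENNReal.tsum_mul_left, ← mul_assoc, ← ENNReal.ofReal_mul (by positivity)]
  congr 2
  ring

/-! ### The theta series as an incomplete Eisenstein series -/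

/-- The function `y ↦ ∑_{c ≥ 1} exp (-π t c² / y)`, whose incomplete Eisenstein series is
`latticeTheta - 1`. -/
noncomputable def seedTheta (t y : ℝ) : ℝ≥0∞ :=
  ∑' c : ℕ, ENNReal.ofReal (Real.exp (-Real.pi * t * (c + 1 : ℝ) ^ 2 * y⁻¹))

theorem measurable_seedTheta (t : ℝ) : Measurable (seedTheta t) :=
  Measurable.tsum fun c ↦ by fun_prop

theorem latticeForm_smul (τ : ℍ) (n : ℤ) (v : Fin 2 → ℤ) :
    latticeForm τ (n • v) = (n : ℝ) ^ 2 * latticeForm τ v := by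
  have : ((n • v) 0 : ℂ) * τ + (n • v) 1 = n * (v 0 * τ + v 1) := by
    simp; ring
  rw [latticeForm, this, latticeForm, map_mul, Complex.normSq_intCast]
  ring

/-- Every nonzero vector is a positive multiple of a coprime pair in a unique way. -/
theorem bijective_smul_coprimePair : Function.Bijective
    fun p : ℕ × CoprimePair ↦ (⟨((p.1 : ℤ) + 1) • p.2.1, smul_ne_zero (by omega) p.2.ne_zero⟩ :
      {v : Fin 2 → ℤ // v ≠ 0}) := by
  have hgcd : ∀ (c : ℕ) (x : CoprimePair),
      Int.gcd (((c : ℤ) + 1) * x.1 0) (((c : ℤ) + 1) * x.1 1) = c + 1 := by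
    intro c x
    rw [Int.gcd_mul_left, Int.isCoprime_iff_gcd_eq_one.1 x.2]
    omega
  constructor
  · rintro ⟨c, x⟩ ⟨d, y⟩ h
    have h' : ((c : ℤ) + 1) • x.1 = ((d : ℤ) + 1) • y.1 := congrArg Subtype.val h
    have h0 := congrFun h' 0
    have h1 := congrFun h' 1
    simp only [Pi.smul_apply, smul_eq_mul] at h0 h1
    have hcd : c + 1 = d + 1 := by
      rw [← hgcd c x, ← hgcd d y, h0, h1]
    obtain rfl : c = d := by omega
    have : x.1 = y.1 := smul_right_injective _ (by omega : (c : ℤ) + 1 ≠ 0) h'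
    rw [Subtype.ext this]
  · rintro ⟨v, hv⟩
    have hpos : 0 < Int.gcd (v 0) (v 1) := by
      refine Nat.pos_of_ne_zero fun h ↦ hv ?_
      rw [Int.gcd_eq_zero_iff] at h
      ext j; fin_cases j
      · exact h.1
      · exact h.2
    obtain ⟨m, n, hmn, h0, h1⟩ := Int.exists_gcd_one hpos
    refine ⟨⟨Int.gcd (v 0) (v 1) - 1, ⟨![m, n], Int.isCoprime_iff_gcd_eq_one.2 hmn⟩⟩, ?_⟩
    apply Subtype.ext
    have : ((Int.gcd (v 0) (v 1) - 1 : ℕ) : ℤ) + 1 = Int.gcd (v 0) (v 1) := by omega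
    ext j
    simp only [this, Pi.smul_apply, smul_eq_mul]
    fin_cases j
    · simp; rw [mul_comm]; exact h0.symm
    · simp; rw [mul_comm]; exact h1.symm

/-- The nonzero vectors of `ℤ²` are grouped into multiples of coprime pairs; thus `Θ - 1` is a sum
over the bottom rows of the matrices in `SL₂(ℤ)`. -/
theorem tsum_seedTheta_rowIm (τ : ℍ) {t : ℝ} (ht : 0 < t) :
    ∑' x : CoprimePair, seedTheta t (rowIm τ x) = ENNReal.ofReal (latticeTheta τ t - 1) := by
  have h1 : latticeTheta τ t - 1 =
      ∑' v : {v : Fin 2 → ℤ // v ≠ 0}, Real.exp (-Real.pi * latticeForm τ v.1 * t) := by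
    rw [latticeTheta_eq_one_add τ ht, add_sub_cancel_left]
    rw [← tsum_subtype_eq_of_support_subset (s := {v : Fin 2 → ℤ | v ≠ 0})]
    · exact tsum_congr fun v ↦ by rw [if_neg v.2]
    · intro v hv
      rw [Function.mem_support] at hv
      intro h
      simp [h] at hv
  have hsum : Summable fun v : {v : Fin 2 → ℤ // v ≠ 0} ↦
      Real.exp (-Real.pi * latticeForm τ v.1 * t) :=
    (summable_exp_latticeForm τ ht).subtype {v | v ≠ 0}
  rw [h1, ENNReal.ofReal_tsum_of_nonneg (fun _ ↦ (Real.exp_pos _).le) hsum,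
    ← (Equiv.ofBijective _ bijective_smul_coprimePair).tsum_eq, ENNReal.tsum_prod']
  simp_rw [seedTheta]
  rw [ENNReal.tsum_comm]
  refine tsum_congr fun c ↦ tsum_congr fun x ↦ ?_
  rw [Equiv.ofBijective_apply, latticeForm_smul, rowIm, inv_inv]
  congr 2
  push_cast
  ring

/-- The measure `dy / y²` on `(0, ∞)`. -/
noncomputable def heightMeasure : Measure ℝ :=
  (volume.restrict (Ioi 0)).withDensity fun y ↦ ENNReal.ofReal (y ^ 2)⁻¹

instance : SFinite heightMeasure := by unfold heightMeasure; infer_instance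

theorem stripMeasure_eq :
    stripMeasure = (volume.restrict (Ico (-(1 / 2)) (1 / 2))).prod heightMeasure := rfl

theorem ae_heightMeasure_pos : ∀ᵐ y ∂heightMeasure, 0 < y := by
  refine (withDensity_absolutelyContinuous _ _).ae_le ?_
  exact ae_restrict_mem measurableSet_Ioi

/-- The measure `dy / y²` is Lebesgue measure in the coordinate `w = 1 / y`. -/
theorem measurePreserving_inv_heightMeasure :
    MeasurePreserving (fun w : ℝ ↦ w⁻¹) (volume.restrict (Ioi 0)) heightMeasure := by
  refine ⟨measurable_inv, ?_⟩
  ext s hs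
  rw [Measure.map_apply measurable_inv hs, Measure.restrict_apply (measurable_inv hs),
    heightMeasure, withDensity_apply _ hs, Measure.restrict_restrict hs]
  have himg : (fun w : ℝ ↦ w⁻¹) ⁻¹' s ∩ Ioi 0 = (fun w : ℝ ↦ w⁻¹) '' (s ∩ Ioi 0) := by
    ext w
    constructor
    · rintro ⟨h1, h2⟩
      exact ⟨w⁻¹, ⟨h1, inv_pos.2 (mem_Ioi.1 h2)⟩, inv_inv w⟩
    · rintro ⟨y, ⟨h1, h2⟩, rfl⟩
      exact ⟨by simpa using h1, inv_pos.2 (mem_Ioi.1 h2)⟩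
  rw [himg, ← setLIntegral_one, lintegral_image_eq_lintegral_abs_deriv_mul
    (hs.inter measurableSet_Ioi) (f' := fun y ↦ -(y ^ 2)⁻¹)
    (fun y hy ↦ (hasDerivAt_inv (ne_of_gt hy.2)).hasDerivWithinAt)
    inv_injective.injOn]
  refine lintegral_congr fun y ↦ ?_
  rw [abs_neg, abs_of_nonneg (by positivity), mul_one]

theorem lintegral_heightMeasure (F : ℝ → ℝ≥0∞) :
    ∫⁻ y, F y ∂heightMeasure = ∫⁻ w in Ioi 0, F w⁻¹ :=
  (measurePreserving_inv_heightMeasure.lintegral_comp_emb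
    (MeasurableEquiv.inv ℝ).measurableEmbedding F).symm

theorem integral_heightMeasure (F : ℝ → ℝ) :
    ∫ y, F y ∂heightMeasure = ∫ w in Ioi 0, F w⁻¹ :=
  (measurePreserving_inv_heightMeasure.integral_comp
    (MeasurableEquiv.inv ℝ).measurableEmbedding F).symm

theorem integrable_heightMeasure_iff (F : ℝ → ℝ) :
    Integrable F heightMeasure ↔ IntegrableOn (fun w ↦ F w⁻¹) (Ioi 0) :=
  (measurePreserving_inv_heightMeasure.integrable_comp_emb
    (MeasurableEquiv.inv ℝ).measurableEmbedding).symm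

theorem ofComplex_reIm (τ : ℍ) : ofComplex ((reIm τ).1 + (reIm τ).2 * Complex.I) = τ := by
  have : (((reIm τ).1 : ℂ) + (reIm τ).2 * Complex.I) = (τ : ℂ) := by
    simpa [reIm] using Complex.re_add_im (τ : ℂ)
  rw [this, ofComplex_apply]

theorem measurable_ofComplex : Measurable fun z : ℂ ↦ (ofComplex z : ℍ) := by
  have : (fun z : ℂ ↦ (ofComplex z : ℍ)) = fun z ↦ if h : z ∈ {z : ℂ | 0 < z.im} then ⟨z, h⟩
      else Classical.choice inferInstance := by
    ext z
    by_cases h : 0 < z.im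
    · rw [dif_pos (show z ∈ {z : ℂ | 0 < z.im} from h), ofComplex_apply_of_im_pos h]
    · rw [dif_neg (show z ∉ {z : ℂ | 0 < z.im} from h), ofComplex_apply_of_im_nonpos (not_lt.1 h)]
  rw [this]
  have h : Measurable fun z : {z : ℂ | 0 < z.im} ↦ (⟨z.1, z.2⟩ : ℍ) :=
    measurableEmbedding_coe.measurable_comp_iff.1 measurable_subtype_coe
  exact Measurable.dite h measurable_const (measurableSet_lt measurable_const Complex.measurable_im)

theorem measurable_ofComplex_re_im :
    Measurable fun p : ℝ × ℝ ↦ ofComplex (p.1 + p.2 * Complex.I) :=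
  measurable_ofComplex.comp (by fun_prop)

/-- Integration over the strip in the coordinates `x`, `y`. -/
theorem lintegral_strip {F : ℍ → ℝ≥0∞} (hF : Measurable F) :
    ∫⁻ τ in strip, F τ = ∫⁻ y : ℝ, (∫⁻ x : ℝ in Ico (-(1 / 2) : ℝ) (1 / 2),
      F (ofComplex (x + y * Complex.I))) ∂heightMeasure := by
  have hm := hF.comp measurable_ofComplex_re_im
  have h := measurePreserving_reIm.lintegral_comp hm
  rw [stripMeasure_eq, lintegral_prod_symm _ hm.aemeasurable] at h
  refine Eq.trans ?_ h
  exact lintegral_congr fun τ ↦ by rw [Function.comp_apply, ofComplex_reIm]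

theorem integral_strip {F : ℍ → ℝ} (hF : Measurable F) (hi : IntegrableOn F strip) :
    ∫ τ in strip, F τ = ∫ y : ℝ, (∫ x : ℝ in Ico (-(1 / 2) : ℝ) (1 / 2),
      F (ofComplex (x + y * Complex.I))) ∂heightMeasure := by
  have hm := hF.comp measurable_ofComplex_re_im
  have hcomp : (fun τ ↦ (F ∘ fun p : ℝ × ℝ ↦ ofComplex (p.1 + p.2 * Complex.I)) (reIm τ)) = F := by
    ext τ
    rw [Function.comp_apply, ofComplex_reIm]
  have h := measurePreserving_reIm.integral_comp measurableEmbedding_reIm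
    (F ∘ fun p : ℝ × ℝ ↦ ofComplex (p.1 + p.2 * Complex.I))
  have hi' := (measurePreserving_reIm.integrable_comp_emb measurableEmbedding_reIm
    (g := F ∘ fun p : ℝ × ℝ ↦ ofComplex (p.1 + p.2 * Complex.I))).1 (by
      have := hcomp ▸ hi
      exact this)
  rw [stripMeasure_eq] at hi' h
  rw [hcomp, integral_prod_symm _ hi'] at h
  rw [h]
  rfl

/-! ### The unfolded integral of `log |f|` -/

theorem lintegral_Ioi_comp_mul_left (G : ℝ → ℝ≥0∞) {b : ℝ} (hb : 0 < b) :
    ∫⁻ w in Ioi 0, G (b * w) = ENNReal.ofReal b⁻¹ * ∫⁻ v in Ioi 0, G v := by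
  have h1 : ∀ H : ℝ → ℝ≥0∞, ∫⁻ w, H (b * w) = ENNReal.ofReal b⁻¹ * ∫⁻ v, H v := fun H ↦ by
    have := (MeasurePreserving.mk (μa := volume) (measurable_const_mul b) rfl).lintegral_comp_emb
      (Homeomorph.mulLeft₀ b hb.ne').measurableEmbedding H
    rw [this, Real.map_volume_mul_left hb.ne', lintegral_smul_measure, abs_of_pos (inv_pos.2 hb)]
    rfl
  rw [← lintegral_indicator measurableSet_Ioi, ← lintegral_indicator measurableSet_Ioi, ← h1]
  refine lintegral_congr fun w ↦ ?_
  simp only [indicator, mem_Ioi, mul_pos_iff_of_pos_left hb]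

theorem seedTheta_mul_inv {t Y v : ℝ} (ht : 0 < t) (hY : 0 < Y) (hv : 0 < v) :
    seedTheta t (t * Y * v⁻¹) = seedTheta v Y := by
  refine tsum_congr fun c ↦ ?_
  congr 2
  field_simp

/-- The contribution to the height integral of a zero at height `Y`, by the substitution
`y = t Y / w`. -/
theorem lintegral_seedTheta_mul_sub {t Y : ℝ} (ht : 0 < t) (hY : 0 < Y) :
    ∫⁻ y, seedTheta t y * ENNReal.ofReal (Y - y) ∂heightMeasure =
      ENNReal.ofReal t⁻¹ * ∫⁻ w in Ioi t, seedTheta w Y * ENNReal.ofReal (1 - t / w) := by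
  have hb : 0 < t * Y := mul_pos ht hY
  have hne : ENNReal.ofReal (t * Y)⁻¹ * ENNReal.ofReal (t * Y) = 1 := by
    rw [← ENNReal.ofReal_mul (by positivity), inv_mul_cancel₀ hb.ne', ENNReal.ofReal_one]
  have h1 : ∀ w : ℝ, 0 < w → seedTheta t w⁻¹ * ENNReal.ofReal (Y - w⁻¹) =
      ENNReal.ofReal Y * (seedTheta (t * Y * w) Y * ENNReal.ofReal (1 - t / (t * Y * w))) := by
    intro w hw
    rw [← seedTheta_mul_inv ht hY (by positivity : 0 < t * Y * w), mul_left_comm,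
      ← ENNReal.ofReal_mul hY.le]
    congr 2
    · field_simp
    · field_simp
  rw [lintegral_heightMeasure, setLIntegral_congr_fun measurableSet_Ioi h1,
    lintegral_Ioi_comp_mul_left
      (fun v ↦ ENNReal.ofReal Y * (seedTheta v Y * ENNReal.ofReal (1 - t / v))) hb,
    lintegral_const_mul' _ _ ENNReal.ofReal_ne_top, ← mul_assoc,
    ← ENNReal.ofReal_mul (by positivity)]
  congr 1
  · congr 1; field_simp
  · rw [← lintegral_indicator measurableSet_Ioi, ← lintegral_indicator measurableSet_Ioi]
    refine lintegral_congr fun v ↦ ?_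
    by_cases h1 : 0 < v
    · rw [indicator_of_mem (show v ∈ Ioi 0 from h1)]
      by_cases h2 : t < v
      · rw [indicator_of_mem (show v ∈ Ioi t from h2)]
      · rw [indicator_of_notMem (show v ∉ Ioi t from h2), ENNReal.ofReal_of_nonpos, mul_zero]
        rw [sub_nonpos, one_le_div h1]
        exact not_lt.1 h2
    · rw [indicator_of_notMem (show v ∉ Ioi 0 from h1),
        indicator_of_notMem (show v ∉ Ioi t from fun h ↦ h1 (ht.trans h))]

theorem measurable_seedTheta_left (Y : ℝ) : Measurable fun t ↦ seedTheta t Y :=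
  Measurable.tsum fun c ↦ by fun_prop

/-- The contributions of all zeros in one orbit add up to an integral of the theta series at the
zero, since the heights of the orbit in the strip are the numbers `rowIm τ x`. -/
theorem tsum_lintegral_seedTheta (τ : ℍ) {t : ℝ} (ht : 0 < t) :
    ∑' x : CoprimePair, ∫⁻ y, seedTheta t y * ENNReal.ofReal (rowIm τ x - y) ∂heightMeasure =
      ENNReal.ofReal (t⁻¹ * ∫ w in Ioi t, (latticeTheta τ w - 1) * (1 - t / w)) := by
  have hnn : ∀ w ∈ Ioi t, 0 ≤ (latticeTheta τ w - 1) * (1 - t / w) := by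
    intro w hw
    have hw0 : 0 < w := ht.trans hw
    refine mul_nonneg (by linarith [one_le_latticeTheta τ hw0]) ?_
    rw [sub_nonneg, div_le_one hw0]
    exact le_of_lt hw
  simp_rw [lintegral_seedTheta_mul_sub ht (rowIm_pos τ _)]
  have hm : ∀ x, Measurable fun w ↦ seedTheta w (rowIm τ x) * ENNReal.ofReal (1 - t / w) :=
    fun x ↦ (measurable_seedTheta_left _).mul (by fun_prop)
  rw [ENNReal.tsum_mul_left, ← lintegral_tsum fun x ↦ (hm x).aemeasurable,
    ENNReal.ofReal_mul (by positivity), ofReal_integral_eq_lintegral_ofReal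
      (integrableOn_latticeTheta_sub_one_mul τ ht)
      ((ae_restrict_iff' measurableSet_Ioi).2 (ae_of_all _ hnn))]
  congr 1
  refine setLIntegral_congr_fun measurableSet_Ioi fun w hw ↦ ?_
  have hw0 : 0 < w := ht.trans hw
  rw [ENNReal.tsum_mul_right, tsum_seedTheta_rowIm τ hw0, ENNReal.ofReal_mul]
  linarith [one_le_latticeTheta τ hw0]

/-- The part of the unfolded integral that comes from `log |f|`. -/
theorem HasDivisor.lintegral_seedTheta_mul_horizontalMean {Z : Divisor} {k : ℤ}
    {f : ModularForm 𝒮ℒ k} (hZ : HasDivisor f Z) (hf : Tendsto f atImInfty (𝓝 1)) {t : ℝ}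
    (ht : 0 < t) :
    ∫⁻ y, seedTheta t y * ENNReal.ofReal (horizontalMean f y) ∂heightMeasure =
      ENNReal.ofReal (Real.pi / t * ∑ P ∈ Z.support, (Z P : ℝ) *
        ∫ w in Ioi t, (latticeTheta P.out w - 1) * (1 - t / w)) := by
  have hm : ∀ τ x, Measurable fun y ↦ seedTheta t y * ENNReal.ofReal (rowIm τ x - y) := fun τ x ↦
    (measurable_seedTheta t).mul (by fun_prop)
  have h1 : ∫⁻ y, seedTheta t y * ENNReal.ofReal (horizontalMean f y) ∂heightMeasure =
      ∫⁻ y, ∑ P ∈ Z.support, ENNReal.ofReal (Real.pi * Z P) *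
        ∑' x : CoprimePair, seedTheta t y * ENNReal.ofReal (rowIm P.out x - y)
          ∂heightMeasure := by
    refine lintegral_congr_ae ?_
    filter_upwards [ae_heightMeasure_pos] with y hy
    rw [hZ.horizontalMean_eq hf hy, Finset.mul_sum]
    refine Finset.sum_congr rfl fun P _ ↦ ?_
    rw [ENNReal.tsum_mul_left, mul_left_comm]
  rw [h1, lintegral_finsetSum _ fun P _ ↦ (Measurable.tsum fun x ↦ hm _ x).const_mul _,
    Finset.mul_sum, ENNReal.ofReal_sum_of_nonneg]
  · refine Finset.sum_congr rfl fun P _ ↦ ?_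
    rw [lintegral_const_mul _ (Measurable.tsum fun x ↦ hm _ x),
      lintegral_tsum fun x ↦ (hm _ x).aemeasurable, tsum_lintegral_seedTheta _ ht,
      ← ENNReal.ofReal_mul]
    · congr 1; ring
    · have : (0 : ℝ) ≤ Z P := by exact_mod_cast hZ.coeff_nonneg P
      positivity
  · intro P _
    have : (0 : ℝ) ≤ Z P := by exact_mod_cast hZ.coeff_nonneg P
    refine mul_nonneg (by positivity) (mul_nonneg this (setIntegral_nonneg measurableSet_Ioi ?_))
    intro w hw
    have hw0 : 0 < w := ht.trans hw
    refine mul_nonneg (by linarith [one_le_latticeTheta P.out hw0]) ?_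
    rw [sub_nonneg, div_le_one hw0]
    exact le_of_lt hw

theorem hasDerivAt_mellin_exp_neg : MellinConvergent (fun t ↦ Real.log t • (Real.exp (-t) : ℂ)) 1 ∧
    HasDerivAt (mellin fun t ↦ (Real.exp (-t) : ℂ))
      (mellin (fun t ↦ Real.log t • (Real.exp (-t) : ℂ)) 1) 1 := by
  refine mellin_hasDerivAt_of_isBigO_rpow (E := ℂ) (a := 2) (b := 0) ?_ ?_ (by simp) ?_ (by simp)
  · exact (Continuous.continuousOn (by fun_prop)).locallyIntegrableOn measurableSet_Ioi
  · rw [← Asymptotics.isBigO_norm_left]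
    simp_rw [Complex.norm_real, Asymptotics.isBigO_norm_left]
    simpa only [neg_one_mul] using (isLittleO_exp_neg_mul_rpow_atTop zero_lt_one _).isBigO
  · simp_rw [neg_zero, Real.rpow_zero]
    refine Asymptotics.isBigO_const_of_tendsto (y := (1 : ℂ)) ?_ one_ne_zero
    have : Continuous fun t : ℝ ↦ (Real.exp (-t) : ℂ) := by fun_prop
    simpa using (this.tendsto 0).mono_left nhdsWithin_le_nhds

theorem integrableOn_log_mul_exp_neg :
    IntegrableOn (fun v : ℝ ↦ Real.log v * Real.exp (-v)) (Ioi 0) := by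
  have := hasDerivAt_mellin_exp_neg.1
  simp only [MellinConvergent, sub_self, Complex.cpow_zero, one_smul, Complex.real_smul] at this
  have h := this.re
  refine h.congr (ae_of_all _ fun v ↦ ?_)
  simp only [← Complex.ofReal_mul, RCLike.re_to_complex, Complex.ofReal_re]

/-- The integral is `Γ'(1)`. -/
theorem integral_log_mul_exp_neg :
    ∫ v in Ioi 0, Real.log v * Real.exp (-v) = -Real.eulerMascheroniConstant := by
  have h := hasDerivAt_mellin_exp_neg.2
  rw [← Complex.GammaIntegral_eq_mellin] at h
  have h2 : HasDerivAt Complex.Gamma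
      (mellin (fun t ↦ Real.log t • (Real.exp (-t) : ℂ)) 1) 1 := by
    refine h.congr_of_eventuallyEq ?_
    have : {s : ℂ | 0 < s.re} ∈ 𝓝 (1 : ℂ) :=
      (isOpen_lt continuous_const Complex.continuous_re).mem_nhds (by simp)
    filter_upwards [this] with s hs
    exact Complex.Gamma_eq_integral hs
  have h3 := h2.unique Complex.hasDerivAt_Gamma_one
  rw [mellin] at h3
  simp only [sub_self, Complex.cpow_zero, one_smul, Complex.real_smul,
    ← Complex.ofReal_mul] at h3
  rw [integral_complex_ofReal] at h3
  exact_mod_cast h3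

theorem integrableOn_exp_neg_mul {a : ℝ} (ha : 0 < a) :
    IntegrableOn (fun w : ℝ ↦ Real.exp (-(a * w))) (Ioi 0) := by
  simpa using exp_neg_integrableOn_Ioi 0 ha

theorem exp_neg_mul_sub_log_eq {a : ℝ} (ha : 0 < a) (b : ℝ) : ∀ w ∈ Ioi (0 : ℝ),
    Real.exp (-(a * w)) * (b - Real.log w) = (fun v ↦ (b + Real.log a) * Real.exp (-v) -
      Real.log v * Real.exp (-v)) (a * w) := by
  intro w hw
  simp only [Real.log_mul ha.ne' (ne_of_gt (mem_Ioi.1 hw))]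
  ring

theorem integrableOn_exp_neg_aux (b : ℝ) :
    IntegrableOn (fun v : ℝ ↦ b * Real.exp (-v) - Real.log v * Real.exp (-v)) (Ioi 0) := by
  have h := integrableOn_exp_neg_mul one_pos
  simp only [one_mul] at h
  exact (h.const_mul _).sub integrableOn_log_mul_exp_neg

theorem integrableOn_exp_neg_mul_sub_log {a : ℝ} (ha : 0 < a) (b : ℝ) :
    IntegrableOn (fun w : ℝ ↦ Real.exp (-(a * w)) * (b - Real.log w)) (Ioi 0) := by
  rw [integrableOn_congr_fun (exp_neg_mul_sub_log_eq ha b) measurableSet_Ioi,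
    integrableOn_Ioi_comp_mul_left_iff (fun v ↦ (b + Real.log a) * Real.exp (-v) -
      Real.log v * Real.exp (-v)) 0 ha, mul_zero]
  exact integrableOn_exp_neg_aux _

theorem integral_exp_neg_mul_sub_log {a : ℝ} (ha : 0 < a) (b : ℝ) :
    ∫ w in Ioi 0, Real.exp (-(a * w)) * (b - Real.log w) =
      (b + Real.eulerMascheroniConstant + Real.log a) / a := by
  have h := integrableOn_exp_neg_mul one_pos
  simp only [one_mul] at h
  rw [setIntegral_congr_fun measurableSet_Ioi (exp_neg_mul_sub_log_eq ha b),
    integral_comp_mul_left_Ioi (fun v ↦ (b + Real.log a) * Real.exp (-v) -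
      Real.log v * Real.exp (-v)) 0 ha, mul_zero, integral_sub (h.const_mul _)
      integrableOn_log_mul_exp_neg, integral_const_mul, integral_exp_neg_Ioi_zero,
    integral_log_mul_exp_neg, smul_eq_mul]
  field_simp
  ring

/-- A bound for the logarithmic integral, uniform in the scale up to `log a / a`. -/
theorem exists_integral_norm_exp_neg_mul_sub_log_le (b : ℝ) : ∃ C : ℝ, ∀ a : ℝ, 0 < a →
    ∫ w in Ioi 0, ‖Real.exp (-(a * w)) * (b - Real.log w)‖ ≤ (C + |Real.log a|) / a := by
  have h := integrableOn_exp_neg_mul one_pos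
  simp only [one_mul] at h
  refine ⟨|b| + ∫ v in Ioi 0, ‖Real.log v * Real.exp (-v)‖, fun a ha ↦ ?_⟩
  have h1 : ∀ w ∈ Ioi (0 : ℝ), ‖Real.exp (-(a * w)) * (b - Real.log w)‖ =
      (fun v ↦ ‖(b + Real.log a) * Real.exp (-v) - Real.log v * Real.exp (-v)‖) (a * w) :=
    fun w hw ↦ by rw [exp_neg_mul_sub_log_eq ha b w hw]
  rw [setIntegral_congr_fun measurableSet_Ioi h1, integral_comp_mul_left_Ioi
    (fun v ↦ ‖(b + Real.log a) * Real.exp (-v) - Real.log v * Real.exp (-v)‖) 0 ha, mul_zero,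
    smul_eq_mul, inv_mul_eq_div]
  gcongr
  have h2 : ∫ v in Ioi 0, (|b| + |Real.log a|) * Real.exp (-v) = |b| + |Real.log a| := by
    rw [integral_const_mul, integral_exp_neg_Ioi_zero, mul_one]
  calc _ ≤ ∫ v in Ioi 0, ((|b| + |Real.log a|) * Real.exp (-v) +
        ‖Real.log v * Real.exp (-v)‖) := by
        refine integral_mono (integrableOn_exp_neg_aux _).norm
          ((h.const_mul _).add integrableOn_log_mul_exp_neg.norm) fun v ↦ ?_
        refine (norm_sub_le _ _).trans ?_
        gcongr
        rw [norm_mul, Real.norm_of_nonneg (Real.exp_pos _).le]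
        gcongr
        exact norm_add_le b _
    _ = _ := by
        rw [integral_add (h.const_mul _) integrableOn_log_mul_exp_neg.norm, h2]
        ring

theorem summable_log_div_sq : Summable fun c : ℕ ↦ Real.log (c + 1) / (c + 1 : ℝ) ^ 2 := by
  have h : Summable fun n : ℕ ↦ ((n : ℝ) ^ (-(3 / 2) : ℝ)) * 2 :=
    (Real.summable_nat_rpow.2 (by norm_num)).mul_right 2
  refine Summable.of_nonneg_of_le (fun c ↦ ?_) (fun c ↦ ?_) ((summable_nat_add_iff 1).2 h)
  · have : 0 ≤ Real.log (c + 1) := Real.log_nonneg (by linarith [c.cast_nonneg (α := ℝ)])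
    positivity
  · have hc : (0 : ℝ) < c + 1 := by positivity
    have h1 := Real.log_le_rpow_div hc.le (ε := 1 / 2) (by norm_num)
    push_cast
    rw [div_le_iff₀ (by positivity), mul_assoc, mul_comm (2 : ℝ), ← mul_assoc,
      ← Real.rpow_natCast (_ : ℝ) 2, ← Real.rpow_add hc]
    norm_num at h1 ⊢
    linarith

theorem summable_one_div_sq : Summable fun c : ℕ ↦ 1 / (c + 1 : ℝ) ^ 2 := by
  have := (summable_nat_add_iff 1).2 (Real.summable_one_div_nat_pow.2 (by norm_num : 1 < 2))
  simpa using this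

theorem tsum_one_div_sq : ∑' c : ℕ, 1 / (c + 1 : ℝ) ^ 2 = Real.pi ^ 2 / 6 := by
  have := (hasSum_nat_add_iff' 1).2 hasSum_zeta_two
  simpa using this.tsum_eq

/-! ### The unfolded integral of `log (4πy)` -/

theorem exp_seed_eq (t w : ℝ) (c : ℕ) : Real.exp (-Real.pi * t * (c + 1 : ℝ) ^ 2 * (w⁻¹)⁻¹) =
    Real.exp (-(Real.pi * t * (c + 1 : ℝ) ^ 2 * w)) := by
  rw [inv_inv]; congr 1; ring

theorem summable_exp_seed {t w : ℝ} (ht : 0 < t) (hw : 0 < w) :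
    Summable fun c : ℕ ↦ Real.exp (-(Real.pi * t * (c + 1 : ℝ) ^ 2 * w)) := by
  have hr : Real.exp (-(Real.pi * t * w)) < 1 := by
    rw [Real.exp_lt_one_iff, neg_lt_zero]
    positivity
  refine Summable.of_nonneg_of_le (fun _ ↦ (Real.exp_pos _).le) (fun c ↦ ?_)
    (summable_geometric_of_lt_one (Real.exp_pos _).le hr)
  rw [← Real.exp_nat_mul, Real.exp_le_exp]
  have : (c : ℝ) ≤ (c + 1 : ℝ) ^ 2 := by nlinarith [c.cast_nonneg (α := ℝ)]
  have h2 : 0 < Real.pi * t * w := by positivity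
  nlinarith

theorem seedTheta_inv_eq_ofReal {t w : ℝ} (ht : 0 < t) (hw : 0 < w) : seedTheta t w⁻¹ =
    ENNReal.ofReal (∑' c : ℕ, Real.exp (-(Real.pi * t * (c + 1 : ℝ) ^ 2 * w))) := by
  rw [ENNReal.ofReal_tsum_of_nonneg (fun _ ↦ (Real.exp_pos _).le) (summable_exp_seed ht hw)]
  exact tsum_congr fun c ↦ by rw [exp_seed_eq]

theorem toReal_seedTheta_inv {t w : ℝ} (ht : 0 < t) (hw : 0 < w) : (seedTheta t w⁻¹).toReal =
    ∑' c : ℕ, Real.exp (-(Real.pi * t * (c + 1 : ℝ) ^ 2 * w)) := by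
  rw [seedTheta_inv_eq_ofReal ht hw,
    ENNReal.toReal_ofReal (tsum_nonneg fun _ ↦ (Real.exp_pos _).le)]

theorem seedTheta_ne_top {t y : ℝ} (ht : 0 < t) (hy : 0 < y) : seedTheta t y ≠ ∞ := by
  rw [← inv_inv y, seedTheta_inv_eq_ofReal ht (inv_pos.2 hy)]
  exact ENNReal.ofReal_ne_top

/-- The constant `∑ log c / c²`, which is `-ζ'(2)`. -/
noncomputable def logZetaSum : ℝ := ∑' c : ℕ, Real.log (c + 1) / (c + 1 : ℝ) ^ 2

theorem log_scale {t : ℝ} (ht : 0 < t) (c : ℕ) :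
    Real.log (Real.pi * t * (c + 1 : ℝ) ^ 2) = Real.log (Real.pi * t) + 2 * Real.log (c + 1) := by
  rw [Real.log_mul (by positivity) (by positivity), Real.log_pow]
  push_cast; ring

/-- The part of the unfolded integral that comes from `log (4 π y)`. -/
theorem integral_seedTheta_mul_log {t : ℝ} (ht : 0 < t) :
    Integrable (fun y ↦ (seedTheta t y).toReal * Real.log (4 * Real.pi * y)) heightMeasure ∧
    ∫ y, (seedTheta t y).toReal * Real.log (4 * Real.pi * y) ∂heightMeasure =
      ((Real.log (4 * Real.pi ^ 2) + Real.eulerMascheroniConstant + Real.log t) *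
        (Real.pi ^ 2 / 6) + 2 * logZetaSum) / (Real.pi * t) := by
  set b := Real.log (4 * Real.pi) with hb
  set a : ℕ → ℝ := fun c ↦ Real.pi * t * (c + 1 : ℝ) ^ 2 with ha
  have ha0 : ∀ c, 0 < a c := fun c ↦ by positivity
  set F : ℕ → ℝ → ℝ := fun c w ↦ Real.exp (-(a c * w)) * (b - Real.log w) with hF
  have heq : ∀ w ∈ Ioi (0 : ℝ),
      (seedTheta t w⁻¹).toReal * Real.log (4 * Real.pi * w⁻¹) = ∑' c, F c w := by
    intro w hw
    have hw0 : 0 < w := hw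
    rw [toReal_seedTheta_inv ht hw, Real.log_mul (by positivity) (by positivity), Real.log_inv,
      ← sub_eq_add_neg, tsum_mul_right]
  have hint : ∀ c, Integrable (F c) (volume.restrict (Ioi 0)) := fun c ↦
    integrableOn_exp_neg_mul_sub_log (ha0 c) b
  have hsum : Summable fun c ↦ ∫ w in Ioi 0, ‖F c w‖ := by
    obtain ⟨C, hC⟩ := exists_integral_norm_exp_neg_mul_sub_log_le b
    refine Summable.of_nonneg_of_le (fun c ↦ integral_nonneg fun _ ↦ norm_nonneg _)
      (fun c ↦ (hC (a c) (ha0 c)).trans ?_)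
      ((summable_one_div_sq.mul_left ((C + |Real.log (Real.pi * t)|) / (Real.pi * t))).add
        (summable_log_div_sq.mul_left (2 / (Real.pi * t))))
    have hl : 0 ≤ Real.log (c + 1) := Real.log_nonneg (by linarith [c.cast_nonneg (α := ℝ)])
    have h1 : |Real.log (a c)| ≤ |Real.log (Real.pi * t)| + 2 * Real.log (c + 1) := by
      rw [ha, log_scale ht]
      refine (abs_add_le _ _).trans ?_
      rw [abs_of_nonneg (by positivity : 0 ≤ 2 * Real.log (c + 1))]
    calc (C + |Real.log (a c)|) / a c
        ≤ (C + (|Real.log (Real.pi * t)| + 2 * Real.log (c + 1))) / a c := by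
          have := (ha0 c).le
          gcongr
      _ = _ := by rw [ha]; field_simp; ring
  have hS := hasSum_integral_of_summable_integral_norm hint hsum
  have hI : ∀ c, ∫ w in Ioi 0, F c w = (Real.log (4 * Real.pi ^ 2) +
      Real.eulerMascheroniConstant + Real.log t) / (Real.pi * t) * (1 / (c + 1 : ℝ) ^ 2) +
      2 / (Real.pi * t) * (Real.log (c + 1) / (c + 1 : ℝ) ^ 2) := by
    intro c
    rw [hF, integral_exp_neg_mul_sub_log (ha0 c), ha, log_scale ht,
      Real.log_mul (by positivity) (by positivity), hb,
      show (4 * Real.pi ^ 2 : ℝ) = 4 * Real.pi * Real.pi by ring,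
      Real.log_mul (x := 4 * Real.pi) (by positivity) (by positivity)]
    field_simp
    ring
  have hT := (summable_one_div_sq.hasSum.mul_left ((Real.log (4 * Real.pi ^ 2) +
      Real.eulerMascheroniConstant + Real.log t) / (Real.pi * t))).add
    (summable_log_div_sq.hasSum.mul_left (2 / (Real.pi * t)))
  constructor
  · rw [integrable_heightMeasure_iff, integrableOn_congr_fun heq measurableSet_Ioi]
    refine ⟨(AEMeasurable.tsum fun c ↦ (hint c).aemeasurable).aestronglyMeasurable, ?_⟩
    rw [hasFiniteIntegral_iff_enorm]
    calc ∫⁻ w in Ioi 0, ‖∑' c, F c w‖ₑ ≤ ∫⁻ w in Ioi 0, ∑' c, ‖F c w‖ₑ :=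
          lintegral_mono fun w ↦ enorm_tsum_le_tsum_enorm
      _ = ∑' c, ∫⁻ w in Ioi 0, ‖F c w‖ₑ :=
          lintegral_tsum fun c ↦ (hint c).aestronglyMeasurable.enorm
      _ = ∑' c, ENNReal.ofReal (∫ w in Ioi 0, ‖F c w‖) :=
          tsum_congr fun c ↦ (ofReal_integral_norm_eq_lintegral_enorm (hint c)).symm
      _ < ∞ := hsum.tsum_ofReal_lt_top
  · rw [integral_heightMeasure, setIntegral_congr_fun measurableSet_Ioi heq, ← hS.tsum_eq,
      tsum_congr hI, hT.tsum_eq, tsum_one_div_sq, logZetaSum]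
    field_simp

/-! ### Integrability of the logarithm of the Petersson norm -/

theorem logPetersson_eq_log_norm_petersson {k : ℤ} (f : ModularForm 𝒮ℒ k) (τ : ℍ) :
    logPetersson f τ = Real.log (‖petersson k f f τ‖ * (4 * Real.pi) ^ k) := by
  rw [logPetersson, petersson, norm_mul, norm_mul, norm_zpow, RCLike.norm_conj,
    Complex.norm_real, Real.norm_of_nonneg τ.im_pos.le, mul_zpow]
  ring_nf

theorem logPetersson_smul {k : ℤ} (f : ModularForm 𝒮ℒ k) (γ : SL(2, ℤ)) (τ : ℍ) :
    logPetersson f (γ • τ) = logPetersson f τ := by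
  rw [logPetersson_eq_log_norm_petersson, logPetersson_eq_log_norm_petersson]
  have : ‖petersson k f f (γ • τ)‖ = ‖petersson k f f τ‖ :=
    SlashInvariantFormClass.norm_petersson_smul (Γ := 𝒮ℒ)
      (g := Matrix.SpecialLinearGroup.mapGL ℝ γ) ⟨γ, rfl⟩
  rw [this]

theorem continuous_modularForm {k : ℤ} (f : ModularForm 𝒮ℒ k) : Continuous f :=
  (ModularFormClass.holo f).continuous

theorem measurable_logPetersson {k : ℤ} (f : ModularForm 𝒮ℒ k) : Measurable (logPetersson f) := by
  have h : Continuous (petersson k f f) :=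
    petersson_continuous k (continuous_modularForm f) (continuous_modularForm f)
  have : logPetersson f = fun τ ↦ Real.log (‖petersson k f f τ‖ * (4 * Real.pi) ^ k) :=
    funext (logPetersson_eq_log_norm_petersson f)
  rw [this]
  exact (h.norm.measurable.mul_const _).log

theorem logPetersson_of_ne_zero {k : ℤ} {f : ModularForm 𝒮ℒ k} {τ : ℍ} (h : f τ ≠ 0) :
    logPetersson f τ = 2 * Real.log ‖f τ‖ + k * Real.log (4 * Real.pi * τ.im) := by
  have h1 := norm_pos_iff.2 h
  have h2 := τ.im_pos
  rw [logPetersson, Real.log_mul (by positivity) (by positivity), Real.log_pow, Real.log_zpow]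
  push_cast; ring

theorem abs_logPetersson_le {k : ℤ} (f : ModularForm 𝒮ℒ k) (τ : ℍ) :
    |logPetersson f τ| ≤ 2 * |Real.log ‖f τ‖| + |(k : ℝ)| * |Real.log (4 * Real.pi * τ.im)| := by
  by_cases h : f τ = 0
  · rw [logPetersson, h]
    simp only [norm_zero, ne_eq, OfNat.ofNat_ne_zero, not_false_eq_true, zero_pow, zero_mul,
      Real.log_zero, abs_zero]
    positivity
  · rw [logPetersson_of_ne_zero h]
    refine (abs_add_le _ _).trans_eq ?_
    rw [abs_mul, abs_mul, abs_two]

/-- A function with a divisor vanishes almost nowhere on a horizontal line. -/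
theorem HasDivisor.ae_ne_zero {k : ℤ} {f : ModularForm 𝒮ℒ k} {Z : Divisor} (hZ : HasDivisor f Z)
    {y : ℝ} (hy : 0 < y) : ∀ᵐ x : ℝ, f (ofComplex (x + y * Complex.I)) ≠ 0 := by
  have hmem : {x : ℝ | f (ofComplex (x + y * Complex.I)) ≠ 0} ∈ codiscrete ℝ := by
    rw [mem_codiscrete]
    intro x₀
    rw [disjoint_principal_right, compl_compl]
    let τ : ℍ := ⟨x₀ + y * Complex.I, ofReal_add_mul_I_im_pos hy x₀⟩
    have hne : ∀ᶠ z in 𝓝[≠] (τ : ℂ), f (ofComplex z) ≠ 0 := by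
      refine ((analyticAt_comp_ofComplex f τ).eventually_eq_zero_or_eventually_ne_zero).resolve_left
        fun h ↦ ?_
      obtain ⟨n, hn, -⟩ := hZ τ
      rw [analyticOrderAt_eq_top.2 h] at hn
      exact ENat.natCast_ne_top n hn.symm
    have ht : Tendsto (fun x : ℝ ↦ (x : ℂ) + y * Complex.I) (𝓝[≠] x₀) (𝓝[≠] (τ : ℂ)) := by
      refine Continuous.continuousAt (by fun_prop) |>.tendsto.mono_left nhdsWithin_le_nhds
        |> fun h ↦ tendsto_nhdsWithin_iff.2 ⟨h, ?_⟩
      filter_upwards [self_mem_nhdsWithin] with x hx h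
      apply hx
      have h' : (x : ℂ) + y * Complex.I = x₀ + y * Complex.I := h
      simpa using h'
    exact ht.eventually hne
  have := ae_restrict_le_codiscreteWithin (μ := (volume : Measure ℝ)) MeasurableSet.univ hmem
  rw [Measure.restrict_univ] at this
  exact this

theorem exists_norm_le_of_im_ge {k : ℤ} (f : ModularForm 𝒮ℒ k) :
    ∃ M : ℝ, 1 ≤ M ∧ ∀ τ : ℍ, 1 / 2 ≤ τ.im → ‖f τ‖ ≤ M := by
  have hsub : Metric.closedBall (0 : ℂ) (Real.exp (-Real.pi)) ⊆ Metric.ball 0 1 := by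
    refine Metric.closedBall_subset_ball ?_
    rw [Real.exp_lt_one_iff, neg_lt_zero]
    exact Real.pi_pos
  obtain ⟨M, hM⟩ := (isCompact_closedBall (0 : ℂ) (Real.exp (-Real.pi))).exists_bound_of_continuousOn
    ((analyticOnNhd_cuspFunction f).continuousOn.mono hsub)
  refine ⟨max 1 M, le_max_left _ _, fun τ hτ ↦ ?_⟩
  rw [← cuspFunction_qParam f τ]
  refine (hM _ ?_).trans (le_max_right _ _)
  simpa using Function.Periodic.norm_qParam_le_of_one_half_le_im (ξ := (τ : ℂ)) hτ

theorem ofComplex_im {y : ℝ} (hy : 0 < y) (x : ℝ) :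
    (ofComplex ((x : ℂ) + y * Complex.I)).im = y := by
  rw [ofComplex_apply_of_im_pos (ofReal_add_mul_I_im_pos hy x)]
  change ((x : ℂ) + y * Complex.I).im = y
  simp

theorem integral_Ico_eq_intervalIntegral (g : ℝ → ℝ) :
    ∫ x in Ico (-(1 / 2) : ℝ) (1 / 2), g x = ∫ x in (-(1 / 2))..(1 / 2), g x := by
  rw [integral_Ico_eq_integral_Ioo, ← integral_Ioc_eq_integral_Ioo,
    intervalIntegral.integral_of_le (by norm_num)]

theorem integrableOn_Ico_log_norm {k : ℤ} (f : ModularForm 𝒮ℒ k) {y : ℝ} (hy : 0 < y) :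
    IntegrableOn (fun x : ℝ ↦ Real.log ‖f (ofComplex (x + y * Complex.I))‖)
      (Ico (-(1 / 2)) (1 / 2)) :=
  (intervalIntegrable_iff_integrableOn_Ico_of_le (by norm_num)).1 (intervalIntegrable_log_norm f hy _ _)

theorem integral_Ico_const (c : ℝ) : ∫ _ in Ico (-(1 / 2) : ℝ) (1 / 2), c = c := by
  simp; norm_num

/-- The mean of `logPetersson` at height `y`. -/
theorem HasDivisor.integral_logPetersson {k : ℤ} {f : ModularForm 𝒮ℒ k} {Z : Divisor}
    (hZ : HasDivisor f Z) {y : ℝ} (hy : 0 < y) :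
    ∫ x in Ico (-(1 / 2) : ℝ) (1 / 2), logPetersson f (ofComplex (x + y * Complex.I)) =
      2 * horizontalMean f y + k * Real.log (4 * Real.pi * y) := by
  have h : ∫ x in Ico (-(1 / 2) : ℝ) (1 / 2), logPetersson f (ofComplex (x + y * Complex.I)) =
      ∫ x in Ico (-(1 / 2) : ℝ) (1 / 2), (2 * Real.log ‖f (ofComplex (x + y * Complex.I))‖ +
        k * Real.log (4 * Real.pi * y)) := by
    refine integral_congr_ae (ae_restrict_of_ae ?_)
    filter_upwards [hZ.ae_ne_zero hy] with x hx
    rw [logPetersson_of_ne_zero hx, ofComplex_im hy]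
  rw [h, integral_add ((integrableOn_Ico_log_norm f hy).const_mul 2)
    (integrableOn_const (by simp)),
    integral_Ico_const, integral_const_mul, integral_Ico_eq_intervalIntegral, horizontalMean]

/-- A bound for the mean of `|logPetersson|` at height `y ≥ 1 / 2`; it uses that the mean of
`log |f|` is nonnegative. -/
theorem exists_lintegral_logPetersson_le {k : ℤ} {f : ModularForm 𝒮ℒ k}
    (hf : Tendsto f atImInfty (𝓝 1)) : ∃ B : ℝ, 0 ≤ B ∧ ∀ y : ℝ, 1 / 2 ≤ y →
    ∫⁻ x in Ico (-(1 / 2) : ℝ) (1 / 2), ‖logPetersson f (ofComplex (x + y * Complex.I))‖ₑ ≤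
      ENNReal.ofReal (B + |(k : ℝ)| * |Real.log (4 * Real.pi * y)|) := by
  obtain ⟨M, hM1, hM⟩ := exists_norm_le_of_im_ge f
  have hB : 0 ≤ Real.log M := Real.log_nonneg hM1
  refine ⟨4 * Real.log M, by positivity, fun y hy ↦ ?_⟩
  have hy0 : 0 < y := by linarith
  -- As `|f| ≤ M`, a bound for `|log |f||` involves `log |f|` only with a negative sign.
  have habs : ∀ τ : ℍ, 1 / 2 ≤ τ.im →
      |Real.log ‖f τ‖| ≤ 2 * Real.log M - Real.log ‖f τ‖ := by
    intro τ hτ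
    have : Real.log ‖f τ‖ ≤ Real.log M := by
      by_cases h : f τ = 0
      · simpa [h] using hB
      · exact Real.log_le_log (norm_pos_iff.2 h) (hM τ hτ)
    rcases abs_cases (Real.log ‖f τ‖) with ⟨h, -⟩ | ⟨h, -⟩ <;> rw [h] <;> linarith
  set G : ℝ → ℝ := fun x ↦ 2 * (2 * Real.log M - Real.log ‖f (ofComplex (x + y * Complex.I))‖) +
    |(k : ℝ)| * |Real.log (4 * Real.pi * y)| with hG
  have hle : ∀ x : ℝ, |logPetersson f (ofComplex (x + y * Complex.I))| ≤ G x := by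
    intro x
    refine (abs_logPetersson_le f _).trans ?_
    rw [ofComplex_im hy0, hG]
    have := habs (ofComplex (x + y * Complex.I)) (by rwa [ofComplex_im hy0])
    simp only
    linarith
  have hconst : ∀ c : ℝ, IntegrableOn (fun _ : ℝ ↦ c) (Ico (-(1 / 2)) (1 / 2)) := by simp
  have hi2 : IntegrableOn (fun x : ℝ ↦ 2 * Real.log M -
      Real.log ‖f (ofComplex (x + y * Complex.I))‖) (Ico (-(1 / 2)) (1 / 2)) :=
    (hconst _).sub (integrableOn_Ico_log_norm f hy0)
  have hi : IntegrableOn G (Ico (-(1 / 2)) (1 / 2)) := (hi2.const_mul 2).add (hconst _)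
  calc _ ≤ ∫⁻ x in Ico (-(1 / 2) : ℝ) (1 / 2), ENNReal.ofReal (G x) := by
        refine lintegral_mono fun x ↦ ?_
        rw [Real.enorm_eq_ofReal_abs]
        exact ENNReal.ofReal_le_ofReal (hle x)
    _ = ENNReal.ofReal (∫ x in Ico (-(1 / 2) : ℝ) (1 / 2), G x) :=
        (ofReal_integral_eq_lintegral_ofReal hi
          (ae_of_all _ fun x ↦ (abs_nonneg _).trans (hle x))).symm
    _ ≤ _ := by
        refine ENNReal.ofReal_le_ofReal ?_
        rw [hG, integral_add (hi2.const_mul 2) (hconst _), integral_const_mul,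
          integral_sub (hconst _) (integrableOn_Ico_log_norm f hy0), integral_Ico_const,
          integral_Ico_const, integral_Ico_eq_intervalIntegral]
        have := (horizontalMean_eq_tsum hf hy0).1
        rw [horizontalMean] at this
        linarith

theorem lintegral_heightMeasure_ge {F : ℝ → ℝ≥0∞} (hF : Measurable F) :
    ∫⁻ y, (Ici (1 / 2)).indicator F y ∂heightMeasure =
      ∫⁻ y in Ici (1 / 2), ENNReal.ofReal (y ^ 2)⁻¹ * F y := by
  rw [heightMeasure, lintegral_withDensity_eq_lintegral_mul _ (by fun_prop)
    (hF.indicator measurableSet_Ici), ← lintegral_indicator measurableSet_Ici,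
    ← lintegral_indicator measurableSet_Ioi]
  refine lintegral_congr fun y ↦ ?_
  by_cases h : y ∈ Ici (1 / 2 : ℝ)
  · have h0 : y ∈ Ioi (0 : ℝ) := lt_of_lt_of_le (by norm_num) (mem_Ici.1 h)
    rw [indicator_of_mem h, indicator_of_mem h0, Pi.mul_apply, indicator_of_mem h]
  · rw [indicator_of_notMem h]
    by_cases h0 : y ∈ Ioi (0 : ℝ)
    · rw [indicator_of_mem h0, Pi.mul_apply, indicator_of_notMem h, mul_zero]
    · rw [indicator_of_notMem h0]

/-- Convergence of the height integral that dominates `∫ |logPetersson| √(Im τ)`. -/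
theorem lintegral_sqrt_mul_log_lt_top {B : ℝ} (hB : 0 ≤ B) (k : ℤ) :
    ∫⁻ y, (Ici (1 / 2)).indicator (fun y ↦ ENNReal.ofReal √y *
      ENNReal.ofReal (B + |(k : ℝ)| * |Real.log (4 * Real.pi * y)|)) y ∂heightMeasure < ∞ := by
  have hm : Measurable fun y : ℝ ↦ ENNReal.ofReal √y *
      ENNReal.ofReal (B + |(k : ℝ)| * |Real.log (4 * Real.pi * y)|) := by fun_prop
  rw [lintegral_heightMeasure_ge hm]
  -- The logarithm and the constant are bounded by multiples of `y ^ (1 / 4)`.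
  have hint : IntegrableOn (fun y : ℝ ↦ (B * 2 + |(k : ℝ)| * (4 * (4 * Real.pi) ^ (1 / 4 : ℝ))) *
      y ^ (-(5 / 4) : ℝ)) (Ici (1 / 2)) := by
    rw [integrableOn_Ici_iff_integrableOn_Ioi]
    exact (integrableOn_Ioi_rpow_of_lt (by norm_num) (by norm_num)).const_mul _
  refine lt_of_le_of_lt (lintegral_mono_ae ?_) hint.lintegral_lt_top
  filter_upwards [ae_restrict_mem measurableSet_Ici] with y hy
  have hy2 : 1 / 2 ≤ y := hy
  have hy0 : 0 < y := by linarith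
  rw [← ENNReal.ofReal_mul (by positivity), ← ENNReal.ofReal_mul (by positivity)]
  refine ENNReal.ofReal_le_ofReal ?_
  have h4 : 1 ≤ 4 * Real.pi * y := by nlinarith [Real.pi_gt_three]
  have h1 : |Real.log (4 * Real.pi * y)| ≤ 4 * (4 * Real.pi) ^ (1 / 4 : ℝ) * y ^ (1 / 4 : ℝ) := by
    rw [abs_of_nonneg (Real.log_nonneg h4), mul_assoc (4 : ℝ) ((4 * Real.pi) ^ (1 / 4 : ℝ)), ← Real.mul_rpow (by positivity) hy0.le]
    have := Real.log_le_rpow_div (by linarith : 0 ≤ 4 * Real.pi * y) (ε := 1 / 4) (by norm_num)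
    linarith
  have h2 : 1 ≤ 2 * y ^ (1 / 4 : ℝ) := by
    have h : (1 / 2 : ℝ) ^ (1 / 4 : ℝ) ≤ y ^ (1 / 4 : ℝ) := by gcongr
    have h' : (1 / 2 : ℝ) ^ (1 : ℝ) ≤ (1 / 2 : ℝ) ^ (1 / 4 : ℝ) :=
      Real.rpow_le_rpow_of_exponent_ge (by norm_num) (by norm_num) (by norm_num)
    rw [Real.rpow_one] at h'
    linarith
  have h3 : y ^ (-(5 / 4) : ℝ) = (y ^ 2)⁻¹ * √y * y ^ (1 / 4 : ℝ) := by
    rw [Real.sqrt_eq_rpow, ← Real.rpow_natCast y 2, ← Real.rpow_neg hy0.le, ← Real.rpow_add hy0,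
      ← Real.rpow_add hy0]
    norm_num
  rw [h3]
  calc (y ^ 2)⁻¹ * (√y * (B + |(k : ℝ)| * |Real.log (4 * Real.pi * y)|))
      ≤ (y ^ 2)⁻¹ * (√y * (B * (2 * y ^ (1 / 4 : ℝ)) +
          |(k : ℝ)| * (4 * (4 * Real.pi) ^ (1 / 4 : ℝ) * y ^ (1 / 4 : ℝ)))) := by
        gcongr
        exact le_mul_of_one_le_right hB h2
    _ = _ := by ring

theorem fdo_subset_strip : ModularGroup.fdo ⊆ strip := fun τ hτ ↦ by
  have := abs_lt.1 hτ.2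
  exact ⟨this.1.le, this.2⟩

theorem half_le_im_of_mem_fd {τ : ℍ} (hτ : τ ∈ ModularGroup.fd) : 1 / 2 ≤ τ.im := by
  have := ModularGroup.three_le_four_mul_im_sq_of_mem_fd hτ
  nlinarith [τ.im_pos]

/-- The factor `√(Im τ)` is the growth of `Θ(τ, 1)` at the cusp; this bound allows dominated
convergence in the pairing of `logPetersson f` with the theta series. -/
theorem lintegral_fd_logPetersson_lt_top {k : ℤ} {f : ModularForm 𝒮ℒ k}
    (hf : Tendsto f atImInfty (𝓝 1)) :
    ∫⁻ τ in ModularGroup.fd, ‖logPetersson f τ‖ₑ * ENNReal.ofReal √τ.im < ∞ := by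
  obtain ⟨B, hB0, hB⟩ := exists_lintegral_logPetersson_le hf
  set F : ℍ → ℝ≥0∞ := fun τ ↦ {τ : ℍ | 1 / 2 ≤ τ.im}.indicator
    (fun τ ↦ ENNReal.ofReal √τ.im * ‖logPetersson f τ‖ₑ) τ with hF
  have hm0 : Measurable fun τ : ℍ ↦ ENNReal.ofReal √τ.im :=
    (UpperHalfPlane.continuous_im.measurable.sqrt).ennreal_ofReal
  have hFm : Measurable F := (hm0.mul (measurable_logPetersson f).enorm).indicator
    (measurableSet_le measurable_const UpperHalfPlane.continuous_im.measurable)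
  have hae : ModularGroup.fd ≤ᵐ[volume] ModularGroup.fdo := by
    filter_upwards [measure_eq_zero_iff_ae_notMem.1 volume_fd_diff_fdo] with τ h1 h2
    by_contra h3
    exact h1 ⟨h2, h3⟩
  calc _ ≤ ∫⁻ τ in ModularGroup.fd, F τ := by
        refine lintegral_mono_ae ?_
        filter_upwards [ae_restrict_mem measurableSet_fd] with τ hτ
        rw [hF]
        simp only
        rw [indicator_of_mem (show τ ∈ {τ : ℍ | 1 / 2 ≤ τ.im} from half_le_im_of_mem_fd hτ),
          mul_comm]
    _ ≤ ∫⁻ τ in strip, F τ :=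
        lintegral_mono' (Measure.restrict_mono_ae (hae.trans fdo_subset_strip.eventuallyLE)) le_rfl
    _ ≤ ∫⁻ y, (Ici (1 / 2)).indicator (fun y ↦ ENNReal.ofReal √y *
          ENNReal.ofReal (B + |(k : ℝ)| * |Real.log (4 * Real.pi * y)|)) y ∂heightMeasure := by
        rw [lintegral_strip hFm]
        refine lintegral_mono_ae ?_
        filter_upwards [ae_heightMeasure_pos] with y hy
        by_cases h : 1 / 2 ≤ y
        · rw [indicator_of_mem (show y ∈ Ici (1 / 2 : ℝ) from h)]
          have h1 : ∀ x : ℝ, F (ofComplex (x + y * Complex.I)) = ENNReal.ofReal √y *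
              ‖logPetersson f (ofComplex (x + y * Complex.I))‖ₑ := fun x ↦ by
            rw [hF]
            simp only
            rw [indicator_of_mem (by rw [Set.mem_ofPred_eq, ofComplex_im hy]; exact h),
              ofComplex_im hy]
          simp_rw [h1]
          rw [lintegral_const_mul' _ _ ENNReal.ofReal_ne_top]
          gcongr
          exact hB y h
        · have h1 : ∀ x : ℝ, F (ofComplex (x + y * Complex.I)) = 0 := fun x ↦
            indicator_of_notMem (by rw [Set.mem_ofPred_eq, ofComplex_im hy]; exact h) _
          simp [h1]
    _ < ∞ := lintegral_sqrt_mul_log_lt_top hB0 k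

theorem integrableOn_logPetersson {k : ℤ} {f : ModularForm 𝒮ℒ k}
    (hf : Tendsto f atImInfty (𝓝 1)) : IntegrableOn (logPetersson f) ModularGroup.fd := by
  have hm : Measurable fun τ : ℍ ↦ logPetersson f τ * √τ.im :=
    (measurable_logPetersson f).mul UpperHalfPlane.continuous_im.measurable.sqrt
  refine ⟨(measurable_logPetersson f).aestronglyMeasurable, ?_⟩
  rw [hasFiniteIntegral_iff_enorm]
  refine lt_of_le_of_lt ?_ (ENNReal.mul_lt_top ENNReal.ofReal_lt_top
    (lintegral_fd_logPetersson_lt_top hf) : ENNReal.ofReal 2 * _ < ∞)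
  rw [← lintegral_const_mul' _ _ ENNReal.ofReal_ne_top]
  refine lintegral_mono_ae ?_
  filter_upwards [ae_restrict_mem measurableSet_fd] with τ hτ
  have h := half_le_im_of_mem_fd hτ
  have h1 : 1 / 2 ≤ √τ.im := Real.le_sqrt_of_sq_le (by norm_num; linarith)
  have h2 : (1 : ℝ≥0∞) ≤ ENNReal.ofReal 2 * ENNReal.ofReal √τ.im := by
    rw [← ENNReal.ofReal_mul zero_le_two, ENNReal.one_le_ofReal]
    linarith
  rw [mul_left_comm]
  exact le_mul_of_one_le_right' h2

/-! ### The pairing with the theta series and its limit -/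

theorem measurable_rowIm (x : CoprimePair) : Measurable fun τ ↦ rowIm τ x := by
  have : (fun τ ↦ rowIm τ x) = fun τ : ℍ ↦
      (Complex.normSq ((x.1 0 : ℂ) * τ + x.1 1) / τ.im)⁻¹ := rfl
  rw [this]
  have h1 : Continuous fun τ : ℍ ↦ Complex.normSq ((x.1 0 : ℂ) * τ + x.1 1) :=
    Complex.continuous_normSq.comp (by fun_prop)
  exact (h1.measurable.div UpperHalfPlane.continuous_im.measurable).inv

theorem measurable_latticeTheta {t : ℝ} (ht : 0 < t) : Measurable fun τ ↦ latticeTheta τ t := by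
  have h : (fun τ ↦ latticeTheta τ t) =
      fun τ ↦ (∑' x : CoprimePair, seedTheta t (rowIm τ x)).toReal + 1 := by
    ext τ
    rw [tsum_seedTheta_rowIm τ ht, ENNReal.toReal_ofReal, sub_add_cancel]
    linarith [one_le_latticeTheta τ ht]
  rw [h]
  exact (Measurable.tsum fun x ↦
    (measurable_seedTheta t).comp (measurable_rowIm x)).ennreal_toReal.add_const 1

theorem mul_latticeTheta_sub_one (τ : ℍ) {t : ℝ} (ht : 0 < t) :
    t * (latticeTheta τ t - 1) = latticeTheta τ (1 / t) - t := by
  rw [latticeTheta_one_div τ ht]; ring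

theorem mul_latticeTheta_sub_one_nonneg (τ : ℍ) {t : ℝ} (ht : 0 < t) :
    0 ≤ t * (latticeTheta τ t - 1) :=
  mul_nonneg ht.le (by linarith [one_le_latticeTheta τ ht])

theorem mul_latticeTheta_sub_one_le (τ : ℍ) {t : ℝ} (ht : 0 < t) (ht1 : t ≤ 1) :
    t * (latticeTheta τ t - 1) ≤ latticeTheta τ 1 := by
  rw [mul_latticeTheta_sub_one τ ht]
  have : latticeTheta τ (1 / t) ≤ latticeTheta τ 1 :=
    latticeTheta_antitoneOn τ (mem_Ioi.2 one_pos) (mem_Ioi.2 (by positivity))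
      (one_le_one_div ht ht1)
  linarith

theorem tendsto_mul_latticeTheta_sub_one (τ : ℍ) :
    Tendsto (fun t ↦ t * (latticeTheta τ t - 1)) (𝓝[>] 0) (𝓝 1) := by
  have h1 : Tendsto (latticeTheta τ) atTop (𝓝 1) := by
    obtain ⟨c, hc, C, hC⟩ := exists_latticeTheta_sub_one_le τ
    have h0 : Tendsto (fun t ↦ C * Real.exp (-c * t)) atTop (𝓝 0) := by
      have : Tendsto (fun t : ℝ ↦ Real.exp (-(c * t))) atTop (𝓝 0) :=
        Real.tendsto_exp_neg_atTop_nhds_zero.comp (tendsto_id.const_mul_atTop hc)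
      simpa [neg_mul] using this.const_mul C
    have h2 : Tendsto (fun t ↦ latticeTheta τ t - 1) atTop (𝓝 0) := by
      refine squeeze_zero' ?_ ?_ h0
      · filter_upwards [eventually_gt_atTop 0] with t ht
        linarith [one_le_latticeTheta τ ht]
      · filter_upwards [eventually_ge_atTop 1] with t ht using hC t ht
    simpa using h2.add_const 1
  have h2 : Tendsto (fun t : ℝ ↦ 1 / t) (𝓝[>] 0) atTop := by
    simpa using tendsto_inv_nhdsGT_zero (𝕜 := ℝ)
  have h3 : Tendsto (fun t : ℝ ↦ latticeTheta τ (1 / t) - t) (𝓝[>] 0) (𝓝 (1 - 0)) :=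
    (h1.comp h2).sub (tendsto_id.mono_left nhdsWithin_le_nhds)
  rw [sub_zero] at h3
  refine h3.congr' ?_
  filter_upwards [self_mem_nhdsWithin] with t ht
  exact (mul_latticeTheta_sub_one τ ht).symm

section

variable {k : ℤ} {f : ModularForm 𝒮ℒ k}

theorem integrableOn_logPetersson_mul_sqrt (hf : Tendsto f atImInfty (𝓝 1)) :
    IntegrableOn (fun τ : ℍ ↦ |logPetersson f τ| * √τ.im) ModularGroup.fd := by
  refine ⟨((measurable_logPetersson f).abs.mul
    UpperHalfPlane.continuous_im.measurable.sqrt).aestronglyMeasurable, ?_⟩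
  rw [hasFiniteIntegral_iff_enorm]
  refine lt_of_le_of_lt (lintegral_mono fun τ ↦ ?_) (lintegral_fd_logPetersson_lt_top hf)
  rw [enorm_mul, Real.enorm_eq_ofReal_abs, abs_abs, ← Real.enorm_eq_ofReal_abs,
    Real.enorm_eq_ofReal (Real.sqrt_nonneg _)]

theorem exists_abs_logPetersson_mul_le (f : ModularForm 𝒮ℒ k) :
    ∃ C : ℝ, ∀ t : ℝ, 0 < t → t ≤ 1 → ∀ τ ∈ ModularGroup.fd,
      ‖logPetersson f τ * (t * (latticeTheta τ t - 1))‖ ≤ C * (|logPetersson f τ| * √τ.im) := by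
  obtain ⟨C, hC⟩ := exists_latticeTheta_one_le
  refine ⟨C, fun t ht ht1 τ hτ ↦ ?_⟩
  rw [norm_mul, Real.norm_eq_abs, Real.norm_of_nonneg (mul_latticeTheta_sub_one_nonneg τ ht),
    mul_left_comm C]
  exact mul_le_mul_of_nonneg_left ((mul_latticeTheta_sub_one_le τ ht ht1).trans
    (hC τ (half_le_im_of_mem_fd hτ))) (abs_nonneg _)

/-- The integrand converges because `t (Θ(τ, t) - 1)` tends to `1`, and for `t ≤ 1` it is dominated
by means of `Θ(τ, 1)`. -/
theorem tendsto_integral_logPetersson_mul (hf : Tendsto f atImInfty (𝓝 1)) :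
    Tendsto (fun t ↦ ∫ τ in ModularGroup.fd, logPetersson f τ * (t * (latticeTheta τ t - 1)))
      (𝓝[>] 0) (𝓝 (∫ τ in ModularGroup.fd, logPetersson f τ)) := by
  obtain ⟨C, hC⟩ := exists_abs_logPetersson_mul_le f
  refine tendsto_integral_filter_of_dominated_convergence _ ?_ ?_
    ((integrableOn_logPetersson_mul_sqrt hf).const_mul C) (ae_of_all _ fun τ ↦ ?_)
  · filter_upwards [self_mem_nhdsWithin] with t ht
    exact ((measurable_logPetersson f).mul
      (((measurable_latticeTheta ht).sub_const 1).const_mul t)).aestronglyMeasurable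
  · filter_upwards [self_mem_nhdsWithin, Ioc_mem_nhdsGT one_pos] with t ht ht1
    filter_upwards [ae_restrict_mem measurableSet_fd] with τ hτ
    exact hC t ht ht1.2 τ hτ
  · simpa using (tendsto_mul_latticeTheta_sub_one τ).const_mul (logPetersson f τ)

theorem integrableOn_logPetersson_mul_theta (hf : Tendsto f atImInfty (𝓝 1)) {t : ℝ} (ht : 0 < t)
    (ht1 : t ≤ 1) :
    IntegrableOn (fun τ ↦ logPetersson f τ * (latticeTheta τ t - 1)) ModularGroup.fd := by
  obtain ⟨C, hC⟩ := exists_abs_logPetersson_mul_le f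
  have h : IntegrableOn (fun τ ↦ logPetersson f τ * (t * (latticeTheta τ t - 1)))
      ModularGroup.fd := by
    refine ((integrableOn_logPetersson_mul_sqrt hf).const_mul C).mono' ((measurable_logPetersson
      f).mul (((measurable_latticeTheta ht).sub_const 1).const_mul t)).aestronglyMeasurable ?_
    filter_upwards [ae_restrict_mem measurableSet_fd] with τ hτ
    exact hC t ht ht1 τ hτ
  refine (h.const_mul t⁻¹).congr (ae_of_all _ fun τ ↦ ?_)
  simp only
  field_simp

theorem measurable_seed_im (t : ℝ) : Measurable fun τ : ℍ ↦ (seedTheta t τ.im).toReal :=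
  ((measurable_seedTheta t).comp UpperHalfPlane.continuous_im.measurable).ennreal_toReal

/-- Unfolding, for nonnegative invariant functions of `logPetersson`. -/
theorem two_mul_lintegral_strip_logPetersson (f : ModularForm 𝒮ℒ k) {g : ℝ → ℝ≥0∞}
    (hg : Measurable g) {t : ℝ} (ht : 0 < t) :
    2 * ∫⁻ τ in strip, g (logPetersson f τ) * seedTheta t τ.im =
      ∫⁻ τ in ModularGroup.fd, g (logPetersson f τ) * ENNReal.ofReal (latticeTheta τ t - 1) := by
  rw [two_mul_lintegral_strip (v := fun τ ↦ g (logPetersson f τ))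
    (hg.comp (measurable_logPetersson f)) (fun γ τ ↦ by rw [logPetersson_smul])
    (measurable_seedTheta t)]
  simp_rw [tsum_seedTheta_rowIm _ ht]

theorem integrableOn_strip_logPetersson (hf : Tendsto f atImInfty (𝓝 1)) {t : ℝ} (ht : 0 < t)
    (ht1 : t ≤ 1) :
    IntegrableOn (fun τ ↦ logPetersson f τ * (seedTheta t τ.im).toReal) strip := by
  refine ⟨((measurable_logPetersson f).mul (measurable_seed_im t)).aestronglyMeasurable, ?_⟩
  have h := (integrableOn_logPetersson_mul_theta hf ht ht1).2
  rw [hasFiniteIntegral_iff_enorm] at h ⊢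
  have h2 := two_mul_lintegral_strip_logPetersson f (g := fun x ↦ ‖x‖ₑ) measurable_enorm ht
  have h3 : ∫⁻ τ in ModularGroup.fd, ‖logPetersson f τ‖ₑ * ENNReal.ofReal (latticeTheta τ t - 1) <
      ∞ := by
    refine lt_of_le_of_lt (lintegral_mono fun τ ↦ ?_) h
    rw [enorm_mul, Real.enorm_eq_ofReal (r := latticeTheta τ t - 1)]
    linarith [one_le_latticeTheta τ ht]
  rw [← h2] at h3
  refine lt_of_le_of_lt (lintegral_mono fun τ ↦ ?_)
    (lt_of_mul_lt_mul_left' (h3.trans_eq (by simp : (∞ : ℝ≥0∞) = 2 * ∞)))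
  rw [enorm_mul, Real.enorm_eq_ofReal ENNReal.toReal_nonneg,
    ENNReal.ofReal_toReal (seedTheta_ne_top ht τ.im_pos)]

/-- Unfolding for `logPetersson` itself, from the nonnegative case applied to its positive and
negative parts. -/
theorem two_mul_integral_strip_logPetersson (hf : Tendsto f atImInfty (𝓝 1)) {t : ℝ} (ht : 0 < t)
    (ht1 : t ≤ 1) :
    2 * ∫ τ in strip, logPetersson f τ * (seedTheta t τ.im).toReal =
      ∫ τ in ModularGroup.fd, logPetersson f τ * (latticeTheta τ t - 1) := by
  rw [integral_eq_lintegral_pos_part_sub_lintegral_neg_part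
      (integrableOn_strip_logPetersson hf ht ht1),
    integral_eq_lintegral_pos_part_sub_lintegral_neg_part
      (integrableOn_logPetersson_mul_theta hf ht ht1)]
  have h : ∀ s : ℝ, (∫⁻ τ in ModularGroup.fd,
      ENNReal.ofReal (s * (logPetersson f τ * (latticeTheta τ t - 1)))) =
      2 * ∫⁻ τ in strip, ENNReal.ofReal (s * (logPetersson f τ * (seedTheta t τ.im).toReal)) := by
    intro s
    have h2 := two_mul_lintegral_strip_logPetersson f (g := fun x ↦ ENNReal.ofReal (s * x))
      (by fun_prop) ht
    refine (lintegral_congr fun τ ↦ ?_).trans (h2.symm.trans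
      (congrArg (2 * ·) (lintegral_congr fun τ ↦ ?_)))
    · rw [← mul_assoc, ENNReal.ofReal_mul' (by linarith [one_le_latticeTheta τ ht])]
    · rw [← mul_assoc, ENNReal.ofReal_mul' ENNReal.toReal_nonneg,
        ENNReal.ofReal_toReal (seedTheta_ne_top ht τ.im_pos)]
  have h1 := h 1
  have h2 := h (-1)
  simp only [one_mul, neg_one_mul] at h1 h2
  rw [h1, h2, ENNReal.toReal_mul, ENNReal.toReal_mul]
  simp
  ring

end

/-! ### The valence formula and the integral in terms of the divisor -/

theorem integrable_strip_fiber {F : ℍ → ℝ} (hi : IntegrableOn F strip) :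
    Integrable (fun y : ℝ ↦ ∫ x : ℝ in Ico (-(1 / 2) : ℝ) (1 / 2),
      F (ofComplex (x + y * Complex.I))) heightMeasure := by
  have hcomp : (fun τ ↦ (F ∘ fun p : ℝ × ℝ ↦ ofComplex (p.1 + p.2 * Complex.I)) (reIm τ)) = F := by
    ext τ
    rw [Function.comp_apply, ofComplex_reIm]
  have hi' := (measurePreserving_reIm.integrable_comp_emb measurableEmbedding_reIm
    (g := F ∘ fun p : ℝ × ℝ ↦ ofComplex (p.1 + p.2 * Complex.I))).1 (by
      have := hcomp ▸ hi
      exact this)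
  rw [stripMeasure_eq] at hi'
  exact hi'.integral_prod_right

section

variable {k : ℤ} {f : ModularForm 𝒮ℒ k} {Z : Divisor}

/-- The integrals `∫_t^∞ (Θ(w) - 1)(1 - t / w) dw`, summed over the divisor. -/
noncomputable def divisorThetaIntegral (Z : Divisor) (t : ℝ) : ℝ :=
  ∑ P ∈ Z.support, (Z P : ℝ) * ∫ w in Ioi t, (latticeTheta P.out w - 1) * (1 - t / w)

theorem HasDivisor.divisorThetaIntegral_nonneg {f : ℍ → ℂ} (hZ : HasDivisor f Z) {t : ℝ}
    (ht : 0 < t) : 0 ≤ divisorThetaIntegral Z t := by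
  refine Finset.sum_nonneg fun P _ ↦ ?_
  have : (0 : ℝ) ≤ Z P := by exact_mod_cast hZ.coeff_nonneg P
  refine mul_nonneg this (setIntegral_nonneg measurableSet_Ioi fun w hw ↦ ?_)
  have hw0 : 0 < w := ht.trans hw
  refine mul_nonneg (by linarith [one_le_latticeTheta P.out hw0]) ?_
  rw [sub_nonneg, div_le_one hw0]
  exact le_of_lt hw

theorem HasDivisor.integral_strip_logPetersson (hZ : HasDivisor f Z)
    (hf : Tendsto f atImInfty (𝓝 1)) {t : ℝ} (ht : 0 < t) (ht1 : t ≤ 1) :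
    ∫ τ in strip, logPetersson f τ * (seedTheta t τ.im).toReal =
      2 * (Real.pi / t * divisorThetaIntegral Z t) +
        k * (((Real.log (4 * Real.pi ^ 2) + Real.eulerMascheroniConstant + Real.log t) *
        (Real.pi ^ 2 / 6) + 2 * logZetaSum) / (Real.pi * t)) := by
  have hi := integrableOn_strip_logPetersson hf ht ht1
  have hm : Measurable fun τ ↦ logPetersson f τ * (seedTheta t τ.im).toReal :=
    (measurable_logPetersson f).mul (measurable_seed_im t)
  obtain ⟨hl1, hl2⟩ := integral_seedTheta_mul_log ht
  have hfib : (fun y : ℝ ↦ ∫ x : ℝ in Ico (-(1 / 2) : ℝ) (1 / 2),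
      (logPetersson f (ofComplex (x + y * Complex.I)) *
        (seedTheta t (ofComplex (x + y * Complex.I)).im).toReal)) =ᵐ[heightMeasure]
      fun y ↦ 2 * ((seedTheta t y).toReal * horizontalMean f y) +
        k * ((seedTheta t y).toReal * Real.log (4 * Real.pi * y)) := by
    filter_upwards [ae_heightMeasure_pos] with y hy
    simp_rw [ofComplex_im hy]
    rw [integral_mul_const, hZ.integral_logPetersson hy]
    ring
  have hA : Integrable (fun y ↦ (seedTheta t y).toReal * horizontalMean f y) heightMeasure := by
    refine ((((integrable_strip_fiber hi).congr hfib).sub (hl1.const_mul k)).const_mul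
      (1 / 2)).congr (ae_of_all _ fun y ↦ ?_)
    simp only [Pi.sub_apply]
    ring
  have hA2 : ∫ y, (seedTheta t y).toReal * horizontalMean f y ∂heightMeasure =
      Real.pi / t * divisorThetaIntegral Z t := by
    have h0 : 0 ≤ᵐ[heightMeasure] fun y ↦ (seedTheta t y).toReal * horizontalMean f y := by
      filter_upwards [ae_heightMeasure_pos] with y hy
      exact mul_nonneg ENNReal.toReal_nonneg (horizontalMean_eq_tsum hf hy).1
    have h := ofReal_integral_eq_lintegral_ofReal hA h0
    have h1 : ∫⁻ y, ENNReal.ofReal ((seedTheta t y).toReal * horizontalMean f y) ∂heightMeasure =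
        ∫⁻ y, seedTheta t y * ENNReal.ofReal (horizontalMean f y) ∂heightMeasure := by
      refine lintegral_congr_ae ?_
      filter_upwards [ae_heightMeasure_pos] with y hy
      rw [ENNReal.ofReal_mul ENNReal.toReal_nonneg, ENNReal.ofReal_toReal (seedTheta_ne_top ht hy)]
    rw [h1, hZ.lintegral_seedTheta_mul_horizontalMean hf ht] at h
    refine (ENNReal.ofReal_eq_ofReal_iff (integral_nonneg_of_ae h0) ?_).1 h
    have := hZ.divisorThetaIntegral_nonneg ht
    exact mul_nonneg (by positivity) this
  refine (integral_strip hm hi).trans ((integral_congr_ae hfib).trans ?_)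
  rw [integral_add (hA.const_mul 2) (hl1.const_mul k), integral_const_mul, integral_const_mul, hA2,
    hl2]

/-- The behaviour of `divisorThetaIntegral` as `t → 0`: a logarithmic divergence with the degree as
coefficient, and a constant term given by the Epstein zeta functions. -/
theorem tendsto_divisorThetaIntegral (Z : Divisor) :
    Tendsto (fun t ↦ divisorThetaIntegral Z t + ((Z.degree : ℚ) : ℝ) * Real.log t) (𝓝[>] 0)
      (𝓝 (∑ P ∈ Z.support, (Z P : ℝ) * ((epsteinLambda₀ P.out 0).re - 2))) := by
  have h : ∀ t, divisorThetaIntegral Z t + ((Z.degree : ℚ) : ℝ) * Real.log t =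
      ∑ P ∈ Z.support, (Z P : ℝ) * ((∫ w in Ioi t, (latticeTheta P.out w - 1) * (1 - t / w)) +
        Real.log t) := by
    intro t
    simp_rw [mul_add]
    rw [Finset.sum_add_distrib, ← Finset.sum_mul, divisorThetaIntegral, Divisor.degree, Finsupp.sum]
    push_cast
    rfl
  simp_rw [h]
  exact tendsto_finsetSum _ fun P _ ↦
    (tendsto_integral_latticeTheta_sub_one_mul P.out).const_mul _

/-- The integral of `logPetersson` as a limit of quantities that depend only on the weight and the
divisor: the unfolded integral is the sum of the contributions of `log |f|` and of `log (4πy)`. -/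
theorem HasDivisor.tendsto_main (hZ : HasDivisor f Z) (hf : Tendsto f atImInfty (𝓝 1)) :
    Tendsto (fun t ↦ 4 * Real.pi * divisorThetaIntegral Z t + 2 * k / Real.pi *
        ((Real.log (4 * Real.pi ^ 2) + Real.eulerMascheroniConstant + Real.log t) *
        (Real.pi ^ 2 / 6) + 2 * logZetaSum)) (𝓝[>] 0)
      (𝓝 (∫ τ in ModularGroup.fd, logPetersson f τ)) := by
  refine (tendsto_integral_logPetersson_mul hf).congr' ?_
  filter_upwards [self_mem_nhdsWithin, Ioc_mem_nhdsGT one_pos] with t ht ht1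
  have ht0 : (0 : ℝ) < t := ht
  have h1 : ∀ τ : ℍ, logPetersson f τ * (t * (latticeTheta τ t - 1)) =
      t * (logPetersson f τ * (latticeTheta τ t - 1)) := fun τ ↦ by ring
  simp_rw [h1]
  rw [integral_const_mul, ← two_mul_integral_strip_logPetersson hf ht ht1.2,
    hZ.integral_strip_logPetersson hf ht ht1.2]
  have := Real.pi_pos
  field_simp
  ring

/-- The valence formula: the coefficient of the divergent term `log t` must vanish. -/
theorem HasDivisor.weight_eq (hZ : HasDivisor f Z) (hf : Tendsto f atImInfty (𝓝 1)) :
    (k : ℚ) = 12 * Z.degree := by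
  have h1 := hZ.tendsto_main hf
  have h2 := (tendsto_divisorThetaIntegral Z).const_mul (4 * Real.pi)
  have h3 := h1.sub h2
  have h4 : Tendsto (fun t ↦ (k * Real.pi / 3 - 4 * Real.pi * ((Z.degree : ℚ) : ℝ)) * Real.log t)
      (𝓝[>] 0) (𝓝 ((∫ τ in ModularGroup.fd, logPetersson f τ) - 4 * Real.pi *
        (∑ P ∈ Z.support, (Z P : ℝ) * ((epsteinLambda₀ P.out 0).re - 2)) - 2 * k / Real.pi *
        ((Real.log (4 * Real.pi ^ 2) + Real.eulerMascheroniConstant) *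
        (Real.pi ^ 2 / 6) + 2 * logZetaSum))) := by
    refine (h3.sub_const (2 * k / Real.pi * ((Real.log (4 * Real.pi ^ 2) +
      Real.eulerMascheroniConstant) * (Real.pi ^ 2 / 6) + 2 * logZetaSum))).congr fun t ↦ ?_
    have := Real.pi_pos
    field_simp
    ring
  -- A function with a finite limit cannot be a nonzero multiple of `log t`.
  have h5 : (k * Real.pi / 3 - 4 * Real.pi * ((Z.degree : ℚ) : ℝ)) = 0 := by
    by_contra hne
    have h6 := h4.const_mul (k * Real.pi / 3 - 4 * Real.pi * ((Z.degree : ℚ) : ℝ))⁻¹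
    simp_rw [inv_mul_cancel_left₀ hne] at h6
    exact not_tendsto_nhds_of_tendsto_atBot Real.tendsto_log_nhdsGT_zero _ h6
  have h6 : (k : ℝ) = 12 * ((Z.degree : ℚ) : ℝ) := by
    have h7 : Real.pi * (k - 12 * ((Z.degree : ℚ) : ℝ)) = 0 := by linear_combination 3 * h5
    rcases mul_eq_zero.1 h7 with h | h
    · exact absurd h Real.pi_ne_zero
    · linarith
  exact_mod_cast h6

/-- The integral of `logPetersson` over the fundamental domain in terms of the divisor. -/
theorem HasDivisor.integral_fd_logPetersson (hZ : HasDivisor f Z)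
    (hf : Tendsto f atImInfty (𝓝 1)) :
    ∫ τ in ModularGroup.fd, logPetersson f τ / (4 * Real.pi) =
      ∑ P ∈ Z.support, (Z P : ℝ) * ((epsteinLambda₀ P.out 0).re - 2) + (k / 12 : ℝ) *
        (Real.log (4 * Real.pi ^ 2) + Real.eulerMascheroniConstant +
          2 * logZetaSum / (Real.pi ^ 2 / 6)) := by
  have hk : (k : ℝ) = 12 * ((Z.degree : ℚ) : ℝ) := by exact_mod_cast hZ.weight_eq hf
  have h1 := hZ.tendsto_main hf
  have h2 := ((tendsto_divisorThetaIntegral Z).const_mul (4 * Real.pi)).add_const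
    (2 * k / Real.pi * ((Real.log (4 * Real.pi ^ 2) +
      Real.eulerMascheroniConstant) * (Real.pi ^ 2 / 6) + 2 * logZetaSum))
  have h3 := tendsto_nhds_unique h1 (h2.congr fun t ↦ by
    rw [hk]
    have := Real.pi_pos
    field_simp
    ring)
  have := Real.pi_pos
  rw [integral_div, h3]
  field_simp
  ring

end

/-! ### Divisors of modular forms -/

section

variable {k : ℤ} (f : ModularForm 𝒮ℒ k)

theorem denom_sl (γ : SL(2, ℤ)) (τ : ℍ) : denom γ τ = (γ 1 0 : ℂ) * τ + γ 1 1 :=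
  ModularGroup.denom_apply γ τ

theorem modularForm_smul (γ : SL(2, ℤ)) (τ : ℍ) :
    f (γ • τ) = ((γ 1 0 : ℂ) * τ + γ 1 1) ^ k * f τ := by
  rw [← denom_sl]
  exact SlashInvariantForm.slash_action_eqn'' (Γ := 𝒮ℒ) f
    (γ := Matrix.SpecialLinearGroup.mapGL ℝ γ) ⟨γ, rfl⟩ τ

theorem denom_sl_ne_zero (γ : SL(2, ℤ)) (τ : ℍ) : (γ 1 0 : ℂ) * τ + γ 1 1 ≠ 0 := by
  rw [← denom_sl]
  exact denom_ne_zero _ τ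

theorem coe_smul_eq_div (γ : SL(2, ℤ)) (τ : ℍ) : ((γ • τ : ℍ) : ℂ) =
    ((γ 0 0 : ℂ) * τ + γ 0 1) / ((γ 1 0 : ℂ) * τ + γ 1 1) := by
  rw [coe_specialLinearGroup_apply]
  simp

theorem eventually_im_pos (τ : ℍ) : ∀ᶠ z in 𝓝 (τ : ℂ), 0 < z.im :=
  (isOpen_lt continuous_const Complex.continuous_im).mem_nhds τ.im_pos

theorem vanishingOrder_smul (γ : SL(2, ℤ)) (τ : ℍ) :
    vanishingOrder f (γ • τ) = vanishingOrder f τ := by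
  set φ : ℂ → ℂ := fun z ↦ ((γ 0 0 : ℂ) * z + γ 0 1) / ((γ 1 0 : ℂ) * z + γ 1 1) with hφ
  have hden := denom_sl_ne_zero γ τ
  have hdet : (γ 0 0 : ℂ) * γ 1 1 - γ 0 1 * γ 1 0 = 1 := by
    have := γ.2
    rw [Matrix.det_fin_two] at this
    exact_mod_cast this
  have hnum : ∀ a b : ℂ, HasDerivAt (fun z : ℂ ↦ a * z + b) a τ := fun a b ↦ by
    simpa using ((hasDerivAt_id (τ : ℂ)).const_mul a).add_const b
  have hd : HasDerivAt φ (1 / ((γ 1 0 : ℂ) * τ + γ 1 1) ^ 2) τ := by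
    refine ((hnum (γ 0 0) (γ 0 1)).div (hnum (γ 1 0) (γ 1 1)) hden).congr_deriv ?_
    rw [← hdet]
    ring
  have hden' : ∀ᶠ z : ℂ in 𝓝 (τ : ℂ), (γ 1 0 : ℂ) * z + γ 1 1 ≠ 0 :=
    ContinuousAt.eventually_ne (by fun_prop) hden
  have han : AnalyticAt ℂ φ τ := by
    refine AnalyticAt.div ?_ ?_ hden <;> fun_prop
  have hτ : φ τ = ((γ • τ : ℍ) : ℂ) := (coe_smul_eq_div γ τ).symm
  have hp : AnalyticAt ℂ (fun z : ℂ ↦ ((γ 1 0 : ℂ) * z + γ 1 1) ^ k) τ :=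
    AnalyticAt.zpow (by fun_prop) hden
  rw [vanishingOrder, ← hτ, ← analyticOrderAt_comp_of_deriv_ne_zero han (by
    rw [hd.deriv]; exact one_div_ne_zero (pow_ne_zero _ hden))]
  have hcongr : (fun z ↦ f (ofComplex z)) ∘ φ =ᶠ[𝓝 (τ : ℂ)]
      (fun z : ℂ ↦ ((γ 1 0 : ℂ) * z + γ 1 1) ^ k) * fun z ↦ f (ofComplex z) := by
    filter_upwards [eventually_im_pos τ] with z hz
    have h1 : φ z = ((γ • (⟨z, hz⟩ : ℍ) : ℍ) : ℂ) := (coe_smul_eq_div γ ⟨z, hz⟩).symm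
    rw [Function.comp_apply, h1, ofComplex_apply, modularForm_smul, Pi.mul_apply,
      ofComplex_apply_of_im_pos hz]
  rw [analyticOrderAt_congr hcongr, analyticOrderAt_mul hp (analyticAt_comp_ofComplex f τ),
    hp.analyticOrderAt_eq_zero.2 (zpow_ne_zero _ hden), zero_add, vanishingOrder]

theorem ramification_smul (γ : SL(2, ℤ)) (τ : ℍ) : ramification (γ • τ) = ramification τ := by
  rw [ramification, ramification, Nat.card_congr
    (MulAction.stabilizerEquivStabilizerOfOrbitRel
      (show MulAction.orbitRel SL(2, ℤ) ℍ (γ • τ) τ from ⟨γ, rfl⟩)).toEquiv]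

theorem tendsto_atImInfty_cuspFunction : Tendsto f atImInfty (𝓝 (cuspFunction 1 f 0)) := by
  have h := ((analyticOnNhd_cuspFunction f 0 (by simp)).continuousAt.tendsto).comp
    (qParam_tendsto_atImInfty one_pos)
  exact h.congr fun τ ↦ cuspFunction_qParam f τ

variable {f}

theorem eventually_im_large {p : ℍ → Prop} (h : ∀ᶠ τ in atImInfty, p τ) :
    ∃ A : ℝ, ∀ τ : ℍ, A ≤ τ.im → p τ := by
  obtain ⟨A, hA⟩ := (atImInfty_mem _).1 h
  exact ⟨A, fun τ hτ ↦ hA τ hτ⟩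

theorem analyticOnNhd_comp_ofComplex :
    AnalyticOnNhd ℂ (fun z : ℂ ↦ f (ofComplex z)) {z | 0 < z.im} := fun z hz ↦
  analyticAt_comp_ofComplex f ⟨z, hz⟩

theorem isPreconnected_upperHalfPlane : IsPreconnected {z : ℂ | 0 < z.im} :=
  (convex_halfSpace_im_gt 0).isPreconnected

theorem vanishingOrder_ne_top (hf : Tendsto f atImInfty (𝓝 1)) (τ : ℍ) :
    vanishingOrder f τ ≠ ⊤ := by
  intro h
  rw [vanishingOrder, analyticOrderAt_eq_top] at h
  have h1 := analyticOnNhd_comp_ofComplex (f := f) |>.eqOn_zero_of_preconnected_of_eventuallyEq_zero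
    isPreconnected_upperHalfPlane τ.im_pos h
  obtain ⟨A, hA⟩ := eventually_im_large (hf.eventually_ne one_ne_zero)
  let σ : ℍ := ⟨(max A 1 : ℝ) * Complex.I, by simp⟩
  refine hA σ ?_ ?_
  · change A ≤ ((max A 1 : ℝ) * Complex.I).im
    simp
  · have := h1 σ.im_pos
    simpa using this

theorem vanishingOrder_ne_zero_iff (τ : ℍ) : vanishingOrder f τ ≠ 0 ↔ f τ = 0 := by
  rw [vanishingOrder, analyticOrderAt_ne_zero, ofComplex_apply]
  exact and_iff_right (analyticAt_comp_ofComplex f τ)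

theorem finite_zeros_fd (hf : Tendsto f atImInfty (𝓝 1)) :
    {τ ∈ ModularGroup.fd | f τ = 0}.Finite := by
  obtain ⟨A, hA⟩ := eventually_im_large (hf.eventually_ne one_ne_zero)
  have hcod : (fun z : ℂ ↦ f (ofComplex z)) ⁻¹' {0}ᶜ ∈ codiscreteWithin {z : ℂ | 0 < z.im} := by
    obtain ⟨σ, hσ⟩ : ∃ σ : ℍ, f σ ≠ 0 := by
      by_contra! h
      exact vanishingOrder_ne_top hf I (by
        rw [vanishingOrder, analyticOrderAt_eq_top]
        exact Eventually.of_forall fun z ↦ h _)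
    exact analyticOnNhd_comp_ofComplex.preimage_zero_mem_codiscreteWithin (x := (σ : ℂ))
      (by simpa using hσ) σ.im_pos ⟨⟨σ, σ.im_pos⟩, isPreconnected_upperHalfPlane⟩
  have hK : IsCompact (UpperHalfPlane.coe '' ModularGroup.truncatedFundamentalDomain A) :=
    (ModularGroup.isCompact_truncatedFundamentalDomain A).image continuous_coe
  have hKsub : UpperHalfPlane.coe '' ModularGroup.truncatedFundamentalDomain A ⊆
      {z : ℂ | 0 < z.im} := by
    rintro _ ⟨τ, -, rfl⟩
    exact τ.im_pos
  have hfin : (UpperHalfPlane.coe '' ModularGroup.truncatedFundamentalDomain A ∩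
      ((fun z : ℂ ↦ f (ofComplex z)) ⁻¹' {0}ᶜ)ᶜ).Finite := by
    have := codiscreteWithin_mono hKsub hcod
    exact hK.finite_sdiff_of_mem_codiscreteWithin this
  refine Finite.of_finite_image (f := UpperHalfPlane.coe) (hfin.subset ?_)
    UpperHalfPlane.coe_injective.injOn
  rintro _ ⟨τ, ⟨h1, h2⟩, rfl⟩
  refine ⟨⟨τ, ⟨h1, ?_⟩, rfl⟩, ?_⟩
  · by_contra h
    exact hA τ (not_le.1 h).le h2
  · simpa using h2

/-- Every modular form with value `1` at the cusp has a divisor. -/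
theorem exists_hasDivisor (hf : Tendsto f atImInfty (𝓝 1)) : ∃ Z : Divisor, HasDivisor f Z := by
  classical
  set c : ModularCurve → ℚ := fun P ↦ (vanishingOrder f P.out).toNat / ramification P.out with hc
  have hcP : ∀ τ : ℍ, c (toModularCurve τ) = (vanishingOrder f τ).toNat / ramification τ := by
    intro τ
    obtain ⟨γ, hγ⟩ := toModularCurve_eq_iff.1 (toModularCurve_out (toModularCurve τ))
    rw [hc]
    simp only
    rw [← hγ, vanishingOrder_smul, ramification_smul]
  have hfin : (Function.support c).Finite := by
    refine ((finite_zeros_fd hf).image toModularCurve).subset fun P hP ↦ ?_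
    obtain ⟨γ, hγ⟩ := ModularGroup.exists_smul_mem_fd P.out
    have hP' : toModularCurve (γ • P.out) = P := by
      rw [toModularCurve_smul, toModularCurve_out]
    refine ⟨γ • P.out, ⟨hγ, ?_⟩, hP'⟩
    rw [← vanishingOrder_ne_zero_iff]
    intro h0
    rw [Function.mem_support, ← hP', hcP, h0] at hP
    simp at hP
  refine ⟨Finsupp.ofSupportFinite c hfin, fun τ ↦ ⟨(vanishingOrder f τ).toNat, ?_, ?_⟩⟩
  · exact (ENat.natCast_toNat (vanishingOrder_ne_top hf τ)).symm
  · rw [Finsupp.ofSupportFinite_coe, hcP]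

end

/-! ### Modular forms with a given divisor -/

theorem Divisor.degree_sub (Z W : Divisor) : (Z - W : Divisor).degree = Z.degree - W.degree :=
  Finsupp.sum_sub_index fun _ _ _ ↦ rfl

theorem Divisor.degree_single (P : ModularCurve) (c : ℚ) :
    Divisor.degree (Finsupp.single P c) = c := Finsupp.sum_single_index rfl

theorem Divisor.le_degree {W : Divisor} (hW : ∀ P, 0 ≤ W P) (P : ModularCurve) :
    W P ≤ W.degree := by
  by_cases h : P ∈ W.support
  · exact Finset.single_le_sum (fun Q _ ↦ hW Q) h
  · rw [Finsupp.notMem_support_iff.1 h]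
    exact Finset.sum_nonneg fun Q _ ↦ hW Q

theorem Divisor.eq_of_le_of_degree_eq {Z W : Divisor} (h : ∀ P, W P ≤ Z P)
    (hd : Z.degree = W.degree) : Z = W := by
  have hnn : ∀ P, 0 ≤ (Z - W : Divisor) P := fun P ↦ by
    rw [Finsupp.sub_apply]; linarith [h P]
  ext P
  have h1 := Divisor.le_degree hnn P
  have h2 := h P
  rw [Divisor.degree_sub, hd, sub_self, Finsupp.sub_apply] at h1
  linarith

section

variable {k : ℤ} {f g : ModularForm 𝒮ℒ k} {Z : Divisor}

theorem HasDivisor.vanishingOrder_eq {f : ℍ → ℂ} (hZ : HasDivisor f Z) (τ : ℍ) :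
    ((vanishingOrder f τ).toNat : ℕ∞) = vanishingOrder f τ := by
  obtain ⟨n, h, -⟩ := hZ τ
  rw [vanishingOrder, h]
  rfl

theorem le_vanishingOrder_linear_combination (a b : ℂ) (τ : ℍ) :
    min (vanishingOrder f τ) (vanishingOrder g τ) ≤ vanishingOrder (a • f + b • g : ModularForm 𝒮ℒ k) τ := by
  have hmul : ∀ (a : ℂ) (f : ModularForm 𝒮ℒ k), vanishingOrder f τ ≤
      analyticOrderAt ((fun _ ↦ a) * fun z : ℂ ↦ f (ofComplex z)) (τ : ℂ) := fun a f ↦ by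
    rw [analyticOrderAt_mul analyticAt_const (analyticAt_comp_ofComplex f τ)]
    exact le_add_self
  have h : (fun z : ℂ ↦ (a • f + b • g : ModularForm 𝒮ℒ k) (ofComplex z)) =
      ((fun _ ↦ a) * fun z : ℂ ↦ f (ofComplex z)) + ((fun _ ↦ b) * fun z : ℂ ↦ g (ofComplex z)) :=
    rfl
  rw [vanishingOrder, vanishingOrder, vanishingOrder]
  exact (min_le_min (hmul a f) (hmul b g)).trans le_analyticOrderAt_add

/-- A modular form is determined by its divisor and its value at the cusp: otherwise a suitable
linear combination of two such forms would have too many zeros. -/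
theorem HasDivisor.unique (hZ : HasDivisor f Z) (hZ' : HasDivisor g Z)
    (hf : Tendsto f atImInfty (𝓝 1)) (hg : Tendsto g atImInfty (𝓝 1)) : f = g := by
  have hord : ∀ τ, vanishingOrder f τ = vanishingOrder g τ := by
    intro τ
    have h := (hZ.coeff_eq τ).symm.trans (hZ'.coeff_eq τ)
    rw [div_left_inj' (ramification_pos τ).ne', Nat.cast_inj] at h
    rw [← hZ.vanishingOrder_eq, ← hZ'.vanishingOrder_eq, h]
  ext τ
  by_cases hgτ : g τ = 0
  · rw [hgτ, ← vanishingOrder_ne_zero_iff, hord, vanishingOrder_ne_zero_iff, hgτ]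
  by_contra hne
  set c := f τ / g τ with hc
  have hc1 : 1 - c ≠ 0 := by
    rw [hc, sub_ne_zero]
    intro h
    exact hne ((div_eq_one_iff_eq hgτ).1 h.symm)
  -- The combination of `f` and `g` that vanishes at `τ` and has the value `1` at the cusp.
  set F : ModularForm 𝒮ℒ k := (1 - c)⁻¹ • f + (-((1 - c)⁻¹ * c)) • g with hF
  have hFt : Tendsto F atImInfty (𝓝 1) := by
    have h := (hf.const_mul (1 - c)⁻¹).add (hg.const_mul (-((1 - c)⁻¹ * c)))
    have e : (1 - c)⁻¹ * 1 + -((1 - c)⁻¹ * c) * 1 = 1 := by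
      field_simp; ring
    rw [e] at h
    exact h
  have hFτ : F τ = 0 := by
    change (1 - c)⁻¹ * f τ + (-((1 - c)⁻¹ * c)) * g τ = 0
    rw [hc]
    field_simp
    ring
  obtain ⟨W, hW⟩ := exists_hasDivisor hFt
  have hle : ∀ P, Z P ≤ W P := by
    intro P
    rw [← toModularCurve_out P, hZ.coeff_eq, hW.coeff_eq]
    refine div_le_div_of_nonneg_right ?_ (ramification_pos _).le
    have h1 := le_vanishingOrder_linear_combination (f := f) (g := g) (1 - c)⁻¹
      (-((1 - c)⁻¹ * c)) P.out
    rw [← hord, min_self, ← hF, ← hZ.vanishingOrder_eq, ← hW.vanishingOrder_eq] at h1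
    exact_mod_cast h1
  have hdeg : W.degree = Z.degree := by
    have h1 := hZ.weight_eq hf
    have h2 := hW.weight_eq hFt
    linarith
  -- By the valence formula `F` has no zeros beyond those of `f` and `g`, but it vanishes at `τ`.
  have hWZ := Divisor.eq_of_le_of_degree_eq hle hdeg
  rw [hWZ] at hW
  have h1 := (hZ'.coeff_eq τ).symm.trans (hW.coeff_eq τ)
  rw [div_left_inj' (ramification_pos τ).ne', Nat.cast_inj] at h1
  have h2 : vanishingOrder g τ = 0 := not_not.1 fun h ↦ hgτ ((vanishingOrder_ne_zero_iff τ).1 h)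
  have h3 := (vanishingOrder_ne_zero_iff τ).2 hFτ
  rw [← hW.vanishingOrder_eq, ← h1, h2] at h3
  exact h3 rfl

/-- A form of weight `k` that vanishes at a point whose stabilizer has order at most `24 / k` has
no zeros outside the orbit of that point: by the valence formula its divisor has degree `k / 12`,
and the one zero already accounts for this. -/
theorem hasDivisor_single (hf : Tendsto f atImInfty (𝓝 1)) {ρ : ℍ} (hρ : f ρ = 0)
    (hk : (k : ℚ) * Nat.card (MulAction.stabilizer SL(2, ℤ) ρ) ≤ 24) :
    HasDivisor f (Finsupp.single (toModularCurve ρ) (k / 12 : ℚ)) := by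
  classical
  obtain ⟨Z, hZ⟩ := exists_hasDivisor hf
  have hZk := hZ.weight_eq hf
  convert hZ using 1
  refine (Divisor.eq_of_le_of_degree_eq (fun P ↦ ?_) ?_).symm
  · rw [Finsupp.single_apply]
    split_ifs with h
    · rw [← h, hZ.coeff_eq, ramification]
      have hcard : (0 : ℚ) < Nat.card (MulAction.stabilizer SL(2, ℤ) ρ) := by
        exact_mod_cast Nat.card_pos
      have hn : 1 ≤ (vanishingOrder f ρ).toNat := by
        rw [Nat.one_le_iff_ne_zero]
        intro h0
        refine (vanishingOrder_ne_zero_iff ρ).2 hρ ?_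
        rw [← hZ.vanishingOrder_eq, h0]
        rfl
      have hn' : (1 : ℚ) ≤ (vanishingOrder f ρ).toNat := by exact_mod_cast hn
      rw [le_div_iff₀ (by positivity)]
      linarith
    · exact hZ.coeff_nonneg P
  · rw [Divisor.degree_single, hZk]
    ring

end

theorem HasDivisor.mul {k l : ℤ} {f : ModularForm 𝒮ℒ k} {g : ModularForm 𝒮ℒ l} {Z W : Divisor}
    (hZ : HasDivisor f Z) (hW : HasDivisor g W) : HasDivisor (f.mul g) (Z + W) := by
  intro τ
  obtain ⟨m, h1, h2⟩ := hZ τ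
  obtain ⟨n, h3, h4⟩ := hW τ
  refine ⟨m + n, ?_, ?_⟩
  · have h : (fun z : ℂ ↦ (f.mul g) (ofComplex z)) =
        (fun z : ℂ ↦ f (ofComplex z)) * fun z : ℂ ↦ g (ofComplex z) := rfl
    rw [h, analyticOrderAt_mul (analyticAt_comp_ofComplex f τ) (analyticAt_comp_ofComplex g τ),
      h1, h3]
    rfl
  · rw [Finsupp.add_apply, h2, h4]
    push_cast
    ring

theorem hasDivisor_one : HasDivisor (1 : ModularForm 𝒮ℒ 0) 0 := by
  intro τ
  refine ⟨0, ?_, by simp⟩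
  have h : (fun z : ℂ ↦ (1 : ModularForm 𝒮ℒ 0) (ofComplex z)) = fun _ ↦ 1 := rfl
  rw [h, analyticAt_const.analyticOrderAt_eq_zero.2 one_ne_zero]
  rfl

/-- Divisors of modular forms with value `1` at the cusp are closed under finite sums. -/
theorem exists_hasDivisor_sum {ι : Type*} (s : Finset ι) (Z : ι → Divisor)
    (h : ∀ i ∈ s, ∃ (k : ℤ) (f : ModularForm 𝒮ℒ k), HasDivisor f (Z i) ∧
      Tendsto f atImInfty (𝓝 1)) :
    ∃ (k : ℤ) (f : ModularForm 𝒮ℒ k), HasDivisor f (∑ i ∈ s, Z i) ∧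
      Tendsto f atImInfty (𝓝 1) := by
  classical
  induction s using Finset.induction_on with
  | empty => exact ⟨0, 1, by simpa using hasDivisor_one, tendsto_const_nhds⟩
  | insert i s hi ih =>
    obtain ⟨k, f, hf, hf1⟩ := h i (by simp)
    obtain ⟨l, g, hg, hg1⟩ := ih fun j hj ↦ h j (by simp [hj])
    refine ⟨k + l, f.mul g, ?_, ?_⟩
    · rw [Finset.sum_insert hi]
      exact hf.mul hg
    · have := hf1.mul hg1
      rw [one_mul] at this
      exact this

theorem tendsto_E {k : ℕ} (hk : 3 ≤ k) (hk2 : Even k) :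
    Tendsto (ModularForm.E hk) atImInfty (𝓝 1) := by
  have h := tendsto_atImInfty_cuspFunction (ModularForm.E hk)
  have h0 := EisensteinSeries.E_qExpansion_coeff_zero hk hk2
  rw [UpperHalfPlane.qExpansion_coeff] at h0
  simp only [Nat.factorial_zero, Nat.cast_one, inv_one, one_mul, iteratedDeriv_zero] at h0
  rwa [h0] at h

/-- The form is the combination of `E₄³` and `E₆²` that vanishes at `ρ`; it can be normalized at the
cusp because `E₄³ - E₆²` is a multiple of the discriminant and so does not vanish at `ρ`. -/
theorem exists_weight_twelve (ρ : ℍ) : ∃ f : ModularForm 𝒮ℒ 12, f ρ = 0 ∧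
    Tendsto f atImInfty (𝓝 1) := by
  set p := ModularForm.E₄ ρ with hp
  set q := ModularForm.E₆ ρ with hq
  have hne : p ^ 3 - q ^ 2 ≠ 0 := by
    have h := ModularForm.discriminant_eq_E₄_cube_sub_E₆_sq ρ
    intro h0
    rw [← hp, ← hq, h0, zero_div] at h
    exact ModularForm.discriminant_ne_zero ρ h
  set F : ModularForm 𝒮ℒ 12 := ModularForm.mcast (by decide) (ModularForm.E₄.pow 3) with hF
  set G : ModularForm 𝒮ℒ 12 := ModularForm.mcast (by decide) (ModularForm.E₆.pow 2) with hG
  have hFv : ∀ τ, F τ = ModularForm.E₄ τ ^ 3 := fun τ ↦ by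
    rw [hF, ModularForm.coe_mcast, ModularForm.coe_pow, Pi.pow_apply]
  have hGv : ∀ τ, G τ = ModularForm.E₆ τ ^ 2 := fun τ ↦ by
    rw [hG, ModularForm.coe_mcast, ModularForm.coe_pow, Pi.pow_apply]
  have h : ∀ τ, ((-(q ^ 2 / (p ^ 3 - q ^ 2))) • F + (p ^ 3 / (p ^ 3 - q ^ 2)) • G) τ =
      -(q ^ 2 / (p ^ 3 - q ^ 2)) * ModularForm.E₄ τ ^ 3 +
        p ^ 3 / (p ^ 3 - q ^ 2) * ModularForm.E₆ τ ^ 2 := fun τ ↦ by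
    rw [← hFv, ← hGv]; rfl
  refine ⟨(-(q ^ 2 / (p ^ 3 - q ^ 2))) • F + (p ^ 3 / (p ^ 3 - q ^ 2)) • G, ?_, ?_⟩
  · rw [h, ← hp, ← hq]
    ring
  · have h4 := ((tendsto_E (k := 4) (by norm_num) ⟨2, rfl⟩).pow 3).const_mul
      (-(q ^ 2 / (p ^ 3 - q ^ 2)))
    have h6 := ((tendsto_E (k := 6) (by norm_num) ⟨3, rfl⟩).pow 2).const_mul
      (p ^ 3 / (p ^ 3 - q ^ 2))
    have h46 := h4.add h6
    have e : -(q ^ 2 / (p ^ 3 - q ^ 2)) * 1 ^ 3 + p ^ 3 / (p ^ 3 - q ^ 2) * 1 ^ 2 = 1 := by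
      field_simp; ring
    rw [e] at h46
    exact h46.congr fun τ ↦ (h τ).symm

/-! ### Stabilizers and units -/

theorem mul_denom_of_mem_stabilizer {ρ : ℍ} {γ : SL(2, ℤ)}
    (h : γ ∈ MulAction.stabilizer SL(2, ℤ) ρ) :
    (γ 0 0 : ℂ) * ρ + γ 0 1 = ρ * ((γ 1 0 : ℂ) * ρ + γ 1 1) := by
  have h1 := coe_smul_eq_div γ ρ
  rw [MulAction.mem_stabilizer_iff.1 h, eq_div_iff (denom_sl_ne_zero γ ρ)] at h1
  exact h1.symm

/-- On the stabilizer of `ρ` the factor `c ρ + d` is a character. -/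
noncomputable def stabilizerCharacter (ρ : ℍ) : MulAction.stabilizer SL(2, ℤ) ρ →* ℂ where
  toFun γ := (γ.1 1 0 : ℂ) * ρ + γ.1 1 1
  map_one' := by simp
  map_mul' γ δ := by
    have h := mul_denom_of_mem_stabilizer δ.2
    rw [Subgroup.coe_mul, Matrix.SpecialLinearGroup.coe_mul, Matrix.mul_apply, Matrix.mul_apply,
      Fin.sum_univ_two, Fin.sum_univ_two]
    push_cast
    linear_combination (γ.1 1 0 : ℂ) * h

theorem int_linear_eq {ρ : ℍ} {a b c d : ℤ} (h : (a : ℂ) * ρ + b = c * ρ + d) :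
    a = c ∧ b = d := by
  have hi := congrArg Complex.im h
  have hr := congrArg Complex.re h
  have hρ := ρ.im_ne_zero
  simp [hρ] at hi
  subst hi
  simp at hr
  exact ⟨rfl, hr⟩

theorem stabilizerCharacter_injective (ρ : ℍ) : Function.Injective (stabilizerCharacter ρ) := by
  intro γ δ h
  obtain ⟨h1, h2⟩ := int_linear_eq (ρ := ρ) h
  have h3 := mul_denom_of_mem_stabilizer γ.2
  have h4 := mul_denom_of_mem_stabilizer δ.2
  rw [h1, h2, ← h4] at h3
  obtain ⟨h5, h6⟩ := int_linear_eq h3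
  apply Subtype.ext
  ext i j
  fin_cases i <;> fin_cases j <;> assumption

/-- The value of the character is an eigenvalue of the matrix, hence a root of its characteristic
polynomial. -/
theorem stabilizerCharacter_sq (ρ : ℍ) (γ : MulAction.stabilizer SL(2, ℤ) ρ) :
    stabilizerCharacter ρ γ ^ 2 - (γ.1 0 0 + γ.1 1 1 : ℤ) * stabilizerCharacter ρ γ + 1 = 0 := by
  have h := mul_denom_of_mem_stabilizer γ.2
  have hdet : (γ.1 0 0 : ℂ) * γ.1 1 1 - γ.1 0 1 * γ.1 1 0 = 1 := by
    have := γ.1.2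
    rw [Matrix.det_fin_two] at this
    exact_mod_cast this
  change ((γ.1 1 0 : ℂ) * ρ + γ.1 1 1) ^ 2 - (γ.1 0 0 + γ.1 1 1 : ℤ) *
    ((γ.1 1 0 : ℂ) * ρ + γ.1 1 1) + 1 = 0
  push_cast
  linear_combination -(γ.1 1 0 : ℂ) * h - hdet

theorem neg_one_mem_stabilizer (ρ : ℍ) : -1 ∈ MulAction.stabilizer SL(2, ℤ) ρ := by
  rw [MulAction.mem_stabilizer_iff, ModularGroup.SL_neg_smul, one_smul]

/-- The transformation law at an elliptic point forces a zero, unless the weight is compatible with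
the character of the stabilizer. -/
theorem modularForm_eq_zero_of_character {k : ℤ} (f : ModularForm 𝒮ℒ k) {ρ : ℍ}
    (γ : MulAction.stabilizer SL(2, ℤ) ρ) (h : stabilizerCharacter ρ γ ^ k ≠ 1) : f ρ = 0 := by
  have h1 := modularForm_smul f γ.1 ρ
  rw [MulAction.mem_stabilizer_iff.1 γ.2] at h1
  have h2 : (stabilizerCharacter ρ γ ^ k - 1) * f ρ = 0 := by
    rw [sub_mul, one_mul, sub_eq_zero]
    exact h1.symm
  exact (mul_eq_zero.1 h2).resolve_left (sub_ne_zero.2 h)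

/-- For every point `ρ` there is a modular form with a zero only at `[ρ]`, of the least possible
order: `E₄` or `E₆` at the elliptic points, a combination of `E₄³` and `E₆²` elsewhere. -/
theorem exists_hasDivisor_single (ρ : ℍ) : ∃ (k : ℤ) (f : ModularForm 𝒮ℒ k),
    HasDivisor f (Finsupp.single (toModularCurve ρ)
      (2 / Nat.card (MulAction.stabilizer SL(2, ℤ) ρ) : ℚ)) ∧ Tendsto f atImInfty (𝓝 1) := by
  -- The stabilizer embeds into `ℂˣ` by its character, so it is cyclic, with a generator whose
  -- eigenvalue `u` is a root of unity of order `s`.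
  have hcyc : IsCyclic (MulAction.stabilizer SL(2, ℤ) ρ) :=
    isCyclic_of_injective_ringHom _ (stabilizerCharacter_injective ρ)
  obtain ⟨γ, hγ⟩ := IsCyclic.exists_ofOrder_eq_natCard (α := MulAction.stabilizer SL(2, ℤ) ρ)
  set s := Nat.card (MulAction.stabilizer SL(2, ℤ) ρ) with hs
  have hs0 : 0 < s := Nat.card_pos
  set u := stabilizerCharacter ρ γ with hu
  have hus : orderOf u = s := by
    rw [hu, orderOf_injective _ (stabilizerCharacter_injective ρ), hγ]
  have heven : 2 ∣ s := by
    let δ : MulAction.stabilizer SL(2, ℤ) ρ := ⟨-1, neg_one_mem_stabilizer ρ⟩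
    have h1 : stabilizerCharacter ρ δ = -1 := by
      change ((-1 : SL(2, ℤ)) 1 0 : ℂ) * ρ + (-1 : SL(2, ℤ)) 1 1 = -1
      simp
    have h2 : orderOf δ = 2 := by
      rw [← orderOf_injective _ (stabilizerCharacter_injective ρ), h1, orderOf_neg_one,
        ringChar.eq_zero, if_neg (by decide)]
    rw [← h2]
    exact orderOf_dvd_natCard δ
  have hfin : ∀ {k : ℤ} (f : ModularForm 𝒮ℒ k), f ρ = 0 → Tendsto f atImInfty (𝓝 1) →
      (k : ℚ) * s = 24 → HasDivisor f (Finsupp.single (toModularCurve ρ) (2 / s : ℚ)) := by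
    intro k f h1 h2 h3
    have : (2 / s : ℚ) = k / 12 := by
      have : (s : ℚ) ≠ 0 := by exact_mod_cast hs0.ne'
      field_simp
      linarith
    rw [this]
    exact hasDivisor_single h2 h1 h3.le
  have hpow : u ^ s = 1 := by rw [← hus]; exact pow_orderOf_eq_one u
  have hnorm : ‖u‖ = 1 := Complex.norm_eq_one_of_pow_eq_one hpow hs0.ne'
  have hu0 : u ≠ 0 := by
    intro h; rw [h, norm_zero] at hnorm; exact zero_ne_one hnorm
  have hsq := stabilizerCharacter_sq ρ γ
  rw [← hu] at hsq
  -- The trace `u + u⁻¹` is an integer of absolute value at most `2`, which leaves the orders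
  -- `2`, `4` and `6`, realized by forms of weight `12`, `6` and `4`.
  set t : ℤ := γ.1 0 0 + γ.1 1 1 with ht
  have htle : |t| ≤ 2 := by
    have h1 : (t : ℂ) = u + u⁻¹ := by
      field_simp
      linear_combination -hsq
    have h2 : ‖(t : ℂ)‖ ≤ 2 := by
      rw [h1]
      refine (norm_add_le _ _).trans ?_
      rw [norm_inv, hnorm]; norm_num
    rw [Complex.norm_intCast] at h2
    exact_mod_cast h2
  have hdvd : ∀ n : ℕ, u ^ n = 1 → s ∣ n := fun n hn ↦ by
    rw [← hus]; exact orderOf_dvd_of_pow_eq_one hn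
  have htc : t = -2 ∨ t = -1 ∨ t = 0 ∨ t = 1 ∨ t = 2 := by
    have := abs_le.1 htle
    omega
  have h2case : s ∣ 2 → ∃ (k : ℤ) (f : ModularForm 𝒮ℒ k),
      HasDivisor f (Finsupp.single (toModularCurve ρ) (2 / s : ℚ)) ∧
        Tendsto f atImInfty (𝓝 1) := by
    intro h
    have hs2 : s = 2 := Nat.dvd_antisymm h heven
    obtain ⟨f, h1, h2⟩ := exists_weight_twelve ρ
    exact ⟨12, f, hfin f h1 h2 (by rw [hs2]; norm_num), h2⟩
  rcases htc with h | h | h | h | h <;> rw [h] at hsq <;> push_cast at hsq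
  · have h1 : (u + 1) ^ 2 = 0 := by linear_combination hsq
    have h2 : u = -1 := by
      rw [pow_eq_zero_iff two_ne_zero] at h1
      linear_combination h1
    exact h2case (hdvd 2 (by rw [h2]; norm_num))
  · have h3 : s ∣ 3 := hdvd 3 (by linear_combination (u - 1) * hsq)
    have := heven.trans h3
    omega
  · have h4 : s ∣ 4 := hdvd 4 (by linear_combination (u ^ 2 - 1) * hsq)
    have hs4 : s = 4 ∨ s ∣ 2 := by
      have haux : ∀ m ≤ 4, m ∣ 4 → 2 ∣ m → m = 4 ∨ m ∣ 2 := by decide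
      exact haux s (Nat.le_of_dvd (by norm_num) h4) h4 heven
    rcases hs4 with hs4 | hs2
    · refine ⟨6, ModularForm.E₆, hfin _ (modularForm_eq_zero_of_character _ γ ?_)
        (tendsto_E _ ⟨3, rfl⟩) (by rw [hs4]; norm_num), tendsto_E _ ⟨3, rfl⟩⟩
      rw [← hu]
      intro h6
      have : s ∣ 6 := hdvd 6 (by exact_mod_cast h6)
      rw [hs4] at this
      omega
    · exact h2case hs2
  · have h6 : s ∣ 6 := hdvd 6 (by linear_combination (u ^ 4 + u ^ 3 - u - 1) * hsq)
    have hs6 : s = 6 ∨ s ∣ 2 := by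
      have haux : ∀ m ≤ 6, m ∣ 6 → 2 ∣ m → m = 6 ∨ m ∣ 2 := by decide
      exact haux s (Nat.le_of_dvd (by norm_num) h6) h6 heven
    rcases hs6 with hs6 | hs2
    · refine ⟨4, ModularForm.E₄, hfin _ (modularForm_eq_zero_of_character _ γ ?_)
        (tendsto_E _ ⟨2, rfl⟩) (by rw [hs6]; norm_num), tendsto_E _ ⟨2, rfl⟩⟩
      rw [← hu]
      intro h4
      have : s ∣ 4 := hdvd 4 (by exact_mod_cast h4)
      rw [hs6] at this
      omega
    · exact h2case hs2
  · have h1 : (u - 1) ^ 2 = 0 := by linear_combination hsq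
    have h2 : u = 1 := by
      rw [pow_eq_zero_iff two_ne_zero] at h1
      linear_combination h1
    exact h2case (hdvd 2 (by rw [h2]; norm_num))

section

variable {D : ℤ} {𝔞 : (FractionalIdeal (𝓞 (quadField D))⁰ (quadField D))ˣ} {a b : quadField D}

theorem IsOrientedBasis.ne_zero (h : IsOrientedBasis D 𝔞 a b) : (a : ℂ) ≠ 0 := by
  intro h0
  have := h.2.2
  simp [h0] at this

theorem IsOrientedBasis.coe_span (h : IsOrientedBasis D 𝔞 a b) {x : quadField D}
    (hx : x ∈ (𝔞 : FractionalIdeal (𝓞 (quadField D))⁰ (quadField D))) :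
    ∃ m n : ℤ, (x : ℂ) = m * (b : ℂ) + n * (a : ℂ) := by
  rw [h.2.1, Submodule.mem_span_pair] at hx
  obtain ⟨n, m, hmn⟩ := hx
  refine ⟨m, n, ?_⟩
  have := congrArg (Subtype.val : quadField D → ℂ) hmn
  rw [← this]
  simp
  ring

/-- The matrix of multiplication by an algebraic integer on an oriented basis. -/
theorem IsOrientedBasis.exists_matrix (h : IsOrientedBasis D 𝔞 a b) (u : 𝓞 (quadField D)) :
    ∃ p q r s : ℤ, ((u : quadField D) : ℂ) * b = p * (b : ℂ) + q * (a : ℂ) ∧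
      ((u : quadField D) : ℂ) * a = r * (b : ℂ) + s * (a : ℂ) ∧
      ((p * s - q * r : ℤ) : ℝ) = Complex.normSq ((u : quadField D) : ℂ) := by
  have hmem : ∀ x ∈ ({a, b} : Set (quadField D)),
      u • x ∈ (𝔞 : FractionalIdeal (𝓞 (quadField D))⁰ (quadField D)) := fun x hx ↦
    Submodule.smul_mem _ u ((h.2.1 x).2 (Submodule.subset_span hx))
  obtain ⟨p, q, hpq⟩ := h.coe_span (hmem b (by simp))
  obtain ⟨r, s, hrs⟩ := h.coe_span (hmem a (by simp))
  have e : ∀ x : quadField D, ((u • x : quadField D) : ℂ) = ((u : quadField D) : ℂ) * x :=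
    fun x ↦ rfl
  rw [e] at hpq hrs
  refine ⟨p, q, r, s, hpq, hrs, ?_⟩
  have h1 : ((u : quadField D) : ℂ) * b * conj (((u : quadField D) : ℂ) * a) =
      Complex.normSq ((u : quadField D) : ℂ) * ((b : ℂ) * conj (a : ℂ)) := by
    rw [map_mul, Complex.normSq_eq_conj_mul_self]
    ring
  have h2 := congrArg Complex.im h1
  rw [Complex.im_ofReal_mul, hpq, hrs] at h2
  have h3 : ((p * (b : ℂ) + q * (a : ℂ)) * conj (r * (b : ℂ) + s * (a : ℂ))).im =
      ((p * s - q * r : ℤ) : ℝ) * ((b : ℂ) * conj (a : ℂ)).im := by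
    simp
    ring
  rw [h3] at h2
  exact mul_right_cancel₀ h.2.2.ne' h2

/-- The square of the absolute value of an algebraic integer is the determinant of its matrix, hence
a positive integer; so it is `1` for a unit, whose inverse has the same property. -/
theorem IsOrientedBasis.normSq_unit (h : IsOrientedBasis D 𝔞 a b) (u : (𝓞 (quadField D))ˣ) :
    Complex.normSq (((u : 𝓞 (quadField D)) : quadField D) : ℂ) = 1 := by
  have key : ∀ u : (𝓞 (quadField D))ˣ,
      1 ≤ Complex.normSq (((u : 𝓞 (quadField D)) : quadField D) : ℂ) := by
    intro u
    obtain ⟨p, q, r, s, -, -, h1⟩ := h.exists_matrix (u : 𝓞 (quadField D))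
    have h0 : 0 < Complex.normSq (((u : 𝓞 (quadField D)) : quadField D) : ℂ) := by
      refine Complex.normSq_pos.2 ?_
      have := u.ne_zero
      exact_mod_cast this
    rw [← h1] at h0 ⊢
    exact_mod_cast h0
  have hmul : Complex.normSq (((u : 𝓞 (quadField D)) : quadField D) : ℂ) *
      Complex.normSq ((((u⁻¹ : (𝓞 (quadField D))ˣ) : 𝓞 (quadField D)) : quadField D) : ℂ) = 1 := by
    rw [← map_mul, ← map_one Complex.normSq]
    congr 1
    have h1 := u.mul_inv
    have h2 := congrArg (fun x : 𝓞 (quadField D) ↦ ((x : quadField D) : ℂ)) h1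
    exact h2
  have h1 := key u
  have h2 := key u⁻¹
  nlinarith

/-- The stabilizer of the point attached to an ideal is the unit group. -/
theorem IsOrientedBasis.card_stabilizer (h : IsOrientedBasis D 𝔞 a b) {ρ : ℍ}
    (hρ : (ρ : ℂ) = (b : ℂ) / (a : ℂ)) :
    Nat.card (MulAction.stabilizer SL(2, ℤ) ρ) = numUnits D := by
  have ha := h.ne_zero
  have ha' : a ≠ 0 := fun h0 ↦ ha (by rw [h0]; rfl)
  have hval : ∀ γ : MulAction.stabilizer SL(2, ℤ) ρ,
      (((γ.1 1 0 : quadField D) * (b / a) + γ.1 1 1 : quadField D) : ℂ) =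
        stabilizerCharacter ρ γ := by
    intro γ
    change _ = (γ.1 1 0 : ℂ) * ρ + γ.1 1 1
    rw [hρ]
    push_cast
    rfl
  have hint : ∀ γ : MulAction.stabilizer SL(2, ℤ) ρ,
      IsIntegral ℤ ((γ.1 1 0 : quadField D) * (b / a) + γ.1 1 1 : quadField D) := by
    intro γ
    rw [← isIntegral_algHom_iff ((quadField D).val.restrictScalars ℤ) Subtype.val_injective]
    change IsIntegral ℤ ((((γ.1 1 0 : quadField D) * (b / a) + γ.1 1 1 : quadField D)) : ℂ)
    rw [hval]
    refine IsIntegral.of_pow (n := Nat.card (MulAction.stabilizer SL(2, ℤ) ρ)) Nat.card_pos ?_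
    rw [← map_pow, pow_card_eq_one', map_one]
    exact isIntegral_one
  let φ : MulAction.stabilizer SL(2, ℤ) ρ →* 𝓞 (quadField D) :=
    { toFun := fun γ ↦ ⟨_, hint γ⟩
      map_one' := by
        apply RingOfIntegers.ext
        apply Subtype.val_injective
        exact (hval 1).trans (map_one _)
      map_mul' := fun γ δ ↦ by
        apply RingOfIntegers.ext
        apply Subtype.val_injective
        refine (hval (γ * δ)).trans ((map_mul _ _ _).trans ?_)
        rw [← hval, ← hval]
        rfl }
  have hφ : ∀ γ, ((φ γ : quadField D) : ℂ) = stabilizerCharacter ρ γ := hval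
  refine Nat.card_eq_of_bijective φ.toHomUnits ⟨fun γ δ hγδ ↦ ?_, fun u ↦ ?_⟩
  · apply stabilizerCharacter_injective ρ
    have h1 := congrArg (fun x : (𝓞 (quadField D))ˣ ↦ (((x : 𝓞 (quadField D)) : quadField D) : ℂ))
      hγδ
    rw [← hφ, ← hφ]
    exact h1
  · obtain ⟨p, q, r, s, h1, h2, h3⟩ := h.exists_matrix (u : 𝓞 (quadField D))
    rw [h.normSq_unit] at h3
    have hdet : p * s - q * r = 1 := by exact_mod_cast h3
    let γ : SL(2, ℤ) := ⟨!![p, q; r, s], by rw [Matrix.det_fin_two_of]; exact hdet⟩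
    have hr : (r : ℂ) * ρ + s = (((u : 𝓞 (quadField D)) : quadField D) : ℂ) := by
      rw [hρ]
      field_simp
      linear_combination -h2
    have hγ : γ ∈ MulAction.stabilizer SL(2, ℤ) ρ := by
      rw [MulAction.mem_stabilizer_iff]
      apply UpperHalfPlane.ext
      rw [coe_smul_eq_div, div_eq_iff (denom_sl_ne_zero γ ρ)]
      change (p : ℂ) * ρ + q = ρ * ((r : ℂ) * ρ + s)
      rw [hr, hρ]
      field_simp
      linear_combination -h1
    refine ⟨⟨γ, hγ⟩, ?_⟩
    apply Units.ext
    apply RingOfIntegers.ext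
    apply Subtype.val_injective
    exact (hφ _).trans hr

end

/-- A representative of the Heegner point of an ideal class, with an ideal that gives rise to it. -/
theorem exists_isOrientedBasis {D : ℤ} (hD : IsNegFundamentalDiscriminant D)
    (C : ClassGroup (𝓞 (quadField D))) :
    ∃ (𝔞 : (FractionalIdeal (𝓞 (quadField D))⁰ (quadField D))ˣ) (a b : quadField D) (ρ : ℍ),
      ClassGroup.mk (quadField D) 𝔞 = C ∧ IsOrientedBasis D 𝔞 a b ∧
      (ρ : ℂ) = (b : ℂ) / (a : ℂ) ∧ heegnerPoint D hD C = toModularCurve ρ :=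
  (heegnerPoint_eq_iff hD C _).1 rfl

theorem exists_isPsi (D : ℤ) (hD : IsNegFundamentalDiscriminant D) :
    ∃ (k : ℤ) (f : ModularForm 𝒮ℒ k), IsPsi D hD f := by
  refine exists_hasDivisor_sum _ _ fun C _ ↦ ?_
  obtain ⟨𝔞, a, b, ρ, -, hab, hρ, hP⟩ := exists_isOrientedBasis hD C
  rw [hP, ← hab.card_stabilizer hρ]
  exact exists_hasDivisor_single ρ

theorem degree_heegnerDivisor (D : ℤ) (hD : IsNegFundamentalDiscriminant D) :
    (heegnerDivisor D hD).degree = 2 * classNumber (quadField D) / numUnits D := by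
  have h : ∀ s : Finset (ClassGroup (𝓞 (quadField D))), Divisor.degree (∑ C ∈ s,
      Finsupp.single (heegnerPoint D hD C) (2 / (numUnits D : ℚ))) = s.card * (2 / numUnits D) := by
    classical
    intro s
    induction s using Finset.induction_on with
    | empty => simp [Divisor.degree]
    | insert C s hC ih =>
      rw [Finset.sum_insert hC, Divisor.degree, Finsupp.sum_add_index' (fun _ ↦ rfl)
        (fun _ _ _ ↦ rfl), ← Divisor.degree, ← Divisor.degree, ih, Divisor.degree_single,
        Finset.card_insert_of_notMem hC]
      push_cast
      ring
  rw [heegnerDivisor, h, classNumber, Finset.card_univ]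
  ring

theorem existsUnique_isPsi (D : ℤ) (hD : IsNegFundamentalDiscriminant D) :
    ∃! F : (Σ k : ℤ, ModularForm 𝒮ℒ k), IsPsi D hD F.2 := by
  obtain ⟨k, f, hf⟩ := exists_isPsi D hD
  refine ⟨⟨k, f⟩, hf, ?_⟩
  rintro ⟨l, g⟩ hg
  have h1 := hf.1.weight_eq hf.2
  have h2 := HasDivisor.weight_eq (f := g) hg.1 hg.2
  obtain rfl : l = k := by
    have : (l : ℚ) = k := h2.trans h1.symm
    exact_mod_cast this
  rw [HasDivisor.unique (f := g) (g := f) hg.1 hf.1 hg.2 hf.2]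

/-! ### The ring of integers of an imaginary quadratic field -/

theorem sqrtDisc_mem (D : ℤ) : sqrtDisc D ∈ quadField D :=
  IntermediateField.subset_adjoin ℚ _ rfl

theorem exists_rat_of_mem_quadField {D : ℤ} (hD : D < 0) {x : ℂ} (hx : x ∈ quadField D) :
    ∃ u v : ℚ, x = u + v * sqrtDisc D := by
  have hint : IsIntegral ℚ (sqrtDisc D) := (isIntegral_sqrtDisc D).tower_top
  rw [quadField, ← IntermediateField.mem_toSubalgebra,
    IntermediateField.adjoin_simple_toSubalgebra_of_isAlgebraic hint.isAlgebraic] at hx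
  induction hx using Algebra.adjoin_induction with
  | mem x hx => exact ⟨0, 1, by simp [mem_singleton_iff.1 hx]⟩
  | algebraMap r => exact ⟨r, 0, by simp⟩
  | add x y _ _ hx hy =>
    obtain ⟨u, v, rfl⟩ := hx
    obtain ⟨u', v', rfl⟩ := hy
    exact ⟨u + u', v + v', by push_cast; ring⟩
  | mul x y _ _ hx hy =>
    obtain ⟨u, v, rfl⟩ := hx
    obtain ⟨u', v', rfl⟩ := hy
    refine ⟨u * u' + D * v * v', u * v' + v * u', ?_⟩
    push_cast
    linear_combination (v * v' : ℂ) * sqrtDisc_sq hD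

theorem conj_sqrtDisc (D : ℤ) : conj (sqrtDisc D) = -sqrtDisc D := by
  simp [sqrtDisc]

theorem exists_int_of_isIntegral {r : ℚ} (h : IsIntegral ℤ (r : ℂ)) : ∃ n : ℤ, r = n := by
  have h' : IsIntegral ℤ (algebraMap ℚ ℂ r) := h
  rw [isIntegral_algebraMap_iff (algebraMap ℚ ℂ).injective] at h'
  obtain ⟨n, hn⟩ := IsIntegrallyClosed.isIntegral_iff.1 h'
  exact ⟨n, hn.symm⟩

/-- A squarefree integer cannot cancel the square of a denominator. -/
theorem exists_int_of_squarefree_mul_sq {D N : ℤ} (hD : Squarefree D) {s : ℚ}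
    (h : (D : ℚ) * s ^ 2 = N) : ∃ n : ℤ, s = n := by
  have hD0 : (D : ℚ) ≠ 0 := by exact_mod_cast hD.ne_zero
  have h1 : ((D : ℚ) * s) ^ 2 = ((D * N : ℤ) : ℚ) := by
    push_cast
    linear_combination (D : ℚ) * h
  obtain ⟨j, hj⟩ : ∃ j : ℤ, algebraMap ℤ ℚ j = (D : ℚ) * s := by
    refine IsIntegrallyClosed.isIntegral_iff.1 (IsIntegral.of_pow (n := 2) two_pos ?_)
    rw [h1]
    exact isIntegral_algebraMap (R := ℤ) (A := ℚ) (x := D * N)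
  have hj' : (j : ℚ) = D * s := hj
  rw [← hj'] at h1
  have h2 : j ^ 2 = D * N := by exact_mod_cast h1
  obtain ⟨n, hn⟩ := (hD.dvd_pow_iff_dvd two_ne_zero).1 ⟨N, h2⟩
  refine ⟨n, mul_left_cancel₀ hD0 ?_⟩
  rw [← hj', hn]
  push_cast
  rfl

/-- The arithmetic of fundamental discriminants behind the description of the ring of integers. -/
theorem IsNegFundamentalDiscriminant.exists_int {D : ℤ} (hD : IsNegFundamentalDiscriminant D)
    {t n : ℤ} {s : ℚ} (h : (D : ℚ) * s ^ 2 = t ^ 2 - 4 * n) :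
    ∃ j m : ℤ, s = j ∧ t = 2 * m + j * D := by
  have h' : ((D : ℤ) : ℚ) * s ^ 2 = ((t ^ 2 - 4 * n : ℤ) : ℚ) := by push_cast; exact h
  rcases hD.2 with ⟨h4, hsq⟩ | ⟨m, rfl, hm, hsq⟩
  · obtain ⟨j, rfl⟩ := exists_int_of_squarefree_mul_sq hsq h'
    have h2 : D * j ^ 2 = t ^ 2 - 4 * n := by exact_mod_cast h
    have h3 : (t - j * D) % 2 = 0 := by
      obtain ⟨d, rfl⟩ : ∃ d, D = 4 * d + 1 := ⟨D / 4, by omega⟩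
      have h5 : Even (t ^ 2 - j ^ 2) := ⟨2 * (d * j ^ 2 + n), by linear_combination -h2⟩
      rw [Int.even_sub, Int.even_pow' two_ne_zero, Int.even_pow' two_ne_zero] at h5
      have h6 : Even (t - j * (4 * d + 1)) := by
        rw [Int.even_sub, h5, Int.even_mul]
        have : ¬ Even (4 * d + 1) := by
          rw [Int.even_iff]
          omega
        tauto
      exact Int.even_iff.1 h6
    exact ⟨j, (t - j * D) / 2, rfl, by omega⟩
  · have h1 : (m : ℚ) * (2 * s) ^ 2 = ((t ^ 2 - 4 * n : ℤ) : ℚ) := by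
      rw [← h']
      push_cast
      ring
    obtain ⟨j, hj⟩ := exists_int_of_squarefree_mul_sq hsq h1
    rw [hj] at h1
    have h2 : m * j ^ 2 = t ^ 2 - 4 * n := by exact_mod_cast h1
    have h3 : t % 2 = 0 ∧ j % 2 = 0 := by
      have hsq4 : ∀ x : ℤ, ∃ y : ℤ, x ^ 2 = 4 * y + x % 2 := fun x ↦ by
        obtain ⟨c, hc | hc⟩ := Int.even_or_odd' x
        · exact ⟨c ^ 2, by rw [hc, Int.mul_emod_right]; ring⟩
        · exact ⟨c ^ 2 + c, by rw [hc, show (2 * c + 1) % 2 = 1 by omega]; ring⟩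
      obtain ⟨y, hy⟩ := hsq4 t
      obtain ⟨z, hz⟩ := hsq4 j
      rw [hy, hz, mul_add] at h2
      have h4 : m * (4 * z) = 4 * (m * z) := by ring
      rw [h4] at h2
      rcases Int.emod_two_eq_zero_or_one j with hj | hj <;> rw [hj] at h2 <;> omega
    obtain ⟨i, hi⟩ : ∃ i, j = 2 * i := ⟨j / 2, by omega⟩
    refine ⟨i, t / 2 - 2 * i * m, ?_, ?_⟩
    · rw [hi] at hj
      push_cast at hj
      linarith
    · have : t = 2 * (t / 2) := by omega
      linear_combination this

/-- The generator `ω = (D + √D) / 2` of the ring of integers. -/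
noncomputable def quadGenerator (D : ℤ) : ℂ := (D + sqrtDisc D) / 2

theorem quadGenerator_mem (D : ℤ) : quadGenerator D ∈ quadField D :=
  div_mem (add_mem (intCast_mem _ D) (sqrtDisc_mem D)) (ofNat_mem _ 2)

/-- The constant coefficient `(D² - D) / 4` of the minimal polynomial of `ω`. -/
theorem IsNegFundamentalDiscriminant.exists_four_mul {D : ℤ}
    (hD : IsNegFundamentalDiscriminant D) : ∃ c : ℤ, 4 * c = D ^ 2 - D := by
  rcases hD.mod_four with h | h
  · obtain ⟨d, rfl⟩ : ∃ d, D = 4 * d := ⟨D / 4, by omega⟩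
    exact ⟨4 * d ^ 2 - d, by ring⟩
  · obtain ⟨d, rfl⟩ : ∃ d, D = 4 * d + 1 := ⟨D / 4, by omega⟩
    exact ⟨4 * d ^ 2 + d, by ring⟩

theorem quadGenerator_sq {D c : ℤ} (hD : D < 0) (hc : 4 * c = D ^ 2 - D) :
    quadGenerator D ^ 2 - D * quadGenerator D + c = 0 := by
  have h1 := sqrtDisc_sq hD
  have h2 : (4 : ℂ) * c = D ^ 2 - D := by exact_mod_cast hc
  rw [quadGenerator]
  linear_combination h1 / 4 + h2 / 4

theorem isIntegral_quadGenerator {D : ℤ} (hD : IsNegFundamentalDiscriminant D) :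
    IsIntegral ℤ (quadGenerator D) := by
  obtain ⟨c, hc⟩ := hD.exists_four_mul
  refine ⟨Polynomial.X ^ 2 - Polynomial.C D * Polynomial.X + Polynomial.C c, by monicity!, ?_⟩
  simp only [Polynomial.eval₂_add, Polynomial.eval₂_sub, Polynomial.eval₂_mul,
    Polynomial.eval₂_pow, Polynomial.eval₂_X, Polynomial.eval₂_C]
  exact quadGenerator_sq hD.1 hc

/-- The ring of integers is `ℤ[ω]`: the trace and the norm of an integral element are integers. -/
theorem exists_eq_add_mul_quadGenerator {D : ℤ} (hD : IsNegFundamentalDiscriminant D) {x : ℂ}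
    (hx : x ∈ quadField D) (hint : IsIntegral ℤ x) :
    ∃ m j : ℤ, x = m + j * quadGenerator D := by
  obtain ⟨u, v, rfl⟩ := exists_rat_of_mem_quadField hD.1 hx
  have hconj : conj ((u : ℂ) + v * sqrtDisc D) = u - v * sqrtDisc D := by
    rw [map_add, map_mul, conj_sqrtDisc]
    simp [sub_eq_add_neg]
  have hint' : IsIntegral ℤ ((u : ℂ) - v * sqrtDisc D) := by
    rw [← hconj]
    exact hint.map (Complex.conjAe.toAlgHom.restrictScalars ℤ)
  obtain ⟨t, ht⟩ := exists_int_of_isIntegral (r := 2 * u) (by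
    have h : ((2 * u : ℚ) : ℂ) = (u + v * sqrtDisc D) + (u - v * sqrtDisc D) := by
      push_cast
      ring
    rw [h]
    exact hint.add hint')
  obtain ⟨n, hn⟩ := exists_int_of_isIntegral (r := u ^ 2 - D * v ^ 2) (by
    have h : ((u ^ 2 - D * v ^ 2 : ℚ) : ℂ) =
        (u + v * sqrtDisc D) * (u - v * sqrtDisc D) := by
      push_cast
      linear_combination (v : ℂ) ^ 2 * sqrtDisc_sq hD.1
    rw [h]
    exact hint.mul hint')
  obtain ⟨j, m, hj, hm⟩ := hD.exists_int (t := t) (n := n) (s := 2 * v) (by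
    rw [← ht, ← hn]
    ring)
  refine ⟨m, j, ?_⟩
  have h1 : (u : ℂ) = (m : ℂ) + j * D / 2 := by
    have h2 : (2 : ℂ) * u = t := by exact_mod_cast ht
    have h3 : (t : ℂ) = 2 * m + j * D := by exact_mod_cast hm
    linear_combination (h2 + h3) / 2
  have h2 : (v : ℂ) = j / 2 := by
    have h2 : (2 : ℂ) * v = j := by exact_mod_cast hj
    linear_combination h2 / 2
  rw [h1, h2, quadGenerator]
  ring

/-- The algebraic integer `ω = (D + √D) / 2`. -/
noncomputable def integerGenerator {D : ℤ} (hD : IsNegFundamentalDiscriminant D) :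
    𝓞 (quadField D) :=
  ⟨⟨quadGenerator D, quadGenerator_mem D⟩,
    (isIntegral_algHom_iff ((quadField D).val.restrictScalars ℤ) Subtype.val_injective).1
      (isIntegral_quadGenerator hD)⟩

theorem coe_integerGenerator {D : ℤ} (hD : IsNegFundamentalDiscriminant D) :
    ((integerGenerator hD : quadField D) : ℂ) = quadGenerator D := rfl

theorem coe_coe_injective {D : ℤ} :
    Function.Injective (fun x : 𝓞 (quadField D) ↦ ((x : quadField D) : ℂ)) :=
  Subtype.val_injective.comp RingOfIntegers.coe_injective

theorem exists_eq_add_mul_integerGenerator {D : ℤ} (hD : IsNegFundamentalDiscriminant D)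
    (x : 𝓞 (quadField D)) : ∃ m j : ℤ, x = m + j * integerGenerator hD := by
  have hx : IsIntegral ℤ ((x : quadField D) : ℂ) :=
    (isIntegral_algHom_iff ((quadField D).val.restrictScalars ℤ) Subtype.val_injective).2
      (RingOfIntegers.isIntegral_coe x)
  obtain ⟨m, j, h⟩ := exists_eq_add_mul_quadGenerator hD (x : quadField D).2 hx
  refine ⟨m, j, coe_coe_injective ?_⟩
  simp only [map_add, map_mul, map_intCast]
  exact h

theorem integerGenerator_sq {D c : ℤ} (hD : IsNegFundamentalDiscriminant D)
    (hc : 4 * c = D ^ 2 - D) :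
    integerGenerator hD ^ 2 - D * integerGenerator hD + c = 0 := by
  apply coe_coe_injective
  simp only [map_add, map_mul, map_intCast, map_sub, map_pow, map_zero]
  exact quadGenerator_sq hD.1 hc

/-- The elements `1, ω` form an oriented basis of the ring of integers. -/
theorem isOrientedBasis_one {D : ℤ} (hD : IsNegFundamentalDiscriminant D) :
    IsOrientedBasis D 1 1 (integerGenerator hD : quadField D) := by
  have him : 0 < (quadGenerator D).im := by
    have := sqrtDisc_im_pos hD.1
    rw [quadGenerator, Complex.div_ofNat_im]
    simpa using this
  refine ⟨?_, fun x ↦ ?_, ?_⟩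
  · rw [LinearIndependent.pair_iff]
    intro s t hst
    have h1 := congrArg (Subtype.val : quadField D → ℂ) hst
    have h2 : (s : ℂ) + t * quadGenerator D = 0 := by
      rw [← coe_integerGenerator hD]
      simpa using h1
    have h3 := congrArg Complex.im h2
    have ht : t = 0 := by
      simp at h3
      exact h3.resolve_right him.ne'
    rw [ht] at h2
    exact ⟨by simpa using h2, ht⟩
  · rw [Units.val_one, FractionalIdeal.mem_one_iff, Submodule.mem_span_pair]
    constructor
    · rintro ⟨y, rfl⟩
      obtain ⟨m, j, h⟩ := exists_eq_add_mul_integerGenerator hD y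
      refine ⟨m, j, ?_⟩
      rw [h]
      simp
    · rintro ⟨m, j, rfl⟩
      refine ⟨m + j * integerGenerator hD, ?_⟩
      simp
  · rw [coe_integerGenerator]
    simpa using him

/-! ### Ideal norms and the quadratic forms of Heegner points -/

/-- The integral basis `1, ω`. -/
noncomputable def integerBasis {D : ℤ} (hD : IsNegFundamentalDiscriminant D) :
    Module.Basis (Fin 2) ℤ (𝓞 (quadField D)) :=
  Module.Basis.mk (v := ![1, integerGenerator hD])
    (by
      have h := (isOrientedBasis_one hD).1
      rw [LinearIndependent.pair_iff] at h ⊢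
      intro s t hst
      refine h s t ?_
      have := congrArg (algebraMap (𝓞 (quadField D)) (quadField D)) hst
      simpa using this)
    (by
      rintro x -
      obtain ⟨m, j, rfl⟩ := exists_eq_add_mul_integerGenerator hD x
      rw [Matrix.range_cons, Matrix.range_cons, Matrix.range_empty, union_empty, singleton_union,
        Submodule.mem_span_pair]
      exact ⟨m, j, by simp⟩)

section

variable {D : ℤ} {𝔞 : (FractionalIdeal (𝓞 (quadField D))⁰ (quadField D))ˣ} {a b : quadField D}

/-- The `ℤ`-basis of a fractional ideal given by an oriented basis. -/
noncomputable def IsOrientedBasis.basis (h : IsOrientedBasis D 𝔞 a b) :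
    Module.Basis (Fin 2) ℤ (𝔞 : FractionalIdeal (𝓞 (quadField D))⁰ (quadField D)) :=
  Module.Basis.mk (v := ![⟨a, (h.2.1 a).2 (Submodule.subset_span (by simp))⟩,
      ⟨b, (h.2.1 b).2 (Submodule.subset_span (by simp))⟩])
    (by
      have h1 := h.1
      rw [LinearIndependent.pair_iff] at h1 ⊢
      intro s t hst
      refine h1 s t ?_
      exact congrArg Subtype.val hst)
    (by
      rintro ⟨x, hx⟩ -
      obtain ⟨m, j, hmj⟩ := Submodule.mem_span_pair.1 ((h.2.1 x).1 hx)
      rw [Matrix.range_cons, Matrix.range_cons, Matrix.range_empty, union_empty, singleton_union,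
        Submodule.mem_span_pair]
      exact ⟨m, j, Subtype.ext hmj⟩)

theorem quadGenerator_im : (quadGenerator D).im = √(-(D : ℝ)) / 2 := by
  rw [quadGenerator, Complex.div_ofNat_im, sqrtDisc]
  simp

/-- The covolume of the lattice of a fractional ideal is determined by its norm. -/
theorem IsOrientedBasis.im_mul_conj (hD : IsNegFundamentalDiscriminant D)
    (h : IsOrientedBasis D 𝔞 a b) :
    ((b : ℂ) * conj (a : ℂ)).im =
      (FractionalIdeal.absNorm (𝔞 : FractionalIdeal (𝓞 (quadField D))⁰ (quadField D)) : ℝ) *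
        (√(-(D : ℝ)) / 2) := by
  set B := (integerBasis hD).localizationLocalization ℚ ℤ⁰ (quadField D) with hB
  have h0 : B 0 = 1 := by
    rw [hB, Module.Basis.localizationLocalization_apply]
    simp [integerBasis]
  have h1 : B 1 = integerGenerator hD := by
    rw [hB, Module.Basis.localizationLocalization_apply]
    simp [integerBasis]
  have hx : ∀ x : quadField D, (x : ℂ) = (B.repr x 0 : ℂ) + (B.repr x 1 : ℂ) * quadGenerator D := by
    intro x
    have h2 := congrArg (Subtype.val : quadField D → ℂ) (B.sum_repr x)
    rw [Fin.sum_univ_two, h0, h1] at h2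
    rw [← h2]
    simp [Algebra.smul_def, coe_integerGenerator]
  have hdet := FractionalIdeal.abs_det_basis_change (integerBasis hD)
    (𝔞 : FractionalIdeal (𝓞 (quadField D))⁰ (quadField D)) h.basis
  rw [← hB, Module.Basis.det_apply, Matrix.det_fin_two] at hdet
  simp only [Module.Basis.toMatrix_apply, Function.comp_apply] at hdet
  have e0 : ((h.basis 0 : _) : quadField D) = a := by simp [IsOrientedBasis.basis]
  have e1 : ((h.basis 1 : _) : quadField D) = b := by simp [IsOrientedBasis.basis]
  rw [e0, e1] at hdet
  have him : ((b : ℂ) * conj (a : ℂ)).im =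
      ((B.repr a 0 * B.repr b 1 - B.repr b 0 * B.repr a 1 : ℚ) : ℝ) * (√(-(D : ℝ)) / 2) := by
    rw [hx a, hx b, ← quadGenerator_im]
    simp
    ring
  have hpos := h.2.2
  have hs : 0 < √(-(D : ℝ)) / 2 := by
    rw [← quadGenerator_im]
    simpa [coe_integerGenerator] using (isOrientedBasis_one hD).2.2
  rw [him] at hpos ⊢
  rw [← hdet, Rat.cast_abs, abs_of_pos (pos_of_mul_pos_left hpos hs.le)]

/-- Multiplication by `x` scales a lattice together with its oriented basis, so the quotient `b / a`
depends only on the ideal class. -/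
theorem IsOrientedBasis.span_mul {x : (quadField D)ˣ} (h : IsOrientedBasis D 𝔞 a b) :
    IsOrientedBasis D (toPrincipalIdeal (𝓞 (quadField D)) _ x * 𝔞) (x * a) (x * b) := by
  refine ⟨?_, fun y ↦ ?_, ?_⟩
  · have h1 := h.1
    rw [LinearIndependent.pair_iff] at h1 ⊢
    intro s t hst
    refine h1 s t (mul_left_cancel₀ x.ne_zero ?_)
    rw [mul_zero, ← hst, mul_add, mul_smul_comm, mul_smul_comm]
  · rw [Units.val_mul, coe_toPrincipalIdeal, FractionalIdeal.mem_singleton_mul,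
      Submodule.mem_span_pair]
    constructor
    · rintro ⟨z, hz, rfl⟩
      obtain ⟨m, j, rfl⟩ := Submodule.mem_span_pair.1 ((h.2.1 z).1 hz)
      exact ⟨m, j, by rw [mul_add, mul_smul_comm, mul_smul_comm]⟩
    · rintro ⟨m, j, rfl⟩
      exact ⟨m • a + j • b, (h.2.1 _).2 (Submodule.mem_span_pair.2 ⟨m, j, rfl⟩),
        by rw [mul_add, mul_smul_comm, mul_smul_comm]⟩
  · have h1 : ((x * b : quadField D) : ℂ) * conj ((x * a : quadField D) : ℂ) =
        (Complex.normSq ((x : quadField D) : ℂ) : ℝ) * ((b : ℂ) * conj (a : ℂ)) := by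
      rw [Complex.normSq_eq_conj_mul_self]
      push_cast
      rw [map_mul]
      ring
    rw [h1, Complex.im_ofReal_mul]
    refine mul_pos (Complex.normSq_pos.2 ?_) h.2.2
    have := x.ne_zero
    exact_mod_cast this

theorem sqrt_neg_pos (hD : D < 0) : 0 < √(-(D : ℝ)) := by
  have : (D : ℝ) < 0 := by exact_mod_cast hD
  exact Real.sqrt_pos.2 (by linarith)

theorem normSq_eq_absNorm (hD : IsNegFundamentalDiscriminant D) (x : (quadField D)ˣ) :
    Complex.normSq ((x : quadField D) : ℂ) = (FractionalIdeal.absNorm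
      (FractionalIdeal.spanSingleton (𝓞 (quadField D))⁰ (x : quadField D)) : ℝ) := by
  have h := ((isOrientedBasis_one hD).span_mul (x := x)).im_mul_conj hD
  rw [mul_one, mul_one, coe_toPrincipalIdeal] at h
  have h1 : ((x * integerGenerator hD : quadField D) : ℂ) * conj ((x : quadField D) : ℂ) =
      (Complex.normSq ((x : quadField D) : ℂ) : ℝ) * quadGenerator D := by
    rw [Complex.normSq_eq_conj_mul_self]
    push_cast
    rw [coe_integerGenerator]
    ring
  rw [h1, Complex.im_ofReal_mul, quadGenerator_im] at h
  have hs : √(-(D : ℝ)) / 2 ≠ 0 := by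
    have := sqrt_neg_pos hD.1
    positivity
  exact mul_right_cancel₀ hs h

/-- The quadratic form of a Heegner point in terms of ideal norms. -/
theorem IsOrientedBasis.latticeForm_eq (hD : IsNegFundamentalDiscriminant D)
    (h : IsOrientedBasis D 𝔞 a b) {ρ : ℍ} (hρ : (ρ : ℂ) = (b : ℂ) / (a : ℂ)) (v : Fin 2 → ℤ)
    {x : (quadField D)ˣ} (hx : (x : quadField D) = v 0 * b + v 1 * a) {I : Ideal (𝓞 (quadField D))}
    (hI : (I : FractionalIdeal (𝓞 (quadField D))⁰ (quadField D)) *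
        (𝔞 : FractionalIdeal (𝓞 (quadField D))⁰ (quadField D)) =
      FractionalIdeal.spanSingleton _ (x : quadField D)) :
    latticeForm ρ v = 2 * Ideal.absNorm I / √(-(D : ℝ)) := by
  have ha := h.ne_zero
  have hN : 0 < Complex.normSq (a : ℂ) := Complex.normSq_pos.2 ha
  have h1 : ((v 0 : ℂ) * ρ + v 1) * a = ((x : quadField D) : ℂ) := by
    rw [hx, hρ]
    push_cast
    field_simp
  have h2 := congrArg Complex.normSq h1
  rw [map_mul, normSq_eq_absNorm hD, ← hI, map_mul, FractionalIdeal.coeIdeal_absNorm] at h2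
  have h3 : ρ.im * Complex.normSq (a : ℂ) = ((b : ℂ) * conj (a : ℂ)).im := by
    rw [← coe_im, hρ, im_div_eq]
    field_simp
  rw [h.im_mul_conj hD] at h3
  have hs := sqrt_neg_pos hD.1
  have him := ρ.im_pos
  rw [latticeForm, div_eq_div_iff him.ne' hs.ne']
  refine mul_right_cancel₀ hN.ne' ?_
  push_cast at h2
  linear_combination √(-(D : ℝ)) * h2 - 2 * (Ideal.absNorm I : ℝ) * h3

end

/-! ### The theta series of the Heegner points -/

theorem exists_toPrincipalIdeal_eq {R K : Type*} [CommRing R] [IsDomain R] [Field K] [Algebra R K]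
    [IsFractionRing R K] {𝔠 : (FractionalIdeal R⁰ K)ˣ} (h : ClassGroup.mk K 𝔠 = 1) :
    ∃ x : Kˣ, toPrincipalIdeal R K x = 𝔠 := by
  rw [← (ClassGroup.equiv K).injective.eq_iff] at h
  simpa only [ClassGroup.equiv_mk, FractionalIdeal.canonicalEquiv_self,
    RingEquiv.coe_mulEquiv_refl, QuotientGroup.mk'_apply, map_one, QuotientGroup.eq_one_iff,
    MonoidHom.mem_range, Units.ext_iff, Units.coe_mapEquiv, MulEquiv.refl_apply] using h

theorem classGroupMk_toPrincipalIdeal {R K : Type*} [CommRing R] [IsDomain R] [Field K]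
    [Algebra R K] [IsFractionRing R K] (x : Kˣ) : ClassGroup.mk K (toPrincipalIdeal R K x) = 1 := by
  rw [← (ClassGroup.equiv K).injective.eq_iff]
  simp only [ClassGroup.equiv_mk, FractionalIdeal.canonicalEquiv_self,
    RingEquiv.coe_mulEquiv_refl, QuotientGroup.mk'_apply, map_one, QuotientGroup.eq_one_iff,
    MonoidHom.mem_range, Units.ext_iff]
  exact ⟨x, rfl⟩

theorem exists_unit_mul_eq {R K : Type*} [CommRing R] [IsDomain R] [Field K]
    [Algebra R K] [IsFractionRing R K] {x y : Kˣ}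
    (h : toPrincipalIdeal R K x = toPrincipalIdeal R K y) :
    ∃ u : Rˣ, (x : K) = algebraMap R K u * y := by
  have h1 := congrArg (fun 𝔠 : (FractionalIdeal R⁰ K)ˣ ↦ ((𝔠 : FractionalIdeal R⁰ K) : Submodule R K)) h
  simp only [coe_toPrincipalIdeal, FractionalIdeal.coe_spanSingleton] at h1
  obtain ⟨u, hu⟩ := Submodule.span_singleton_eq_span_singleton.1 h1.symm
  exact ⟨u, by rw [← hu, Units.smul_def, Algebra.smul_def]⟩

theorem toPrincipalIdeal_unit_mul {R K : Type*} [CommRing R] [IsDomain R] [Field K]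
    [Algebra R K] [IsFractionRing R K] {x y : Kˣ} {u : Rˣ} (h : (x : K) = algebraMap R K u * y) :
    toPrincipalIdeal R K x = toPrincipalIdeal R K y := by
  apply Units.ext
  apply FractionalIdeal.coeToSubmodule_injective
  simp only [coe_toPrincipalIdeal, FractionalIdeal.coe_spanSingleton]
  exact (Submodule.span_singleton_eq_span_singleton.2
    ⟨u, by rw [h, Units.smul_def, Algebra.smul_def]⟩).symm

section

variable {D : ℤ} {𝔞 : ClassGroup (𝓞 (quadField D)) →
  (FractionalIdeal (𝓞 (quadField D))⁰ (quadField D))ˣ}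
  {a b : ClassGroup (𝓞 (quadField D)) → quadField D}

theorem IsOrientedBasis.combination_injective {𝔞 : (FractionalIdeal (𝓞 (quadField D))⁰ (quadField D))ˣ}
    {a b : quadField D} (h : IsOrientedBasis D 𝔞 a b) {v v' : Fin 2 → ℤ}
    (hv : (v 0 : quadField D) * b + v 1 * a = v' 0 * b + v' 1 * a) : v = v' := by
  have h1 := h.1
  rw [LinearIndependent.pair_iff] at h1
  have h2 := h1 (v 1 - v' 1) (v 0 - v' 0) (by
    rw [zsmul_eq_mul, zsmul_eq_mul]
    push_cast
    linear_combination hv)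
  ext i
  fin_cases i
  · exact sub_eq_zero.1 h2.2
  · exact sub_eq_zero.1 h2.1

/-- The ideals `x 𝔞⁻¹`, for `x` a nonzero element of a representative `𝔞` of one of the ideal
classes, exhaust the nonzero integral ideals, and each arises from exactly one unit orbit. -/
theorem exists_equiv_ideal_units (h𝔞 : ∀ C, ClassGroup.mk (quadField D) (𝔞 C) = C)
    (hab : ∀ C, IsOrientedBasis D (𝔞 C) (a C) (b C)) :
    ∃ e : (Ideal (𝓞 (quadField D)))⁰ × (𝓞 (quadField D))ˣ ≃
        ClassGroup (𝓞 (quadField D)) × {v : Fin 2 → ℤ // v ≠ 0},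
      ∀ p, ∃ x : (quadField D)ˣ,
        (x : quadField D) = (e p).2.1 0 * b (e p).1 + (e p).2.1 1 * a (e p).1 ∧
        ((p.1 : Ideal (𝓞 (quadField D))) : FractionalIdeal (𝓞 (quadField D))⁰ (quadField D)) *
          (𝔞 (e p).1 : FractionalIdeal (𝓞 (quadField D))⁰ (quadField D)) =
          FractionalIdeal.spanSingleton _ (x : quadField D) := by
  have hgen : ∀ I : (Ideal (𝓞 (quadField D)))⁰, ∃ g : (quadField D)ˣ,
      toPrincipalIdeal (𝓞 (quadField D)) _ g =
        FractionalIdeal.mk0 (quadField D) I * 𝔞 (ClassGroup.mk0 I)⁻¹ := fun I ↦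
    exists_toPrincipalIdeal_eq (by rw [map_mul, h𝔞, ClassGroup.mk_mk0, mul_inv_cancel])
  choose g hg using hgen
  have hcoord : ∀ p : (Ideal (𝓞 (quadField D)))⁰ × (𝓞 (quadField D))ˣ, ∃ v : Fin 2 → ℤ, v ≠ 0 ∧
      (v 0 : quadField D) * b (ClassGroup.mk0 p.1)⁻¹ + v 1 * a (ClassGroup.mk0 p.1)⁻¹ =
        ((p.2 : 𝓞 (quadField D)) : quadField D) * g p.1 := by
    intro p
    have h1 : ((p.2 : 𝓞 (quadField D)) : quadField D) * g p.1 ∈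
        (𝔞 (ClassGroup.mk0 p.1)⁻¹ : FractionalIdeal (𝓞 (quadField D))⁰ (quadField D)) := by
      have h2 : (g p.1 : quadField D) ∈
          ((FractionalIdeal.mk0 (quadField D) p.1 * 𝔞 (ClassGroup.mk0 p.1)⁻¹ : _ˣ) :
            FractionalIdeal (𝓞 (quadField D))⁰ (quadField D)) := by
        rw [← hg, coe_toPrincipalIdeal]
        exact FractionalIdeal.mem_spanSingleton_self _ _
      have h3 : ((FractionalIdeal.mk0 (quadField D) p.1 * 𝔞 (ClassGroup.mk0 p.1)⁻¹ : _ˣ) :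
            FractionalIdeal (𝓞 (quadField D))⁰ (quadField D)) ≤ 𝔞 (ClassGroup.mk0 p.1)⁻¹ := by
        rw [Units.val_mul, FractionalIdeal.coe_mk0]
        exact (mul_le_mul_left FractionalIdeal.coeIdeal_le_one _).trans_eq (one_mul _)
      exact Submodule.smul_mem _ (p.2 : 𝓞 (quadField D)) (h3 h2)
    obtain ⟨n, m, hmn⟩ := Submodule.mem_span_pair.1 (((hab _).2.1 _).1 h1)
    rw [zsmul_eq_mul, zsmul_eq_mul] at hmn
    refine ⟨![m, n], ?_, ?_⟩
    · intro h0
      have hm : m = 0 := congrFun h0 0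
      have hn : n = 0 := congrFun h0 1
      rw [hm, hn] at hmn
      have : ((p.2 : 𝓞 (quadField D)) : quadField D) * g p.1 ≠ 0 :=
        mul_ne_zero (by exact_mod_cast p.2.ne_zero) (g p.1).ne_zero
      exact this (by rw [← hmn]; simp)
    · rw [← hmn]
      simp
      ring
  choose v hv0 hv using hcoord
  let F : (Ideal (𝓞 (quadField D)))⁰ × (𝓞 (quadField D))ˣ →
      ClassGroup (𝓞 (quadField D)) × {v : Fin 2 → ℤ // v ≠ 0} := fun p ↦
    ((ClassGroup.mk0 p.1)⁻¹, ⟨v p, hv0 p⟩)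
  let U : (𝓞 (quadField D))ˣ → (quadField D)ˣ :=
    Units.map (algebraMap (𝓞 (quadField D)) (quadField D) : _ →* _)
  have hspan : ∀ p : (Ideal (𝓞 (quadField D)))⁰ × (𝓞 (quadField D))ˣ,
      toPrincipalIdeal (𝓞 (quadField D)) _ (U p.2 * g p.1) =
        FractionalIdeal.mk0 (quadField D) p.1 * 𝔞 (ClassGroup.mk0 p.1)⁻¹ := fun p ↦ by
    rw [← hg]
    exact toPrincipalIdeal_unit_mul (u := p.2) (by rw [Units.val_mul]; rfl)
  have hmk0 : ∀ I J : (Ideal (𝓞 (quadField D)))⁰,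
      FractionalIdeal.mk0 (quadField D) I = FractionalIdeal.mk0 (quadField D) J → I = J := by
    intro I J h
    have := congrArg Units.val h
    rw [FractionalIdeal.coe_mk0, FractionalIdeal.coe_mk0] at this
    exact Subtype.ext (FractionalIdeal.coeIdeal_injective this)
  have hF : Function.Bijective F := by
    constructor
    · rintro p p' hpp
      have h1 : (ClassGroup.mk0 p.1)⁻¹ = (ClassGroup.mk0 p'.1)⁻¹ := congrArg Prod.fst hpp
      have h2 : v p = v p' := congrArg (fun q ↦ q.2.1) hpp
      have h3 := hv p
      rw [h2, h1, hv] at h3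
      have h4 : U p'.2 * g p'.1 = U p.2 * g p.1 := Units.ext h3
      have h5 := hspan p
      rw [← h4, hspan, h1] at h5
      have h6 := hmk0 _ _ (mul_right_cancel h5)
      rw [h6] at h3
      refine Prod.ext h6.symm (Units.ext ?_)
      exact RingOfIntegers.coe_injective (mul_right_cancel₀ (g p.1).ne_zero h3.symm)
    · rintro ⟨C, w, hw⟩
      have hx0 : (w 0 : quadField D) * b C + w 1 * a C ≠ 0 := by
        intro h0
        refine hw ((hab C).combination_injective (v' := 0) ?_)
        rw [h0]
        simp
      set x : (quadField D)ˣ := Units.mk0 _ hx0 with hx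
      have hmem : (x : quadField D) ∈
          (𝔞 C : FractionalIdeal (𝓞 (quadField D))⁰ (quadField D)) := by
        refine ((hab C).2.1 _).2 (Submodule.mem_span_pair.2 ⟨w 1, w 0, ?_⟩)
        rw [zsmul_eq_mul, zsmul_eq_mul, add_comm]
        rfl
      have hle : ((toPrincipalIdeal (𝓞 (quadField D)) _ x * (𝔞 C)⁻¹ : _ˣ) :
          FractionalIdeal (𝓞 (quadField D))⁰ (quadField D)) ≤ 1 := by
        rw [Units.val_mul, coe_toPrincipalIdeal]
        calc _ ≤ (𝔞 C : FractionalIdeal (𝓞 (quadField D))⁰ (quadField D)) *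
              (((𝔞 C)⁻¹ : _ˣ) : FractionalIdeal (𝓞 (quadField D))⁰ (quadField D)) :=
              mul_le_mul_left (FractionalIdeal.spanSingleton_le_iff_mem.2 hmem) _
          _ = 1 := Units.mul_inv _
      obtain ⟨I, hI⟩ := FractionalIdeal.le_one_iff_exists_coeIdeal.1 hle
      have hI0 : I ∈ (Ideal (𝓞 (quadField D)))⁰ := by
        rw [mem_nonZeroDivisors_iff_ne_zero]
        rintro rfl
        rw [Ideal.zero_eq_bot, FractionalIdeal.coeIdeal_bot] at hI
        exact (Units.ne_zero _) hI.symm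
      have hI' : FractionalIdeal.mk0 (quadField D) ⟨I, hI0⟩ =
          toPrincipalIdeal (𝓞 (quadField D)) _ x * (𝔞 C)⁻¹ :=
        Units.ext (by rw [FractionalIdeal.coe_mk0]; exact hI)
      have hC : (ClassGroup.mk0 ⟨I, hI0⟩)⁻¹ = C := by
        rw [← ClassGroup.mk_mk0 (quadField D), hI', map_mul, classGroupMk_toPrincipalIdeal, one_mul,
          map_inv, h𝔞, inv_inv]
      have hprin : toPrincipalIdeal (𝓞 (quadField D)) _ x =
          toPrincipalIdeal (𝓞 (quadField D)) _ (g ⟨I, hI0⟩) := by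
        rw [hg, hI', hC, inv_mul_cancel_right]
      obtain ⟨u, hu⟩ := exists_unit_mul_eq hprin
      refine ⟨(⟨I, hI0⟩, u), Prod.ext hC (Subtype.ext ?_)⟩
      refine (hab C).combination_injective ?_
      have := hv (⟨I, hI0⟩, u)
      simp only [hC] at this
      exact this.trans hu.symm
  refine ⟨Equiv.ofBijective F hF, fun p ↦ ⟨U p.2 * g p.1, (hv p).symm, ?_⟩⟩
  have := congrArg Units.val (hspan p)
  rw [Units.val_mul (FractionalIdeal.mk0 _ _), FractionalIdeal.coe_mk0, coe_toPrincipalIdeal] at this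
  exact this.symm

/-- Summed over the ideal classes, the theta series of the Heegner points count the nonzero
integral ideals by their norms. -/
theorem hasSum_latticeTheta (hD : IsNegFundamentalDiscriminant D)
    (h𝔞 : ∀ C, ClassGroup.mk (quadField D) (𝔞 C) = C)
    (hab : ∀ C, IsOrientedBasis D (𝔞 C) (a C) (b C))
    {ρ : ClassGroup (𝓞 (quadField D)) → ℍ} (hρ : ∀ C, (ρ C : ℂ) = (b C : ℂ) / (a C : ℂ))
    {t : ℝ} (ht : 0 < t) :
    HasSum (fun I : (Ideal (𝓞 (quadField D)))⁰ ↦ (numUnits D : ℝ) *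
        Real.exp (-(2 * Real.pi / √(-(D : ℝ)) * t) * Ideal.absNorm (I : Ideal (𝓞 (quadField D)))))
      (∑ C, (latticeTheta (ρ C) t - 1)) := by
  obtain ⟨e, he⟩ := exists_equiv_ideal_units h𝔞 hab
  set f : ClassGroup (𝓞 (quadField D)) × {v : Fin 2 → ℤ // v ≠ 0} → ℝ := fun q ↦
    Real.exp (-Real.pi * latticeForm (ρ q.1) q.2 * t) with hf
  have hfe : ∀ p, f (e p) = Real.exp (-(2 * Real.pi / √(-(D : ℝ)) * t) *
      Ideal.absNorm (p.1 : Ideal (𝓞 (quadField D)))) := by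
    intro p
    obtain ⟨x, hx, hI⟩ := he p
    rw [hf]
    simp only
    rw [(hab _).latticeForm_eq hD (hρ _) _ hx hI]
    congr 1
    ring
  have hfC : ∀ C, HasSum (fun v ↦ f (C, v)) (latticeTheta (ρ C) t - 1) := by
    intro C
    have h1 := summable_exp_latticeForm_ite (ρ C) ht
    have h2 := h1.hasSum
    rw [← sub_eq_of_eq_add' (latticeTheta_eq_one_add (ρ C) ht)] at h2
    have h3 := (hasSum_subtype_iff_indicator (s := {v : Fin 2 → ℤ | v ≠ 0})
      (f := fun v ↦ Real.exp (-Real.pi * latticeForm (ρ C) v * t))).2 (by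
        convert h2 using 1
        ext v
        by_cases hv : v = 0 <;> simp [hv])
    exact h3
  have hsum : Summable f := by
    rw [summable_prod_of_nonneg fun _ ↦ (Real.exp_pos _).le]
    exact ⟨fun C ↦ (hfC C).summable, Summable.of_finite⟩
  have hval : ∑' q, f q = ∑ C, (latticeTheta (ρ C) t - 1) := by
    rw [hsum.tsum_prod, tsum_fintype]
    exact Finset.sum_congr rfl fun C _ ↦ (hfC C).tsum_eq
  have hsum' : Summable (fun p ↦ f (e p)) := (e.summable_iff (f := f)).2 hsum
  have h4 := hsum'.prod
  have h5 : ∑' p, f (e p) = ∑' (I) (u), f (e (I, u)) := hsum'.tsum_prod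
  have h6 : ∀ I : (Ideal (𝓞 (quadField D)))⁰, ∑' u, f (e (I, u)) = (numUnits D : ℝ) *
      Real.exp (-(2 * Real.pi / √(-(D : ℝ)) * t) *
        Ideal.absNorm (I : Ideal (𝓞 (quadField D)))) := by
    intro I
    simp only [hfe]
    rw [tsum_const, nsmul_eq_mul, numUnits]
  simp only [h6] at h4 h5
  rw [← hval, ← e.tsum_eq f, h5]
  exact h4.hasSum

end

/-! ### Counting ideals by their norm -/

/-- The number of ideals of norm `n` in the ring of integers of `ℚ(√D)`. -/
noncomputable def idealCount (D : ℤ) (n : ℕ) : ℕ :=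
  Nat.card {I : Ideal (𝓞 (quadField D)) // Ideal.absNorm I = n}

section

variable {D : ℤ}

instance (n : ℕ) : Finite {I : Ideal (𝓞 (quadField D)) // Ideal.absNorm I = n} :=
  (Ideal.finite_setOfPred_absNorm_eq n).to_subtype

theorem ncard_absNorm_eq (n : ℕ) :
    {I : Ideal (𝓞 (quadField D)) | Ideal.absNorm I = n}.ncard = idealCount D n :=
  (Nat.card_coe_set_eq _).symm

theorem idealCount_one : idealCount D 1 = 1 := by
  rw [← ncard_absNorm_eq]
  simp only [Ideal.absNorm_eq_one_iff]
  exact ncard_singleton _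

/-- Multiplication by `J` is a bijection from the ideals of norm `n` to the multiples of `J` of norm
`N(J) n`. -/
theorem ncard_dvd {J : Ideal (𝓞 (quadField D))} (hJ : J ≠ ⊥) (n : ℕ) :
    {I : Ideal (𝓞 (quadField D)) | Ideal.absNorm I = Ideal.absNorm J * n ∧ J ∣ I}.ncard =
      idealCount D n := by
  have hJ0 : J ≠ 0 := hJ
  have hN : Ideal.absNorm J ≠ 0 := fun h ↦ hJ (Ideal.absNorm_eq_zero_iff.1 h)
  rw [← ncard_absNorm_eq, ← ncard_image_of_injective {I | Ideal.absNorm I = n} (mul_right_injective₀ hJ0)]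
  congr 1
  ext I
  constructor
  · rintro ⟨h, K, rfl⟩
    rw [map_mul] at h
    exact ⟨K, mul_left_cancel₀ hN h, rfl⟩
  · rintro ⟨K, hK, rfl⟩
    have hK' : Ideal.absNorm K = n := hK
    exact ⟨by simp only [map_mul, hK'], dvd_mul_right J K⟩

theorem ncard_dvd_eq_zero {J : Ideal (𝓞 (quadField D))} {n : ℕ} (h : ¬ Ideal.absNorm J ∣ n) :
    {I : Ideal (𝓞 (quadField D)) | Ideal.absNorm I = n ∧ J ∣ I}.ncard = 0 := by
  rw [ncard_eq_zero ((Ideal.finite_setOfPred_absNorm_eq n).subset fun I hI ↦ hI.1),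
    eq_empty_iff_forall_notMem]
  rintro I ⟨rfl, K, rfl⟩
  exact h ⟨_, map_mul Ideal.absNorm J K⟩

theorem absNorm_span_prime (hD : D < 0) (p : ℕ) :
    Ideal.absNorm (Ideal.span {(p : 𝓞 (quadField D))}) = p ^ 2 := by
  rw [Ideal.absNorm_span_natCast, RingOfIntegers.rank, finrank_quadField hD]

variable {p : ℕ}

theorem absNorm_eq_prime_or_eq_span (hD : D < 0) (hp : p.Prime) {P : Ideal (𝓞 (quadField D))}
    (hP : P.IsMaximal) (hpP : (p : 𝓞 (quadField D)) ∈ P) :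
    Ideal.absNorm P = p ∨ P = Ideal.span {(p : 𝓞 (quadField D))} := by
  obtain ⟨Q, hQ⟩ : P ∣ Ideal.span {(p : 𝓞 (quadField D))} :=
    Ideal.dvd_iff_le.2 ((Ideal.span_singleton_le_iff_mem _).2 hpP)
  have hN := absNorm_span_prime hD p
  rw [hQ, map_mul] at hN
  obtain ⟨i, hi, h⟩ := (Nat.dvd_prime_pow hp).1 (Dvd.intro _ hN)
  interval_cases i
  · exact absurd (Ideal.absNorm_eq_one_iff.1 (by simpa using h)) hP.ne_top
  · left
    simpa using h
  · right
    have h1 : Ideal.absNorm Q = 1 := by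
      rw [h] at hN
      exact Nat.eq_of_mul_eq_mul_left (pow_pos hp.pos 2) (by rw [hN, mul_one])
    rw [hQ, Ideal.absNorm_eq_one_iff.1 h1, Ideal.mul_top]

theorem isPrime_of_absNorm_eq (hp : p.Prime) {P : Ideal (𝓞 (quadField D))}
    (hP : Ideal.absNorm P = p) : Prime P := by
  have hP0 : P ≠ ⊥ := by
    rintro rfl
    exact hp.ne_zero (by rw [← hP, Ideal.absNorm_bot])
  exact Ideal.prime_of_isPrime hP0 (Ideal.isPrime_of_irreducible_absNorm (by rwa [hP]))

/-- An ideal of prime norm `p` contains `p`, whose norm is `p²`; the complementary ideal is the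
conjugate one. -/
theorem exists_mul_eq_span (hD : D < 0) (hp : p.Prime) {P : Ideal (𝓞 (quadField D))}
    (hP : Ideal.absNorm P = p) :
    ∃ Q, Ideal.absNorm Q = p ∧ Ideal.span {(p : 𝓞 (quadField D))} = P * Q := by
  obtain ⟨Q, hQ⟩ : P ∣ Ideal.span {(p : 𝓞 (quadField D))} :=
    Ideal.dvd_iff_le.2 (by rw [← hP]; exact Ideal.span_singleton_absNorm_le P)
  refine ⟨Q, ?_, hQ⟩
  have hN := absNorm_span_prime hD p
  rw [hQ, map_mul, hP, sq] at hN
  exact Nat.eq_of_mul_eq_mul_left hp.pos hN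

theorem eq_or_eq_of_mul_eq_span (hp : p.Prime) {P Q M : Ideal (𝓞 (quadField D))}
    (hP : Ideal.absNorm P = p) (hQ : Ideal.absNorm Q = p)
    (hPQ : Ideal.span {(p : 𝓞 (quadField D))} = P * Q) (hM : M.IsMaximal)
    (hpM : (p : 𝓞 (quadField D)) ∈ M) : M = P ∨ M = Q := by
  have h1 : P * Q ≤ M := by
    rw [← hPQ]
    exact (Ideal.span_singleton_le_iff_mem _).2 hpM
  have hmax : ∀ P : Ideal (𝓞 (quadField D)), Ideal.absNorm P = p → P.IsMaximal := fun P hP ↦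
    (Ideal.isPrime_of_prime (isPrime_of_absNorm_eq hp hP)).isMaximal
      (isPrime_of_absNorm_eq hp hP).ne_zero
  rcases (hM.isPrime.mul_le).1 h1 with h | h
  · exact Or.inl ((hmax P hP).eq_of_le hM.ne_top h).symm
  · exact Or.inr ((hmax Q hQ).eq_of_le hM.ne_top h).symm

/-- The local recursion for the number of ideals: the number of prime ideals of norm `p` is `0`, `1`
or `2` according as `p` is inert, ramified or split, and inclusion-exclusion over the prime ideals
above `p` gives the same recursion in all cases. -/
theorem idealCount_prime_mul (hD : D < 0) (hp : p.Prime) (m : ℕ) :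
    (idealCount D (p * m) : ℤ) = idealCount D p * idealCount D m -
      (idealCount D p - 1) * (if p ∣ m then idealCount D (m / p) else 0 : ℕ) := by
  have hdvd : ∀ I : Ideal (𝓞 (quadField D)), Ideal.absNorm I = p * m →
      ∃ M : Ideal (𝓞 (quadField D)), M.IsMaximal ∧ (p : 𝓞 (quadField D)) ∈ M ∧ M ∣ I := by
    intro I hI
    obtain ⟨M, hM, hpM, hMI⟩ := Ideal.exists_isMaximal_dvd_of_dvd_absNorm' hp I
      (by rw [hI]; exact dvd_mul_right _ _)
    refine ⟨M, hM, ?_, hMI⟩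
    have : (p : ℤ) ∈ M.under ℤ := by
      rw [hpM]
      exact Ideal.mem_span_singleton_self _
    simpa [Ideal.mem_comap] using this
  have hspan0 : Ideal.span {(p : 𝓞 (quadField D))} ≠ ⊥ := by
    rw [Ne, Ideal.span_singleton_eq_bot]
    exact_mod_cast hp.ne_zero
  have hspan : {I : Ideal (𝓞 (quadField D)) | Ideal.absNorm I = p * m ∧
      Ideal.span {(p : 𝓞 (quadField D))} ∣ I}.ncard =
        if p ∣ m then idealCount D (m / p) else 0 := by
    split_ifs with h
    · obtain ⟨l, rfl⟩ := h
      have : p * (p * l) = Ideal.absNorm (Ideal.span {(p : 𝓞 (quadField D))}) * l := by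
        rw [absNorm_span_prime hD]
        ring
      rw [this, ncard_dvd hspan0, Nat.mul_div_cancel_left _ hp.pos]
    · refine ncard_dvd_eq_zero ?_
      rw [absNorm_span_prime hD, sq]
      exact fun h' ↦ h (Nat.dvd_of_mul_dvd_mul_left hp.pos h')
  rw [← hspan, ← ncard_absNorm_eq p, ← ncard_absNorm_eq (p * m)]
  rcases eq_empty_or_nonempty {P : Ideal (𝓞 (quadField D)) | Ideal.absNorm P = p} with hT | ⟨P, hP⟩
  · -- the inert case
    have : {I : Ideal (𝓞 (quadField D)) | Ideal.absNorm I = p * m ∧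
        Ideal.span {(p : 𝓞 (quadField D))} ∣ I} =
        {I : Ideal (𝓞 (quadField D)) | Ideal.absNorm I = p * m} := by
      ext I
      refine ⟨fun h ↦ h.1, fun h ↦ ⟨h, ?_⟩⟩
      obtain ⟨M, hM, hpM, hMI⟩ := hdvd I h
      rcases absNorm_eq_prime_or_eq_span hD hp hM hpM with h1 | rfl
      · exact absurd h1 (eq_empty_iff_forall_notMem.1 hT M)
      · exact hMI
    rw [this, hT, ncard_empty]
    simp
  · have hP : Ideal.absNorm P = p := hP
    obtain ⟨Q, hQ, hPQ⟩ := exists_mul_eq_span hD hp hP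
    have hprime : ∀ {P : Ideal (𝓞 (quadField D))}, Ideal.absNorm P = p → Prime P :=
      fun h ↦ isPrime_of_absNorm_eq hp h
    have hT : {P : Ideal (𝓞 (quadField D)) | Ideal.absNorm P = p} = {P, Q} := by
      ext M
      refine ⟨fun hM ↦ ?_, ?_⟩
      · have hM : Ideal.absNorm M = p := hM
        exact eq_or_eq_of_mul_eq_span hp hP hQ hPQ
          ((Ideal.isPrime_of_prime (hprime hM)).isMaximal (hprime hM).ne_zero)
          (by rw [← hM]; exact Ideal.absNorm_mem M)
      · rintro (rfl | rfl)
        exacts [hP, hQ]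
    have hU : {I : Ideal (𝓞 (quadField D)) | Ideal.absNorm I = p * m} =
        {I | Ideal.absNorm I = p * m ∧ P ∣ I} ∪ {I | Ideal.absNorm I = p * m ∧ Q ∣ I} := by
      ext I
      refine ⟨fun h ↦ ?_, ?_⟩
      · obtain ⟨M, hM, hpM, hMI⟩ := hdvd I h
        rcases eq_or_eq_of_mul_eq_span hp hP hQ hPQ hM hpM with rfl | rfl
        · exact Or.inl ⟨h, hMI⟩
        · exact Or.inr ⟨h, hMI⟩
      · rintro (h | h)
        exacts [h.1, h.1]
    have hcard : ∀ {M : Ideal (𝓞 (quadField D))}, Ideal.absNorm M = p →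
        {I : Ideal (𝓞 (quadField D)) | Ideal.absNorm I = p * m ∧ M ∣ I}.ncard =
          idealCount D m := by
      intro M hM
      have h1 := ncard_dvd (hprime hM).ne_zero m
      rwa [hM] at h1
    by_cases hne : P = Q
    · -- the ramified case
      subst hne
      rw [hU, hT, union_self, hcard hP, pair_eq_singleton, ncard_singleton]
      push_cast
      ring
    · -- the split case
      have hfin : ∀ M : Ideal (𝓞 (quadField D)),
          {I : Ideal (𝓞 (quadField D)) | Ideal.absNorm I = p * m ∧ M ∣ I}.Finite := fun M ↦
        (Ideal.finite_setOfPred_absNorm_eq (p * m)).subset fun I hI ↦ hI.1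
      have hinter : {I : Ideal (𝓞 (quadField D)) | Ideal.absNorm I = p * m ∧ P ∣ I} ∩
          {I | Ideal.absNorm I = p * m ∧ Q ∣ I} = {I : Ideal (𝓞 (quadField D)) |
            Ideal.absNorm I = p * m ∧ Ideal.span {(p : 𝓞 (quadField D))} ∣ I} := by
        ext I
        rw [hPQ]
        constructor
        · rintro ⟨⟨h1, K, rfl⟩, -, h2⟩
          refine ⟨h1, mul_dvd_mul_left P (((hprime hQ).dvd_or_dvd h2).resolve_left fun h3 ↦ ?_)⟩
          exact hne (associated_iff_eq.1
            (((hprime hQ).dvd_prime_iff_associated (hprime hP)).1 h3)).symm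
        · rintro ⟨h1, h2⟩
          exact ⟨⟨h1, (dvd_mul_right P Q).trans h2⟩, h1, (dvd_mul_left Q P).trans h2⟩
      have h1 := ncard_union_add_ncard_inter _ _ (hfin P) (hfin Q)
      rw [← hU, hinter, hcard hP, hcard hQ] at h1
      rw [hT, ncard_pair hne]
      push_cast
      have h2 : (({I : Ideal (𝓞 (quadField D)) | Ideal.absNorm I = p * m}.ncard : ℤ)) +
        ({I : Ideal (𝓞 (quadField D)) | Ideal.absNorm I = p * m ∧
            Ideal.span {(p : 𝓞 (quadField D))} ∣ I}.ncard : ℤ) =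
          (idealCount D m : ℤ) + idealCount D m := by exact_mod_cast h1
      linear_combination h2

end

/-! ### Prime ideals and the Kronecker symbol -/

section

variable {D c : ℤ} {p : ℕ}

/-- The ring homomorphism `ℤ[ω] → 𝔽_p` attached to a root of the minimal polynomial of `ω`. -/
theorem exists_ringHom_zmod (hD : IsNegFundamentalDiscriminant D) (hc : 4 * c = D ^ 2 - D)
    {r : ZMod p} (hr : r ^ 2 - D * r + c = 0) :
    ∃ φ : 𝓞 (quadField D) →+* ZMod p, φ (integerGenerator hD) = r := by
  set B := integerBasis hD with hB
  have h0 : B 0 = 1 := by simp [hB, integerBasis]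
  have h1 : B 1 = integerGenerator hD := by simp [hB, integerBasis]
  set ψ : 𝓞 (quadField D) →ₗ[ℤ] ZMod p := B.constr ℤ ![1, r] with hψ
  have hψ0 : ψ 1 = 1 := by rw [← h0, hψ, Module.Basis.constr_basis]; rfl
  have hψ1 : ψ (integerGenerator hD) = r := by rw [← h1, hψ, Module.Basis.constr_basis]; rfl
  have hval : ∀ m j : ℤ, ψ (m + j * integerGenerator hD) = m + j * r := by
    intro m j
    have : (m + j * integerGenerator hD : 𝓞 (quadField D)) = m • 1 + j • integerGenerator hD := by
      simp
    rw [this, map_add, map_zsmul, map_zsmul, hψ0, hψ1]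
    simp
  refine ⟨{ toFun := ψ, map_one' := hψ0, map_zero' := map_zero ψ, map_add' := map_add ψ,
            map_mul' := fun x y ↦ ?_ }, hψ1⟩
  obtain ⟨m, j, rfl⟩ := exists_eq_add_mul_integerGenerator hD x
  obtain ⟨m', j', rfl⟩ := exists_eq_add_mul_integerGenerator hD y
  have h2 : (m + j * integerGenerator hD) * (m' + j' * integerGenerator hD) =
      ((m * m' - c * j * j' : ℤ) : 𝓞 (quadField D)) +
        ((m * j' + j * m' + D * j * j' : ℤ) : 𝓞 (quadField D)) * integerGenerator hD := by
    push_cast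
    linear_combination (j * j' : 𝓞 (quadField D)) * integerGenerator_sq hD hc
  rw [h2, hval, hval, hval]
  push_cast
  linear_combination -(j * j' : ZMod p) * hr

theorem ringHom_zmod_eq (hD : IsNegFundamentalDiscriminant D) {φ ψ : 𝓞 (quadField D) →+* ZMod p}
    (h : φ (integerGenerator hD) = ψ (integerGenerator hD)) : φ = ψ := by
  ext x
  obtain ⟨m, j, rfl⟩ := exists_eq_add_mul_integerGenerator hD x
  simp [h]

/-- The prime ideals of norm `p` correspond to the roots modulo `p` of the minimal polynomial
of `ω`. -/
theorem idealCount_prime (hD : IsNegFundamentalDiscriminant D) (hc : 4 * c = D ^ 2 - D)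
    (hp : p.Prime) : idealCount D p = Nat.card {r : ZMod p // r ^ 2 - D * r + c = 0} := by
  have : Fact p.Prime := ⟨hp⟩
  choose φ hφ using fun r : {r : ZMod p // r ^ 2 - D * r + c = 0} ↦
    exists_ringHom_zmod hD hc r.2
  have hsurj : ∀ ψ : 𝓞 (quadField D) →+* ZMod p, Function.Surjective ψ := fun ψ x ↦ by
    refine ⟨(x.val : 𝓞 (quadField D)), ?_⟩
    rw [map_natCast, ZMod.natCast_zmod_val]
  have hnorm : ∀ ψ : 𝓞 (quadField D) →+* ZMod p, Ideal.absNorm (RingHom.ker ψ) = p := by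
    intro ψ
    have := Nat.card_congr (RingHom.quotientKerEquivOfSurjective (hsurj ψ)).toEquiv
    rw [Nat.card_zmod] at this
    exact this
  symm
  refine Nat.card_eq_of_bijective
    (fun r ↦ ⟨RingHom.ker (φ r), hnorm _⟩) ⟨fun r s hrs ↦ ?_, ?_⟩
  · have h1 : RingHom.ker (φ r) = RingHom.ker (φ s) := congrArg Subtype.val hrs
    have h2 : integerGenerator hD - ((r : ZMod p).val : 𝓞 (quadField D)) ∈ RingHom.ker (φ r) := by
      rw [RingHom.mem_ker, map_sub, hφ, map_natCast, ZMod.natCast_zmod_val, sub_self]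
    rw [h1, RingHom.mem_ker, map_sub, hφ, map_natCast, ZMod.natCast_zmod_val] at h2
    exact Subtype.ext (sub_eq_zero.1 h2).symm
  · rintro ⟨P, hP⟩
    have hcard : Nat.card (𝓞 (quadField D) ⧸ P) = p := hP
    have : Finite (𝓞 (quadField D) ⧸ P) := Nat.finite_of_card_ne_zero (by
      rw [hcard]; exact hp.ne_zero)
    let _ : Fintype (𝓞 (quadField D) ⧸ P) := Fintype.ofFinite _
    let e := ZMod.ringEquivOfPrime (𝓞 (quadField D) ⧸ P) hp (by
      rw [← Nat.card_eq_fintype_card, hcard])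
    let ψ : 𝓞 (quadField D) →+* ZMod p := (e.symm : _ →+* ZMod p).comp (Ideal.Quotient.mk P)
    have hker : RingHom.ker ψ = P := by
      ext x
      rw [RingHom.mem_ker, ← Ideal.Quotient.eq_zero_iff_mem]
      exact EmbeddingLike.map_eq_zero_iff (f := e.symm)
    have hroot : ψ (integerGenerator hD) ^ 2 - D * ψ (integerGenerator hD) + c = 0 := by
      have := congrArg ψ (integerGenerator_sq hD hc)
      simpa only [map_add, map_sub, map_mul, map_pow, map_intCast, map_zero] using this
    refine ⟨⟨_, hroot⟩, Subtype.ext ?_⟩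
    change RingHom.ker (φ _) = P
    rw [ringHom_zmod_eq hD (hφ ⟨_, hroot⟩ : _ = ψ _), hker]

theorem kronecker_two (D : ℤ) : kronecker D 2 = ZMod.χ₈ (D : ZMod 8) := by
  have h1 : Nat.factorization 2 2 = 1 := Nat.prime_two.factorization_self
  rw [kronecker, if_neg two_ne_zero, h1]
  simp

/-- The number of prime ideals of norm `p` is determined by the Kronecker symbol. -/
theorem idealCount_prime_eq (hD : IsNegFundamentalDiscriminant D) (hp : p.Prime) :
    (idealCount D p : ℤ) = 1 + kronecker D p := by
  obtain ⟨c, hc⟩ := hD.exists_four_mul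
  rw [idealCount_prime hD hc hp]
  rcases hp.eq_two_or_odd with rfl | hodd
  · rw [kronecker_two, ZMod.χ₈_int_eq_if_mod_eight, Nat.card_eq_fintype_card, Fintype.card_subtype]
    obtain ⟨d, s, hs, rfl⟩ : ∃ d s : ℤ, (s = 0 ∨ s = 4 ∨ s = 1 ∨ s = 5) ∧ D = 8 * d + s :=
      ⟨D / 8, D % 8, by have := hD.mod_four; omega, by omega⟩
    have hc' : c = 16 * d ^ 2 + 4 * d * s - 2 * d + (s ^ 2 - s) / 4 := by
      rcases hs with rfl | rfl | rfl | rfl <;> norm_num <;> linarith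
    have h2 : (2 : ZMod 2) = 0 := rfl
    have hc2 : (c : ZMod 2) = ((s ^ 2 - s) / 4 : ℤ) := by
      rw [hc', Int.cast_add, show (16 * d ^ 2 + 4 * d * s - 2 * d : ℤ) =
        2 * (8 * d ^ 2 + 2 * d * s - d) by ring]
      simp [h2]
    have hD2 : ((8 * d + s : ℤ) : ZMod 2) = s := by
      rw [Int.cast_add, show (8 * d : ℤ) = 2 * (4 * d) by ring]
      simp [h2]
    rw [hc2, hD2]
    rcases hs with rfl | rfl | rfl | rfl
    · rw [if_pos (by omega)]; decide
    · rw [if_pos (by omega)]; decide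
    · rw [if_neg (by omega), if_pos (by omega)]; decide
    · rw [if_neg (by omega), if_neg (by omega)]; decide
  · have : Fact p.Prime := ⟨hp⟩
    have h2 : (2 : ZMod p) ≠ 0 := by
      have h := (ZMod.natCast_eq_zero_iff 2 p).not.2 fun h ↦ by
        have := Nat.le_of_dvd two_pos h
        have := hp.two_le
        omega
      exact_mod_cast h
    have hc' : (4 : ZMod p) * c = D ^ 2 - D := by exact_mod_cast congrArg (Int.cast : ℤ → ZMod p) hc
    -- completing the square
    have hiff : ∀ r : ZMod p, r ^ 2 - D * r + c = 0 ↔ (2 * r - D) ^ 2 = D := by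
      intro r
      rw [← sub_eq_zero (a := (2 * r - D) ^ 2),
        show (2 * r - D) ^ 2 - D = (2 * 2) * (r ^ 2 - D * r + c) by linear_combination -hc']
      simp [h2]
    rw [kronecker_of_odd hodd, ← jacobiSym.legendreSym.to_jacobiSym, add_comm,
      ← legendreSym.card_sqrts p (by omega), ← ncard_eq_toFinset_card', ← Nat.card_coe_set_eq]
    norm_cast
    refine Nat.card_eq_of_bijective (fun r ↦ ⟨2 * r - D, (hiff r).1 r.2⟩) ⟨fun r s h ↦ ?_, ?_⟩
    · have h3 : (2 * r - D : ZMod p) = 2 * s - D := congrArg Subtype.val h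
      exact Subtype.ext (mul_left_cancel₀ h2 (sub_left_injective h3))
    · rintro ⟨y, hy⟩
      have h3 : 2 * ((y + D) / 2) - D = y := by
        field_simp
        ring
      exact ⟨⟨(y + D) / 2, (hiff _).2 (by rw [h3]; exact hy)⟩, Subtype.ext h3⟩

/-- The divisor sum `∑_{d ∣ n} χ_D(d)`. -/
def kroneckerSum (D : ℤ) (n : ℕ) : ℤ := ∑ d ∈ n.divisors, kronecker D d

/-- The local recursion for the divisor sum. -/
theorem kroneckerSum_prime_mul (hD : D.natAbs ≠ 1) (hp : p.Prime) {m : ℕ} (hm : m ≠ 0) :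
    kroneckerSum D (p * m) = (1 + kronecker D p) * kroneckerSum D m -
      kronecker D p * (if p ∣ m then kroneckerSum D (m / p) else 0) := by
  -- the divisors of `p l` divisible by `p` contribute `χ(p)` times the sum for `l`
  have hsplit : ∀ l : ℕ, l ≠ 0 → kroneckerSum D (p * l) = kronecker D p * kroneckerSum D l +
      ∑ d ∈ (p * l).divisors with ¬ p ∣ d, kronecker D d := by
    intro l hl
    rw [kroneckerSum, ← Finset.sum_filter_add_sum_filter_not _ (p ∣ ·)]
    congr 1
    rw [kroneckerSum, Finset.mul_sum]
    refine (Finset.sum_bij (fun d _ ↦ p * d) (fun d hd ↦ ?_) (fun d _ d' _ h ↦ ?_) ?_ ?_).symm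
    · rw [Finset.mem_filter, Nat.mem_divisors]
      exact ⟨⟨mul_dvd_mul_left p (Nat.dvd_of_mem_divisors hd), mul_ne_zero hp.ne_zero hl⟩,
        dvd_mul_right p d⟩
    · exact Nat.eq_of_mul_eq_mul_left hp.pos h
    · intro e he
      rw [Finset.mem_filter, Nat.mem_divisors] at he
      obtain ⟨⟨h1, -⟩, d, rfl⟩ := he
      exact ⟨d, Nat.mem_divisors.2 ⟨Nat.dvd_of_mul_dvd_mul_left hp.pos h1, hl⟩, rfl⟩
    · intro d _
      rw [kronecker_mul hD]
  have hnot : ∑ d ∈ (p * m).divisors with ¬ p ∣ d, kronecker D d =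
      ∑ d ∈ m.divisors with ¬ p ∣ d, kronecker D d := by
    refine Finset.sum_congr (Finset.ext fun d ↦ ?_) fun _ _ ↦ rfl
    rw [Finset.mem_filter, Finset.mem_filter, Nat.mem_divisors, Nat.mem_divisors]
    constructor
    · rintro ⟨⟨h1, -⟩, h2⟩
      exact ⟨⟨(Nat.Coprime.symm ((Nat.Prime.coprime_iff_not_dvd hp).2 h2)).dvd_of_dvd_mul_left h1,
        hm⟩, h2⟩
    · rintro ⟨⟨h1, -⟩, h2⟩
      exact ⟨⟨h1.mul_left p, mul_ne_zero hp.ne_zero hm⟩, h2⟩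
  rw [hsplit m hm, hnot]
  split_ifs with h
  · obtain ⟨l, rfl⟩ := h
    have hl : l ≠ 0 := by
      rintro rfl
      exact hm (mul_zero p)
    rw [Nat.mul_div_cancel_left _ hp.pos, hsplit l hl]
    ring
  · have : ∑ d ∈ m.divisors with ¬ p ∣ d, kronecker D d = kroneckerSum D m := by
      rw [kroneckerSum, Finset.filter_true_of_mem]
      exact fun d hd hpd ↦ h (hpd.trans (Nat.dvd_of_mem_divisors hd))
    rw [this]
    ring

/-- The Dedekind zeta function of `ℚ(√D)` is `ζ(s) L(χ_D, s)`, in terms of coefficients. -/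
theorem idealCount_eq_kroneckerSum (hD : IsNegFundamentalDiscriminant D) {n : ℕ} (hn : n ≠ 0) :
    (idealCount D n : ℤ) = kroneckerSum D n := by
  have hD1 : D.natAbs ≠ 1 := by
    have := hD.1
    have := hD.mod_four
    omega
  induction n using Nat.strong_induction_on with
  | _ n ih =>
    by_cases h1 : n = 1
    · rw [h1, idealCount_one, kroneckerSum]
      simp [kronecker_of_odd]
    · obtain ⟨p, hp, m, rfl⟩ := Nat.exists_prime_and_dvd h1
      have hm : m ≠ 0 := by
        rintro rfl
        exact hn (mul_zero p)
      have hlt : m < p * m := by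
        have := hp.two_le
        nlinarith [Nat.pos_of_ne_zero hm]
      rw [idealCount_prime_mul hD.1 hp, kroneckerSum_prime_mul hD1 hp hm, ih m hlt hm,
        idealCount_prime_eq hD hp]
      split_ifs with h
      · have hdiv : m / p ≠ 0 := (Nat.div_pos (Nat.le_of_dvd (Nat.pos_of_ne_zero hm) h) hp.pos).ne'
        rw [ih (m / p) ((Nat.div_le_self m p).trans_lt hlt) hdiv]
        ring
      · push_cast
        ring

end

/-! ### The Epstein zeta functions of the Heegner points -/

section

variable {D : ℤ}

/-- A sum over nonzero ideals of a function of the norm. -/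
theorem hasSum_idealCount {g : ℕ → ℝ} {S : ℝ}
    (h : HasSum (fun I : (Ideal (𝓞 (quadField D)))⁰ ↦
      g (Ideal.absNorm (I : Ideal (𝓞 (quadField D))))) S) :
    HasSum (fun n : ℕ ↦ if n = 0 then 0 else (idealCount D n : ℝ) * g n) S := by
  set N : (Ideal (𝓞 (quadField D)))⁰ → ℕ := fun I ↦ Ideal.absNorm (I : Ideal (𝓞 (quadField D)))
    with hN
  have h1 := (Equiv.sigmaFiberEquiv N).hasSum_iff.2 h
  refine h1.sigma fun n ↦ ?_
  have hconst : ∀ x : {I // N I = n}, ((fun I : (Ideal (𝓞 (quadField D)))⁰ ↦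
      g (Ideal.absNorm (I : Ideal (𝓞 (quadField D))))) ∘ Equiv.sigmaFiberEquiv N) ⟨n, x⟩ = g n := by
    rintro ⟨I, rfl⟩
    rfl
  simp only [hconst]
  have hinj : Function.Injective (fun x : {I // N I = n} ↦
      (⟨x.1, x.2⟩ : {I : Ideal (𝓞 (quadField D)) // Ideal.absNorm I = n})) := by
    intro x y hxy
    simp only [Subtype.mk.injEq] at hxy
    exact Subtype.ext (Subtype.ext hxy)
  have : Finite {I // N I = n} := Finite.of_injective _ hinj
  have : Fintype {I // N I = n} := Fintype.ofFinite _
  convert hasSum_fintype (fun _ : {I // N I = n} ↦ g n) using 1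
  rw [Finset.sum_const, nsmul_eq_mul, Finset.card_univ, ← Nat.card_eq_fintype_card]
  split_ifs with hn
  · have : IsEmpty {I // N I = n} := ⟨fun x ↦ by
      have := Ideal.absNorm_ne_zero_of_nonZeroDivisors x.1
      exact this (x.2.trans hn)⟩
    simp
  · rw [idealCount, Nat.card_eq_of_bijective _ ⟨hinj, fun I ↦ ?_⟩]
    have hI : I.1 ∈ (Ideal (𝓞 (quadField D)))⁰ := by
      rw [← Ideal.absNorm_ne_zero_iff_mem_nonZeroDivisors, I.2]
      exact hn
    exact ⟨⟨⟨I.1, hI⟩, I.2⟩, rfl⟩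

/-- Representatives of the Heegner points, whose theta series add up to the theta series of
`ζ(s) L(χ_D, s)`. -/
theorem exists_hasSum_latticeTheta (hD : IsNegFundamentalDiscriminant D) :
    ∃ ρ : ClassGroup (𝓞 (quadField D)) → ℍ, (∀ C, heegnerPoint D hD C = toModularCurve (ρ C)) ∧
      ∀ t : ℝ, 0 < t → HasSum (fun n : ℕ ↦ (numUnits D : ℝ) * kroneckerSum D n *
        Real.exp (-(2 * Real.pi / √(-(D : ℝ)) * n) * t)) (∑ C, (latticeTheta (ρ C) t - 1)) := by
  choose 𝔞 a b ρ h𝔞 hab hρ hP using exists_isOrientedBasis hD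
  refine ⟨ρ, hP, fun t ht ↦ ?_⟩
  refine (hasSum_idealCount (g := fun n ↦ (numUnits D : ℝ) *
    Real.exp (-(2 * Real.pi / √(-(D : ℝ)) * t) * n))
    (hasSum_latticeTheta hD h𝔞 hab hρ ht)).congr_fun fun n ↦ ?_
  split_ifs with hn
  · simp [hn, kroneckerSum]
  · rw [← idealCount_eq_kroneckerSum hD hn,
      show -(2 * Real.pi / √(-(D : ℝ)) * t) * (n : ℝ) = -(2 * Real.pi / √(-(D : ℝ)) * n) * t by ring]
    push_cast
    ring

theorem lseries_kroneckerSum (hD : IsNegFundamentalDiscriminant D) {s : ℂ} (hs : 1 < s.re) :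
    LSeriesHasSum (fun n ↦ (kroneckerSum D n : ℂ)) s (riemannZeta s * kroneckerL D hD s) := by
  have : NeZero D.natAbs := ⟨Int.natAbs_ne_zero.2 hD.1.ne⟩
  have h1 : LSeriesHasSum 1 s (riemannZeta s) := LSeriesHasSum_one hs
  have h2 : LSeriesHasSum (fun n ↦ kroneckerChar D hD n) s (kroneckerL D hD s) := by
    rw [kroneckerL, DirichletCharacter.LFunction_eq_LSeries _ hs]
    exact (DirichletCharacter.LSeriesSummable_of_one_lt_re _ hs).LSeriesHasSum
  have h3 := h1.convolution h2
  refine (LSeriesHasSum_congr s _ fun {n} _ ↦ ?_).1 h3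
  rw [LSeries.convolution_def, kroneckerSum]
  refine (Nat.sum_divisorsAntidiagonal' (fun i j ↦ (1 : ℕ → ℂ) i *
    kroneckerChar D hD j)).trans ?_
  push_cast
  exact Finset.sum_congr rfl fun d _ ↦ by simp [kroneckerChar_natCast]

theorem hasMellin_sum {ι : Type*} (s : Finset ι) {f : ι → ℝ → ℂ} {z : ℂ} {m : ι → ℂ}
    (h : ∀ i ∈ s, HasMellin (f i) z (m i)) :
    HasMellin (fun t ↦ ∑ i ∈ s, f i t) z (∑ i ∈ s, m i) := by
  classical
  induction s using Finset.induction_on with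
  | empty =>
    refine ⟨?_, by simp [mellin]⟩
    simp [MellinConvergent]
  | insert i s hi ih =>
    simp only [Finset.sum_insert hi]
    have h1 := h i (Finset.mem_insert_self i s)
    have h2 := ih fun j hj ↦ h j (Finset.mem_insert_of_mem hj)
    have h3 := hasMellin_add h1.1 h2.1
    rwa [h1.2, h2.2] at h3

/-- The Mellin transform of the theta identity. -/
theorem sum_epsteinLambda₀_of_one_lt_re (hD : IsNegFundamentalDiscriminant D)
    {ρ : ClassGroup (𝓞 (quadField D)) → ℍ}
    (h : ∀ t : ℝ, 0 < t → HasSum (fun n : ℕ ↦ (numUnits D : ℝ) * kroneckerSum D n *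
        Real.exp (-(2 * Real.pi / √(-(D : ℝ)) * n) * t)) (∑ C, (latticeTheta (ρ C) t - 1)))
    {s : ℂ} (hs : 1 < s.re) :
    (∑ C, epsteinLambda₀ (ρ C) s) - classNumber (quadField D) * (1 / s + 1 / (1 - s)) =
      numUnits D * Complex.Gamma s * ((2 * Real.pi / √(-(D : ℝ)) : ℝ) : ℂ) ^ (-s) *
        (riemannZeta s * kroneckerL D hD s) := by
  have hs0 : 0 < s.re := by linarith
  set c : ℝ := 2 * Real.pi / √(-(D : ℝ)) with hc
  have hc0 : 0 < c := div_pos (by positivity) (sqrt_neg_pos hD.1)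
  have h1 : HasMellin (fun t : ℝ ↦ ∑ C, ((latticeTheta (ρ C) t : ℂ) - 1)) s
      (∑ C, (latticeThetaFEPair (ρ C)).Λ s) :=
    hasMellin_sum _ fun C _ ↦ (latticeThetaFEPair (ρ C)).hasMellin hs
  have h2 := (lseries_kroneckerSum hD hs)
  have hcn : ∀ n : ℕ, ((c * n : ℝ) : ℂ) ^ s = (c : ℂ) ^ s * (n : ℂ) ^ s := fun n ↦ by
    rw [Complex.ofReal_mul, Complex.mul_cpow_ofReal_nonneg hc0.le (Nat.cast_nonneg n)]
    simp
  have hterm : ∀ n : ℕ, Complex.Gamma s * ((numUnits D : ℂ) * kroneckerSum D n) /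
      ((c * n : ℝ) : ℂ) ^ s = numUnits D * Complex.Gamma s * (c : ℂ) ^ (-s) *
        LSeries.term (fun n ↦ (kroneckerSum D n : ℂ)) s n := by
    intro n
    rw [LSeries.term_def, hcn, Complex.cpow_neg]
    split_ifs with hn
    · simp [hn, kroneckerSum]
    · field_simp
  have h3 : HasSum (fun n : ℕ ↦ Complex.Gamma s * ((numUnits D : ℂ) * kroneckerSum D n) /
      ((c * n : ℝ) : ℂ) ^ s) (mellin (fun t : ℝ ↦ ∑ C, ((latticeTheta (ρ C) t : ℂ) - 1)) s) := by
    refine hasSum_mellin (fun n ↦ ?_) hs0 (fun t ht ↦ ?_) ?_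
    · rcases Nat.eq_zero_or_pos n with rfl | hn
      · left
        simp [kroneckerSum]
      · right
        have : (0 : ℝ) < n := by exact_mod_cast hn
        positivity
    · have := Complex.hasSum_ofReal.2 (h t ht)
      push_cast at this ⊢
      exact this
    · have h4 := (h2.LSeriesSummable.norm.mul_left ((numUnits D : ℝ) * c ^ (-s.re)))
      refine h4.congr fun n ↦ ?_
      rw [LSeries.norm_term_eq, norm_mul, Complex.norm_natCast]
      split_ifs with hn
      · simp [hn, kroneckerSum]
      · rw [Real.mul_rpow hc0.le (Nat.cast_nonneg n), Real.rpow_neg hc0.le]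
        field_simp
  simp only [hterm] at h3
  have h4 := (HasSum.mul_left ((numUnits D : ℂ) * Complex.Gamma s * (c : ℂ) ^ (-s)) h2).unique h3
  rw [h4, h1.2, classNumber]
  simp only [WeakFEPair.Λ, Finset.sum_sub_distrib]
  simp [latticeThetaFEPair, epsteinLambda₀]
  ring

end

/-! ### The class number formula and its derivative at zero -/

section

variable {D : ℤ}

theorem differentiableAt_kroneckerL (hD : IsNegFundamentalDiscriminant D) {s : ℂ} (hs : s ≠ 1) :
    DifferentiableAt ℂ (kroneckerL D hD) s := by
  have : NeZero D.natAbs := ⟨Int.natAbs_ne_zero.2 hD.1.ne⟩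
  exact DirichletCharacter.differentiableAt_LFunction _ s (Or.inl hs)

/-- The identity between the Epstein zeta functions of the Heegner points and `ζ(s) L(χ_D, s)`,
continued to all `s ≠ 1`. -/
theorem sum_epsteinLambda₀_eq (hD : IsNegFundamentalDiscriminant D)
    {ρ : ClassGroup (𝓞 (quadField D)) → ℍ}
    (h : ∀ t : ℝ, 0 < t → HasSum (fun n : ℕ ↦ (numUnits D : ℝ) * kroneckerSum D n *
        Real.exp (-(2 * Real.pi / √(-(D : ℝ)) * n) * t)) (∑ C, (latticeTheta (ρ C) t - 1)))
    {s : ℂ} (hs : s ≠ 1) :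
    (s * (1 - s) * (∑ C, epsteinLambda₀ (ρ C) s) - classNumber (quadField D)) *
        (Complex.Gamma (s + 1))⁻¹ =
      numUnits D * (1 - s) * ((2 * Real.pi / √(-(D : ℝ)) : ℝ) : ℂ) ^ (-s) *
        (riemannZeta s * kroneckerL D hD s) := by
  set c : ℝ := 2 * Real.pi / √(-(D : ℝ)) with hc
  have hc0 : 0 < c := div_pos (by positivity) (sqrt_neg_pos hD.1)
  have hc0' : (c : ℂ) ≠ 0 := by exact_mod_cast hc0.ne'
  have hopen : IsOpen ({1}ᶜ : Set ℂ) := isOpen_compl_singleton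
  have hA : ∀ C, Differentiable ℂ (epsteinLambda₀ (ρ C)) := fun C ↦ differentiable_epsteinLambda₀ _
  have hΓ : Differentiable ℂ (fun s : ℂ ↦ (Complex.Gamma (s + 1))⁻¹) :=
    Complex.differentiable_one_div_Gamma.comp (differentiable_id.add_const 1)
  have h1 : AnalyticOnNhd ℂ (fun s ↦ (s * (1 - s) * (∑ C, epsteinLambda₀ (ρ C) s) -
      classNumber (quadField D)) * (Complex.Gamma (s + 1))⁻¹) {1}ᶜ := by
    refine DifferentiableOn.analyticOnNhd (Differentiable.differentiableOn ?_) hopen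
    fun_prop
  have h2 : AnalyticOnNhd ℂ (fun s ↦ numUnits D * (1 - s) * (c : ℂ) ^ (-s) *
        (riemannZeta s * kroneckerL D hD s)) {1}ᶜ := by
    refine DifferentiableOn.analyticOnNhd (fun s hs ↦ DifferentiableAt.differentiableWithinAt ?_)
      hopen
    have h3 := differentiableAt_riemannZeta hs
    have h4 := differentiableAt_kroneckerL hD hs
    have h5 : DifferentiableAt ℂ (fun s : ℂ ↦ (c : ℂ) ^ (-s)) s :=
      DifferentiableAt.const_cpow (by fun_prop) (Or.inl hc0')
    fun_prop
  have hconn : IsPreconnected ({1}ᶜ : Set ℂ) :=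
    (isConnected_compl_singleton_of_one_lt_rank (by simp) 1).isPreconnected
  -- Multiplication by `s (1 - s) / Γ(s + 1)` makes both sides holomorphic away from `s = 1`, so the
  -- identity for `Re s > 1` extends.
  refine h1.eqOn_of_preconnected_of_eventuallyEq h2 hconn (z₀ := 2) (by simp) ?_ hs
  filter_upwards [(isOpen_lt continuous_const Complex.continuous_re).mem_nhds
    (show (1 : ℝ) < (2 : ℂ).re by simp)] with z hz
  have hz : 1 < z.re := hz
  have hz0 : z ≠ 0 := by
    rintro rfl
    simp at hz
    linarith
  have hz1 : 1 - z ≠ 0 := by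
    intro h0
    rw [← sub_eq_zero.1 h0] at hz
    simp at hz
  have hΓ0 : Complex.Gamma z ≠ 0 := Complex.Gamma_ne_zero_of_re_pos (by linarith)
  have h3 := sum_epsteinLambda₀_of_one_lt_re hD h hz
  rw [← hc] at h3
  rw [Complex.Gamma_add_one z hz0]
  field_simp
  field_simp at h3
  linear_combination h3

/-- The class number formula, and its refinement from the next Taylor coefficient at `s = 0`. -/
theorem kroneckerL_zero_and_sum_epsteinLambda₀ (hD : IsNegFundamentalDiscriminant D)
    {ρ : ClassGroup (𝓞 (quadField D)) → ℍ}
    (h : ∀ t : ℝ, 0 < t → HasSum (fun n : ℕ ↦ (numUnits D : ℝ) * kroneckerSum D n *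
        Real.exp (-(2 * Real.pi / √(-(D : ℝ)) * n) * t)) (∑ C, (latticeTheta (ρ C) t - 1))) :
    (numUnits D : ℂ) / 2 * kroneckerL D hD 0 = classNumber (quadField D) ∧
    ∑ C, epsteinLambda₀ (ρ C) 0 = classNumber (quadField D) *
        (1 + Real.eulerMascheroniConstant - 1 / 2 * (Real.log |(D : ℝ)| : ℂ)) -
      (numUnits D : ℂ) / 2 * deriv (kroneckerL D hD) 0 := by
  have hζ0 := riemannZeta_zero
  have hζ1 := deriv_riemannZeta_zero
  set c : ℝ := 2 * Real.pi / √(-(D : ℝ)) with hc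
  have hc0 : 0 < c := div_pos (by positivity) (sqrt_neg_pos hD.1)
  have hc0' : (c : ℂ) ≠ 0 := by exact_mod_cast hc0.ne'
  have h0 := sum_epsteinLambda₀_eq hD h (s := 0) (by norm_num)
  simp only [zero_mul, zero_sub, zero_add, Complex.Gamma_one, neg_zero, Complex.cpow_zero, hζ0,
    inv_one, mul_one, sub_zero] at h0
  have hcl : (numUnits D : ℂ) / 2 * kroneckerL D hD 0 = classNumber (quadField D) := by
    linear_combination h0
  refine ⟨hcl, ?_⟩
  set A : ℂ → ℂ := fun s ↦ ∑ C, epsteinLambda₀ (ρ C) s with hA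
  have hAd : HasDerivAt A (deriv A 0) 0 := by
    refine DifferentiableAt.hasDerivAt (Differentiable.differentiableAt ?_)
    have : ∀ C, Differentiable ℂ (epsteinLambda₀ (ρ C)) := fun C ↦ differentiable_epsteinLambda₀ _
    fun_prop
  have hΓ : HasDerivAt (fun s : ℂ ↦ (Complex.Gamma (s + 1))⁻¹) Real.eulerMascheroniConstant 0 := by
    have h1 : HasDerivAt Complex.Gamma (-Real.eulerMascheroniConstant) (0 + 1) := by
      rw [zero_add]
      exact Complex.hasDerivAt_Gamma_one
    exact ((h1.comp_add_const 0 1).inv (by simp)).congr_deriv (by simp)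
  have hid : HasDerivAt (fun s : ℂ ↦ s * (1 - s)) 1 0 := by
    exact ((hasDerivAt_id (0 : ℂ)).mul ((hasDerivAt_id (0 : ℂ)).const_sub 1)).congr_deriv (by simp)
  have hL := ((hid.mul hAd).sub_const (classNumber (quadField D) : ℂ)).mul hΓ
  have hcs : HasDerivAt (fun s : ℂ ↦ (c : ℂ) ^ (-s)) (-Complex.log c) 0 := by
    have := (hasDerivAt_neg (0 : ℂ)).const_cpow (c := (c : ℂ)) (Or.inl hc0')
    simpa using this
  have hR := ((((hasDerivAt_id (0 : ℂ)).const_sub 1).const_mul (numUnits D : ℂ)).mul hcs).mul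
    ((differentiableAt_riemannZeta (s := 0) (by norm_num)).hasDerivAt.mul
      (differentiableAt_kroneckerL hD (s := 0) (by norm_num)).hasDerivAt)
  have heq := hL.unique (hR.congr_of_eventuallyEq (by
    filter_upwards [isOpen_compl_singleton.mem_nhds (show (0 : ℂ) ∈ ({1}ᶜ : Set ℂ) by simp)]
      with s hs
    exact sum_epsteinLambda₀_eq hD h hs))
  simp [hζ0, hζ1] at heq
  have hlogc : Complex.log c = Complex.log (2 * Real.pi) - 1 / 2 * (Real.log |(D : ℝ)| : ℂ) := by
    have hD0 : (D : ℝ) < 0 := by exact_mod_cast hD.1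
    rw [← Complex.ofReal_log hc0.le, hc, Real.log_div (by positivity) (sqrt_neg_pos hD.1).ne',
      Real.log_sqrt (by linarith), abs_of_neg hD0, show (2 * Real.pi : ℂ) = (2 * Real.pi : ℝ) by
        push_cast; rfl, ← Complex.ofReal_log (by positivity)]
    push_cast
    ring
  rw [hlogc] at heq
  change A 0 = _
  linear_combination heq + (1 - 1 / 2 * (Real.log |(D : ℝ)| : ℂ)) * hcl

end

/-! ### The logarithmic derivative of the zeta function at `-1` -/

theorem deriv_riemannZeta_two : deriv riemannZeta 2 = -(logZetaSum : ℂ) := by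
  have h1 : deriv riemannZeta 2 = deriv (LSeries 1) 2 := by
    refine EventuallyEq.deriv_eq ?_
    filter_upwards [(isOpen_lt continuous_const Complex.continuous_re).mem_nhds
      (show (1 : ℝ) < (2 : ℂ).re by simp)] with z hz
    exact (LSeriesHasSum_one hz).LSeries_eq.symm
  have habs : LSeries.abscissaOfAbsConv 1 < (2 : ℂ).re := by
    rw [LSeries.abscissaOfAbsConv_one]
    norm_cast
  have hsum : Summable (LSeries.term (LSeries.logMul 1) 2) := LSeriesSummable_logMul_of_lt_re habs
  rw [h1, LSeries_deriv habs, LSeries, logZetaSum, Complex.ofReal_tsum, hsum.tsum_eq_zero_add,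
    LSeries.term_zero, zero_add]
  refine congrArg Neg.neg (tsum_congr fun n ↦ ?_)
  rw [LSeries.term_of_ne_zero n.succ_ne_zero]
  push_cast
  rw [LSeries.logMul, Pi.one_apply, mul_one, Complex.ofReal_log (by positivity)]
  push_cast
  congr 1
  exact_mod_cast Complex.cpow_natCast ((n : ℂ) + 1) 2

theorem riemannZeta_two_ne_zero : riemannZeta 2 ≠ 0 := by
  rw [riemannZeta_two]
  have : (Real.pi : ℂ) ≠ 0 := by exact_mod_cast Real.pi_ne_zero
  simp [this]

theorem logDeriv_riemannZeta_neg_one : deriv riemannZeta (-1) / riemannZeta (-1) =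
    Complex.log (2 * Real.pi) - 1 + Real.eulerMascheroniConstant +
      logZetaSum / (Real.pi ^ 2 / 6) := by
  have hπ : (Real.pi : ℂ) ≠ 0 := by exact_mod_cast Real.pi_ne_zero
  have h2π : (2 * Real.pi : ℂ) ≠ 0 := mul_ne_zero two_ne_zero hπ
  have hev : (fun s ↦ riemannZeta (1 - s)) =ᶠ[𝓝 2] fun s ↦
      2 * (2 * Real.pi : ℂ) ^ (-s) * Complex.Gamma s * Complex.cos (Real.pi * s / 2) *
        riemannZeta s := by
    filter_upwards [(isOpen_lt continuous_const Complex.continuous_re).mem_nhds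
      (show (1 : ℝ) < (2 : ℂ).re by simp)] with z hz
    have hz : 1 < z.re := hz
    refine riemannZeta_one_sub (fun n h ↦ ?_) (fun h ↦ ?_)
    · rw [h] at hz
      simp at hz
      have : (0 : ℝ) ≤ n := n.cast_nonneg
      linarith
    · rw [h] at hz
      simp at hz
  have hΓ : HasDerivAt Complex.Gamma (1 - Real.eulerMascheroniConstant) 2 := by
    have h1 : HasDerivAt (fun s ↦ Complex.Gamma (s + 1)) (1 - Real.eulerMascheroniConstant : ℂ) 1 := by
      have h2 := (hasDerivAt_id (1 : ℂ)).mul Complex.hasDerivAt_Gamma_one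
      have h3 : HasDerivAt (fun s ↦ s * Complex.Gamma s)
          (1 - Real.eulerMascheroniConstant : ℂ) 1 := h2.congr_deriv (by simp; ring)
      refine h3.congr_of_eventuallyEq ?_
      filter_upwards [isOpen_compl_singleton.mem_nhds (show (1 : ℂ) ∈ ({0}ᶜ : Set ℂ) by simp)]
        with s hs
      exact Complex.Gamma_add_one s hs
    have h4 := HasDerivAt.comp_sub_const (2 : ℂ) 1 (f := fun s ↦ Complex.Gamma (s + 1))
      (f' := (1 - Real.eulerMascheroniConstant : ℂ)) (by norm_num; exact h1)
    simpa using h4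
  have hcos : HasDerivAt (fun s : ℂ ↦ Complex.cos (Real.pi * s / 2)) 0 2 := by
    have h1 := ((((hasDerivAt_id (2 : ℂ)).const_mul (Real.pi : ℂ)).div_const 2)).ccos
    refine h1.congr_deriv ?_
    simp
  have hcos2 : Complex.cos (Real.pi * 2 / 2) = -1 := by simp
  have hpow : HasDerivAt (fun s : ℂ ↦ (2 * Real.pi : ℂ) ^ (-s))
      (-(2 * Real.pi : ℂ) ^ (-2 : ℂ) * Complex.log (2 * Real.pi)) 2 := by
    have := (hasDerivAt_neg (2 : ℂ)).const_cpow (c := (2 * Real.pi : ℂ)) (Or.inl h2π)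
    exact this.congr_deriv (by ring)
  have hR := (((hpow.const_mul 2).mul hΓ).mul hcos).mul
    (differentiableAt_riemannZeta (s := 2) (by norm_num)).hasDerivAt
  have hL : HasDerivAt (fun s ↦ riemannZeta (1 - s)) (-deriv riemannZeta (-1)) 2 := by
    have h1 : HasDerivAt riemannZeta (deriv riemannZeta (-1)) (1 - 2) := by
      rw [show (1 - 2 : ℂ) = -1 by norm_num]
      exact (differentiableAt_riemannZeta (by norm_num)).hasDerivAt
    exact h1.comp_const_sub 1 2
  have heq := hL.unique (hR.congr_of_eventuallyEq hev)
  have hval := hev.eq_of_nhds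
  have hΓ2 : Complex.Gamma 2 = 1 := by
    rw [← one_add_one_eq_two, Complex.Gamma_add_one 1 one_ne_zero, Complex.Gamma_one, one_mul]
  simp only [hcos2, hΓ2, show (1 - 2 : ℂ) = -1 by norm_num] at hval
  simp only [hcos2, hΓ2, Pi.mul_apply] at heq
  have hζ := riemannZeta_two_ne_zero
  have hE : (2 * Real.pi : ℂ) ^ (-2 : ℂ) ≠ 0 := by
    rw [Complex.cpow_ne_zero_iff]
    exact Or.inl h2π
  have hne : riemannZeta (-1) ≠ 0 := by
    rw [hval]
    simp [hζ, hE]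
  rw [div_eq_iff hne]
  have h2 : (logZetaSum : ℂ) / (Real.pi ^ 2 / 6) * riemannZeta 2 = logZetaSum := by
    rw [riemannZeta_two]
    field_simp
  rw [deriv_riemannZeta_two] at heq
  rw [hval]
  linear_combination -heq + 2 * (2 * Real.pi : ℂ) ^ (-2 : ℂ) * h2

/-! ### The integral for the Heegner divisor -/

theorem latticeForm_sl_smul (γ : SL(2, ℤ)) (τ : ℍ) (v : Fin 2 → ℤ) :
    latticeForm (γ • τ) v = latticeForm τ (Matrix.vecMul v (γ : Matrix (Fin 2) (Fin 2) ℤ)) := by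
  have hd := denom_sl_ne_zero γ τ
  have h1 : ((v 0 : ℂ) * ((γ • τ : ℍ) : ℂ) + v 1) * ((γ 1 0 : ℂ) * τ + γ 1 1) =
      ((Matrix.vecMul v (γ : Matrix (Fin 2) (Fin 2) ℤ) 0 : ℤ) : ℂ) * τ +
        (Matrix.vecMul v (γ : Matrix (Fin 2) (Fin 2) ℤ) 1 : ℤ) := by
    rw [coe_smul_eq_div, add_mul, mul_assoc, div_mul_cancel₀ _ hd]
    simp only [Matrix.vecMul, dotProduct, Fin.sum_univ_two]
    push_cast
    ring
  rw [latticeForm, latticeForm, ModularGroup.im_smul_eq_div_normSq, denom_sl, ← h1, map_mul]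
  have := Complex.normSq_pos.2 hd
  have := τ.im_pos
  field_simp

theorem latticeTheta_smul (γ : SL(2, ℤ)) (τ : ℍ) (t : ℝ) :
    latticeTheta (γ • τ) t = latticeTheta τ t := by
  let e : (Fin 2 → ℤ) ≃ (Fin 2 → ℤ) :=
    { toFun := fun v ↦ Matrix.vecMul v (γ : Matrix (Fin 2) (Fin 2) ℤ)
      invFun := fun v ↦ Matrix.vecMul v ((γ⁻¹ : SL(2, ℤ)) : Matrix (Fin 2) (Fin 2) ℤ)
      left_inv := fun v ↦ by
        beta_reduce
        rw [Matrix.vecMul_vecMul, ← Matrix.SpecialLinearGroup.coe_mul, mul_inv_cancel,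
          Matrix.SpecialLinearGroup.coe_one, Matrix.vecMul_one]
      right_inv := fun v ↦ by
        beta_reduce
        rw [Matrix.vecMul_vecMul, ← Matrix.SpecialLinearGroup.coe_mul, inv_mul_cancel,
          Matrix.SpecialLinearGroup.coe_one, Matrix.vecMul_one] }
  rw [latticeTheta, latticeTheta, ← e.tsum_eq fun v ↦ Real.exp (-Real.pi * latticeForm τ v * t)]
  exact tsum_congr fun v ↦ by rw [latticeForm_sl_smul]; rfl

theorem epsteinLambda₀_congr {σ τ : ℍ} (h : toModularCurve σ = toModularCurve τ) :
    epsteinLambda₀ σ = epsteinLambda₀ τ := by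
  obtain ⟨γ, rfl⟩ := toModularCurve_eq_iff.1 h
  have : latticeThetaFEPair (γ • τ) = latticeThetaFEPair τ := by
    simp only [latticeThetaFEPair, latticeTheta_smul]
  rw [epsteinLambda₀, this, epsteinLambda₀]

theorem coe_epsteinLambda₀_zero_re (τ : ℍ) :
    (((epsteinLambda₀ τ 0).re : ℝ) : ℂ) = epsteinLambda₀ τ 0 := by
  rw [← integral_latticeThetaModif, Complex.ofReal_re]

theorem sum_heegnerDivisor (D : ℤ) (hD : IsNegFundamentalDiscriminant D) (F : ModularCurve → ℝ) :
    ∑ P ∈ (heegnerDivisor D hD).support, (heegnerDivisor D hD P : ℝ) * F P =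
      2 / (numUnits D : ℝ) * ∑ C, F (heegnerPoint D hD C) := by
  let φ : Divisor →+ ℝ := Finsupp.liftAddHom fun P ↦
    (AddMonoidHom.mulRight (F P)).comp (Rat.castHom ℝ).toAddMonoidHom
  have h1 : φ (heegnerDivisor D hD) =
      ∑ P ∈ (heegnerDivisor D hD).support, (heegnerDivisor D hD P : ℝ) * F P := rfl
  rw [← h1, heegnerDivisor, map_sum, Finset.mul_sum]
  refine Finset.sum_congr rfl fun C _ ↦ ?_
  simp [φ]

theorem numUnits_pos (D : ℤ) (hD : IsNegFundamentalDiscriminant D) : 0 < numUnits D := by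
  obtain ⟨𝔞, a, b, ρ, -, hab, hρ, -⟩ := exists_isOrientedBasis hD 1
  rw [← hab.card_stabilizer hρ]
  exact Nat.card_pos

/-- Dirichlet's class number formula `L(χ_D, 0) = 2 h / w`. -/
theorem kroneckerL_zero (D : ℤ) (hD : IsNegFundamentalDiscriminant D) :
    kroneckerL D hD 0 = 2 * classNumber (quadField D) / numUnits D := by
  obtain ⟨ρ, -, h⟩ := exists_hasSum_latticeTheta hD
  have h1 := (kroneckerL_zero_and_sum_epsteinLambda₀ hD h).1
  have hw : (numUnits D : ℂ) ≠ 0 := by exact_mod_cast (numUnits_pos D hD).ne'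
  rw [eq_div_iff hw]
  linear_combination 2 * h1

theorem weight_isPsi {D : ℤ} {hD : IsNegFundamentalDiscriminant D} {k : ℤ} {Ψ : ModularForm 𝒮ℒ k}
    (hΨ : IsPsi D hD Ψ) : (k : ℚ) = 24 * (classNumber (quadField D) : ℚ) / numUnits D := by
  rw [hΨ.1.weight_eq hΨ.2, degree_heegnerDivisor]
  ring

theorem integral_isPsi {D : ℤ} {hD : IsNegFundamentalDiscriminant D} {k : ℤ}
    {Ψ : ModularForm 𝒮ℒ k} (hΨ : IsPsi D hD Ψ) :
    1 / kroneckerL D hD 0 *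
        ((∫ τ in ModularGroup.fd, logPetersson Ψ τ / (4 * Real.pi) : ℝ) : ℂ) =
      2 * (deriv riemannZeta (-1) / riemannZeta (-1)) + 1
        - deriv (kroneckerL D hD) 0 / kroneckerL D hD 0
        - 1 / 2 * (Real.log |(D : ℝ)| : ℂ) := by
  obtain ⟨ρ, hρ, h⟩ := exists_hasSum_latticeTheta hD
  obtain ⟨hL, hA⟩ := kroneckerL_zero_and_sum_epsteinLambda₀ hD h
  have hw : (numUnits D : ℂ) ≠ 0 := by exact_mod_cast (numUnits_pos D hD).ne'
  have hh : (classNumber (quadField D) : ℂ) ≠ 0 := by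
    exact_mod_cast (Fintype.card_pos (α := ClassGroup (𝓞 (quadField D)))).ne'
  have hL0 : kroneckerL D hD 0 ≠ 0 := by
    rintro h0
    rw [h0, mul_zero] at hL
    exact hh hL.symm
  have hk : (k : ℂ) * numUnits D = 24 * classNumber (quadField D) := by
    have h1 := weight_isPsi hΨ
    rw [eq_div_iff (by exact_mod_cast (numUnits_pos D hD).ne')] at h1
    exact_mod_cast h1
  have hsum : ∑ C, ((((epsteinLambda₀ (heegnerPoint D hD C).out 0).re - 2 : ℝ)) : ℂ) =
      (∑ C, epsteinLambda₀ (ρ C) 0) - 2 * classNumber (quadField D) := by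
    have h1 : ∀ C, ((((epsteinLambda₀ (heegnerPoint D hD C).out 0).re - 2 : ℝ)) : ℂ) =
        epsteinLambda₀ (ρ C) 0 - 2 := by
      intro C
      rw [epsteinLambda₀_congr (τ := ρ C) (by rw [toModularCurve_out, hρ])]
      push_cast
      rw [coe_epsteinLambda₀_zero_re]
    rw [Finset.sum_congr rfl fun C _ ↦ h1 C, Finset.sum_sub_distrib, Finset.sum_const,
      Finset.card_univ, nsmul_eq_mul, mul_comm, classNumber]
  have hlog : (Real.log (4 * Real.pi ^ 2) : ℂ) = 2 * Complex.log (2 * Real.pi) := by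
    rw [show (4 * Real.pi ^ 2 : ℝ) = (2 * Real.pi) ^ 2 by ring, Real.log_pow,
      show (2 * Real.pi : ℂ) = ((2 * Real.pi : ℝ) : ℂ) by push_cast; rfl,
      ← Complex.ofReal_log (by positivity)]
    push_cast
    rfl
  rw [hΨ.1.integral_fd_logPetersson hΨ.2,
    sum_heegnerDivisor D hD fun P ↦ (epsteinLambda₀ P.out 0).re - 2, Complex.ofReal_add,
    Complex.ofReal_mul, Complex.ofReal_sum, hsum, hA, logDeriv_riemannZeta_neg_one]
  push_cast
  rw [hlog]
  have hLw : kroneckerL D hD 0 = 2 * classNumber (quadField D) / numUnits D := kroneckerL_zero D hD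
  have hk' : (k : ℂ) = 24 * classNumber (quadField D) / numUnits D := by
    rw [eq_div_iff hw, hk]
  rw [hLw, hk']
  field_simp
  ring

end HeegnerDivisor

theorem mainTheorem7 (D : ℤ) (hD : HeegnerDivisor.IsNegFundamentalDiscriminant D) :
    (((HeegnerDivisor.heegnerDivisor D hD).degree : ℚ) : ℂ) = HeegnerDivisor.kroneckerL D hD 0 ∧
    (∃! F : (Σ k : ℤ, ModularForm 𝒮ℒ k), HeegnerDivisor.IsPsi D hD F.2) ∧
    ∀ (k : ℤ) (Ψ : ModularForm 𝒮ℒ k), HeegnerDivisor.IsPsi D hD Ψ →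
      (k : ℚ) = 24 * (NumberField.classNumber (HeegnerDivisor.quadField D) : ℚ) /
          (HeegnerDivisor.numUnits D : ℚ) ∧
      MeasureTheory.IntegrableOn (HeegnerDivisor.logPetersson Ψ) ModularGroup.fd
        MeasureTheory.volume ∧
      1 / HeegnerDivisor.kroneckerL D hD 0 *
          ((∫ τ in ModularGroup.fd, HeegnerDivisor.logPetersson Ψ τ / (4 * Real.pi)
            ∂MeasureTheory.volume : ℝ) : ℂ) =
        2 * (deriv riemannZeta (-1) / riemannZeta (-1)) + 1
          - deriv (HeegnerDivisor.kroneckerL D hD) 0 / HeegnerDivisor.kroneckerL D hD 0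
          - 1 / 2 * (Real.log |(D : ℝ)| : ℂ) := by
  refine ⟨?_, HeegnerDivisor.existsUnique_isPsi D hD, fun k Ψ hΨ ↦
    ⟨HeegnerDivisor.weight_isPsi hΨ, HeegnerDivisor.integrableOn_logPetersson hΨ.2,
      HeegnerDivisor.integral_isPsi hΨ⟩⟩
  rw [HeegnerDivisor.degree_heegnerDivisor, HeegnerDivisor.kroneckerL_zero]
  push_cast
  rfl
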